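/- Let $1<p<n$, $p^*=\frac{np}{n-p}$, let $\Omega\subset\mathbb R^n$ be a bounded open set and $d\in\mathbb N$. Assume: (i) $A:\overline\Omega\to M(n;\mathbb R)$ is continuous, $A(x)$ is symmetric for every $x\in\overline\Omega$, and there is $\tau>0$ with $\tau|\xi|^2\le\langle A(x)\xi,\xi\rangle$ for all $(x,\xi)\in\overline\Omega\times\mathbb R^n$; (ii) $F\in C^1(\mathbb R^d)$ satisfies $F(\varrho s)=\varrho^pF(s)$ for all $\varrho>0$, $s\in\mathbb R^d$, and $0<M_F<\lambda_1(A,p)$, where $M_F=\max\{F(s):|s_1|^p+\dots+|s_d|^p=1\}$ and $$\lambda_1(A,p)=\inf\Big\{\int_\Omega\langle A\nabla u,\nabla u\rangle^{p/2}\,dx:\ u\in W_0^{1,p}(\Omega),\ \|u\|_{L^p(\Omega)}=1\Big\};$$ (iii) $G\in C^1(\mathbb R^d)$ satisfies $G(\varrho s)=\varrho^{p^*}G(s)$ for all $\varrho>0$, $s\in\mathbb R^d$, and $G(s)>0$ for $s\ne0$. Let $\mathcal W=W_0^{1,p}(\Omega;\mathbb R^d)$, and for $\boldsymbol u=(u_1,\dots,u_d)\in\mathcal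 W$ put $$\|\boldsymbol u\|_{\mathcal W_A}^p=\sum_{j=1}^d\int_\Omega\langle A\nabla u_j,\nabla u_j\rangle^{p/2}\,dx,\qquad \|\boldsymbol u\|_{L^p(\Omega;\mathbb R^d)}^p=\sum_{j=1}^d\int_\Omega|u_j|^p\,dx,\qquad \Phi(\boldsymbol u)=\|\boldsymbol u\|_{\mathcal W_A}^p-\int_\Omega F(\boldsymbol u)\,dx.$$ Let $\mathcal M=\{\boldsymbol u\in\mathcal W:\int_\Omega G(\boldsymbol u)\,dx=1\}$, let $K=K(A,F,G)$ be given by $K^{-1}=\inf_{\mathcal M}\Phi$, and let $\mathcal N(A;G)$ be the infimum of all $C_1$ for which there is $C_2>0$ such that $$\Big(\int_\Omega G(\boldsymbol u)\,dx\Big)^{p/p^*}\le C_1\|\boldsymbol u\|_{\mathcal W_A}^p+C_2\|\boldsymbol u\|_{L^p(\Omega;\mathbb R^d)}^p\qquad\text{for all }\boldsymbol u\in\mathcal W.$$ If $\mathcal N(A;G)<K(A,F,G)$, then there is $\boldsymbol u\in\mathcal M$ with $\Phi(\boldsymbol u)=K^{-1}$, that is, the infimum of $\Phi$ on $\mathcal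 M$ is attained. Moreover, there is then a nontrivial weak solution of $$-\operatorname{div}\big(\langle A\nabla u_j,\nabla u_j\rangle^{\frac{p-2}2}A\nabla u_j\big)=\tfrac1p\,\partial_jF(\boldsymbol u)+\tfrac1{p^*}\,\partial_jG(\boldsymbol u)\ \text{ in }\Omega,\quad j=1,\dots,d,\qquad \boldsymbol u=0\ \text{ on }\partial\Omega,$$ i.e. some $\boldsymbol u\in\mathcal W$, not a.e. zero, with $$\int_\Omega\langle A\nabla u_j,\nabla u_j\rangle^{\frac{p-2}2}\langle A\nabla u_j,\nabla\varphi\rangle\,dx=\int_\Omega\Big(\tfrac1p\,\partial_jF(\boldsymbol u)+\tfrac1{p^*}\,\partial_jG(\boldsymbol u)\Big)\varphi\,dx$$ for all $j\in\{1,\dots,d\}$ and all $\varphi\in W_0^{1,p}(\Omega)$. -/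

import Mathlib

open MeasureTheory
open scoped ContDiff

noncomputable section

namespace AnisoSystem

/-- Euclidean space `ℝⁿ`. -/
abbrev Eucl (n : ℕ) : Type := EuclideanSpace ℝ (Fin n)

/-- The exponent `p > 1`, seen as an exponent of `Lp` spaces, is at least `1`. -/
instance fact_one_le_ofReal (p : ℝ) [h : Fact (1 < p)] : Fact (1 ≤ ENNReal.ofReal p) :=
  ⟨by simpa using ENNReal.ofReal_le_ofReal h.out.le⟩

/-- The critical Sobolev exponent `p^* = n p / (n - p)`, for `p < n`. -/
def critExp (n : ℕ) (p : ℝ) : ℝ := n * p / (n - p)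

/-- The bilinear form `⟨M ξ, η⟩` of a matrix `M`. -/
def matForm {n : ℕ} (M : Matrix (Fin n) (Fin n) ℝ) (ξ η : Eucl n) : ℝ :=
  inner ℝ (Matrix.toEuclideanLin M ξ) η

/-! ### The Sobolev space `W_0^{1,p}(Ω)` -/

/-- `L^p(Ω) × L^p(Ω; ℝⁿ)`, where a scalar function on `Ω` lives together with its gradient. -/
abbrev LpPair {n : ℕ} (p : ℝ) (Ω : Set (Eucl n)) : Type :=
  Lp ℝ (ENNReal.ofReal p) (volume.restrict Ω) ×
    Lp (Eucl n) (ENNReal.ofReal p) (volume.restrict Ω)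

lemma gradient_add_of_contDiff {n : ℕ} {f g : Eucl n → ℝ}
    (hf : ContDiff ℝ ∞ f) (hg : ContDiff ℝ ∞ g) :
    gradient (f + g) = gradient f + gradient g := by
  funext x
  have hf' : DifferentiableAt ℝ f x := (hf.differentiable (by simp)).differentiableAt
  have hg' : DifferentiableAt ℝ g x := (hg.differentiable (by simp)).differentiableAt
  simp only [gradient, Pi.add_apply]
  rw [fderiv_add hf' hg', map_add]

lemma gradient_smul_of_contDiff {n : ℕ} {f : Eucl n → ℝ} (hf : ContDiff ℝ ∞ f) (c : ℝ) :
    gradient (c • f) = c • gradient f := by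
  funext x
  have hf' : DifferentiableAt ℝ f x := (hf.differentiable (by simp)).differentiableAt
  simp only [gradient, Pi.smul_apply]
  rw [fderiv_const_smul hf' c]
  simp

/-- The pairs `(φ, ∇φ)` with `φ ∈ C_c^∞(Ω)`. -/
def testPairs {n : ℕ} (p : ℝ) (Ω : Set (Eucl n)) : Submodule ℝ (LpPair p Ω) where
  carrier := {w | ∃ φ : Eucl n → ℝ, ContDiff ℝ ∞ φ ∧ HasCompactSupport φ ∧ tsupport φ ⊆ Ω ∧
    w.1 =ᵐ[volume.restrict Ω] φ ∧ w.2 =ᵐ[volume.restrict Ω] gradient φ}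
  add_mem' := by
    rintro v w ⟨φ, hφ, hφc, hφs, hv1, hv2⟩ ⟨ψ, hψ, hψc, hψs, hw1, hw2⟩
    refine ⟨φ + ψ, hφ.add hψ, hφc.add hψc,
      (tsupport_add φ ψ).trans (Set.union_subset hφs hψs), ?_, ?_⟩
    · exact (Lp.coeFn_add _ _).trans (hv1.add hw1)
    · rw [gradient_add_of_contDiff hφ hψ]
      exact (Lp.coeFn_add _ _).trans (hv2.add hw2)
  zero_mem' := by
    refine ⟨0, contDiff_zero_fun, HasCompactSupport.zero, by simp [tsupport], ?_, ?_⟩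
    · exact Lp.coeFn_zero _ _ _
    · have h : gradient (0 : Eucl n → ℝ) = 0 := by
        funext x
        simp [gradient]
      rw [h]
      exact Lp.coeFn_zero _ _ _
  smul_mem' := by
    rintro c v ⟨φ, hφ, hφc, hφs, hv1, hv2⟩
    refine ⟨c • φ, contDiff_const.smul hφ, hφc.smul_left, ?_, ?_, ?_⟩
    · exact (closure_mono (Function.support_const_smul_subset c φ)).trans hφs
    · exact (Lp.coeFn_smul _ _).trans (hv1.const_smul c)
    · rw [gradient_smul_of_contDiff hφ c]
      exact (Lp.coeFn_smul _ _).trans (hv2.const_smul c)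

/-- The Sobolev space `W_0^{1,p}(Ω)`, i.e. the closure of `C_c^∞(Ω)` in the `W^{1,p}`-norm. A
function `u` is recorded as the pair `(u, ∇u)` of the function and its weak gradient, and the
closure is taken in `L^p(Ω) × L^p(Ω; ℝⁿ)`. -/
def W0 {n : ℕ} (p : ℝ) [Fact (1 < p)] (Ω : Set (Eucl n)) : Submodule ℝ (LpPair p Ω) :=
  (testPairs p Ω).topologicalClosure

section Functionals

variable {n d : ℕ} {p : ℝ} [Fact (1 < p)] {Ω : Set (Eucl n)}

/-- The function `u` underlying an element of `W_0^{1,p}(Ω)`. -/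
def W0.fn (u : W0 p Ω) : Eucl n → ℝ := (u : LpPair p Ω).1

/-- The weak gradient `∇u` of an element of `W_0^{1,p}(Ω)`. -/
def W0.grad (u : W0 p Ω) : Eucl n → Eucl n := (u : LpPair p Ω).2

/-- The space `𝒲 = W_0^{1,p}(Ω; ℝ^d)`, a product of `d` copies of `W_0^{1,p}(Ω)`. -/
abbrev W0Vec (p : ℝ) [Fact (1 < p)] (Ω : Set (Eucl n)) (d : ℕ) : Type := Fin d → W0 p Ω

/-- The `ℝ^d`-valued function underlying an element of `𝒲`. -/
def W0Vec.fn (u : W0Vec p Ω d) (x : Eucl n) : Fin d → ℝ := fun j => W0.fn (u j) x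

/-- `‖u‖_{W_{0,A}^{1,p}}^p = ∫_Ω ⟨A(x) ∇u, ∇u⟩^{p/2} dx`. -/
def normApow (A : Eucl n → Matrix (Fin n) (Fin n) ℝ) (u : W0 p Ω) : ℝ :=
  ∫ x in Ω, (matForm (A x) (W0.grad u x) (W0.grad u x)) ^ (p / 2)

/-- `‖u‖_{𝒲_A}^p`, the sum of the `‖u_j‖_{W_{0,A}^{1,p}}^p`. -/
def normApowVec (A : Eucl n → Matrix (Fin n) (Fin n) ℝ) (u : W0Vec p Ω d) : ℝ :=
  ∑ j, normApow A (u j)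

/-- `‖u‖_p^p = ∫_Ω |u|^p dx`. -/
def normLpow (u : W0 p Ω) : ℝ := ∫ x in Ω, |W0.fn u x| ^ p

/-- `‖u‖_{L^p(Ω; ℝ^d)}^p`, the sum of the `‖u_j‖_p^p`. -/
def normLpowVec (u : W0Vec p Ω d) : ℝ := ∑ j, normLpow (u j)

/-- `∫_Ω H(u) dx`. -/
def integralOf (H : (Fin d → ℝ) → ℝ) (u : W0Vec p Ω d) : ℝ := ∫ x in Ω, H (u.fn x)

/-- The energy `Φ_{A,F}(u) = ‖u‖_{𝒲_A}^p - ∫_Ω F(u) dx`. -/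
def energy (A : Eucl n → Matrix (Fin n) (Fin n) ℝ) (F : (Fin d → ℝ) → ℝ)
    (u : W0Vec p Ω d) : ℝ :=
  normApowVec A u - integralOf F u

/-- The constraint set `ℳ = {u ∈ 𝒲 : ∫_Ω G(u) dx = 1}`. -/
def constraintSet (p : ℝ) [Fact (1 < p)] (Ω : Set (Eucl n)) (G : (Fin d → ℝ) → ℝ) :
    Set (W0Vec p Ω d) :=
  {u | integralOf G u = 1}

/-- The first eigenvalue `λ₁(A, p) = inf {‖u‖_{W_{0,A}^{1,p}}^p : ‖u‖_p = 1}`. -/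
def lambdaOne (p : ℝ) [Fact (1 < p)] (Ω : Set (Eucl n))
    (A : Eucl n → Matrix (Fin n) (Fin n) ℝ) : ℝ :=
  sInf (normApow A '' {u : W0 p Ω | normLpow u = 1})

/-- The Sobolev inequality with lower-order term
`(∫_Ω G(u) dx)^{p/p^*} ≤ C₁ ‖u‖_{𝒲_A}^p + C₂ ‖u‖_{L^p}^p` on `𝒲`. -/
def SobolevIneq (p : ℝ) [Fact (1 < p)] (Ω : Set (Eucl n))
    (A : Eucl n → Matrix (Fin n) (Fin n) ℝ) (G : (Fin d → ℝ) → ℝ) (C₁ C₂ : ℝ) : Prop :=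
  ∀ u : W0Vec p Ω d,
    (integralOf G u) ^ (p / critExp n p) ≤ C₁ * normApowVec A u + C₂ * normLpowVec u

/-- The sharp constant `𝒩(A; G)`: the infimum of all `C₁` for which the Sobolev inequality with
lower-order term holds with some `C₂ > 0`. -/
def sharpN (p : ℝ) [Fact (1 < p)] (Ω : Set (Eucl n))
    (A : Eucl n → Matrix (Fin n) (Fin n) ℝ) (G : (Fin d → ℝ) → ℝ) : ℝ :=
  sInf {C₁ : ℝ | ∃ C₂ : ℝ, 0 < C₂ ∧ SobolevIneq p Ω A G C₁ C₂}

/-- `K(A, F, G)`, defined by `K(A, F, G)⁻¹ = inf {Φ_{A,F}(u) : u ∈ ℳ}`. -/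
def energyK (p : ℝ) [Fact (1 < p)] (Ω : Set (Eucl n))
    (A : Eucl n → Matrix (Fin n) (Fin n) ℝ) (F G : (Fin d → ℝ) → ℝ) : ℝ :=
  (sInf (energy A F '' constraintSet p Ω G))⁻¹

/-- The `j`-th partial derivative of a function on `ℝ^d`. -/
def partialD (H : (Fin d → ℝ) → ℝ) (j : Fin d) (s : Fin d → ℝ) : ℝ :=
  fderiv ℝ H s (Pi.single j 1)

/-- `u ∈ 𝒲` is a weak solution of `-L_{A,p} u = (1/p) ∇F(u) + (1/p^*) ∇G(u)` in `Ω`, `u = 0` on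
`∂Ω`: for every `j`, the `j`-th equation holds in the dual of `W_0^{1,p}(Ω)`. -/
def IsWeakSolution (A : Eucl n → Matrix (Fin n) (Fin n) ℝ) (F G : (Fin d → ℝ) → ℝ)
    (u : W0Vec p Ω d) : Prop :=
  ∀ (j : Fin d) (φ : W0 p Ω),
    ∫ x in Ω, (matForm (A x) (W0.grad (u j) x) (W0.grad (u j) x)) ^ ((p - 2) / 2) *
        matForm (A x) (W0.grad (u j) x) (W0.grad φ x) =
      ∫ x in Ω, (1 / p * partialD F j (u.fn x) + 1 / critExp n p * partialD G j (u.fn x)) *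
        W0.fn φ x

/-- `u ∈ 𝒲` is nontrivial: some component is not a.e. zero on `Ω`. -/
def IsNontrivial (u : W0Vec p Ω d) : Prop :=
  ∃ j, ¬ (W0.fn (u j) =ᵐ[volume.restrict Ω] 0)

end Functionals

/-! ### Structural assumptions -/

/-- `A : closure Ω → M(n; ℝ)` is continuous, symmetric and uniformly positive definite. Values of
`A` outside `closure Ω` play no role. -/
structure IsElliptic {n : ℕ} (Ω : Set (Eucl n)) (A : Eucl n → Matrix (Fin n) (Fin n) ℝ) :
    Prop where
  continuousOn : ContinuousOn A (closure Ω)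
  symm : ∀ x ∈ closure Ω, (A x).transpose = A x
  posDef : ∃ τ : ℝ, 0 < τ ∧ ∀ x ∈ closure Ω, ∀ ξ : Eucl n, τ * ‖ξ‖ ^ 2 ≤ matForm (A x) ξ ξ

/-- `H(ϱ s) = ϱ^q H(s)` for all `ϱ > 0` and all `s`. -/
def IsHomogeneous {d : ℕ} (q : ℝ) (H : (Fin d → ℝ) → ℝ) : Prop :=
  ∀ (ϱ : ℝ) (s : Fin d → ℝ), 0 < ϱ → H (ϱ • s) = ϱ ^ q * H s

/-- Homogeneous of degree `q` and positive away from the origin. -/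
def IsPosHomogeneous {d : ℕ} (q : ℝ) (H : (Fin d → ℝ) → ℝ) : Prop :=
  IsHomogeneous q H ∧ ∀ s, s ≠ 0 → 0 < H s

/-- The `p`-sphere `{s ∈ ℝ^d : |s_1|^p + … + |s_d|^p = 1}`. -/
def pSphere (d : ℕ) (p : ℝ) : Set (Fin d → ℝ) := {s | ∑ j, |s j| ^ p = 1}

/-- `M_F`, the maximum of `F` over the `p`-sphere. -/
def maxOnSphere {d : ℕ} (p : ℝ) (F : (Fin d → ℝ) → ℝ) : ℝ := sSup (F '' pSphere d p)

/-- The standing assumptions on `A`, `F`, `G`. -/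
structure AssumptionsAFG {n d : ℕ} (p : ℝ) [Fact (1 < p)] (Ω : Set (Eucl n))
    (A : Eucl n → Matrix (Fin n) (Fin n) ℝ) (F G : (Fin d → ℝ) → ℝ) : Prop where
  elliptic : IsElliptic Ω A
  contDiff_F : ContDiff ℝ 1 F
  homogeneous_F : IsHomogeneous p F
  maxF_pos : 0 < maxOnSphere p F
  maxF_lt : maxOnSphere p F < lambdaOne p Ω A
  contDiff_G : ContDiff ℝ 1 G
  posHomogeneous_G : IsPosHomogeneous (critExp n p) G

end AnisoSystem

end

/-! This is the direct method, with the critical growth of G as the only obstruction. Write m = K⁻¹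
and θ = p/p*, so 0 < θ < 1. Since M_F < λ₁, the energy Φ dominates a multiple of ‖u‖^p in the
𝒲_A-norm (`AssumptionsAFG.coercive`); with the Sobolev inequality this gives m > 0, and homogeneity
gives m (∫ G(u))^θ ≤ Φ(u) on all of 𝒲 (`sInf_energy_mul_le`). A minimizing sequence u_k is therefore
bounded. Along a subsequence it converges in L^p and a.e. to some v ∈ 𝒲, the integrals of F
converge, and the gradient energy is lower semicontinuous. What could be lost in the limit is part
of the mass ∫ G(u_k) = 1.

The loss is excluded by cutting u_k at a fixed height. For the truncation T(s) = arctan(e s)/e, the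
pieces T(u_k) and u_k - T(u_k) have gradients t ∇u_k and (1 - t) ∇u_k with 0 ≤ t ≤ 1, so their
gradient energies add up to at most that of u_k; no convergence of gradients is needed. For e small
and then k large, the pieces carry masses close to τ = ∫ G(v) and 1 - τ (`eventually_split`). Hence
m τ^θ + m (1 - τ)^θ ≤ m, which forces τ = 0 or τ = 1. If τ = 0, then u_k → 0 in L^p, and the Sobolev
inequality with some C₁ < K yields 1 ≤ C₁ m < 1. So τ = 1, v is admissible, and lower semicontinuity
makes it a minimizer.

For the system, Φ - m (∫ G)^θ is nonnegative on 𝒲 and vanishes at the minimizer, so its directional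
derivatives vanish there; multiplying the minimizer by c with c^(p* - p) = m removes the factor m.

One compactness principle for homogeneous functions, `Homog.exists_le`, yields the growth bounds,
the Brezis–Lieb inequality and the uniform convexity of ‖·‖^p. Uniform convexity replaces weak
compactness in the proof of lower semicontinuity, and Rellich's theorem is proved by mollification.
-/

noncomputable section

namespace AnisoSystem

open Filter Topology

/-! ### Homogeneous functions on finite-dimensional spaces -/

section Homogeneous

variable {E : Type*} [NormedAddCommGroup E] [NormedSpace ℝ E] {q : ℝ}

/-- Positive homogeneity of degree `q` of a function on a real vector space. -/
def Homog (q : ℝ) (f : E → ℝ) : Prop := ∀ (r : ℝ) (s : E), 0 < r → f (r • s) = r ^ q * f s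

lemma Homog.map_zero {f : E → ℝ} (hf : Homog q f) (hq : 0 < q) : f 0 = 0 := by
  have h := hf 2 0 two_pos
  rw [smul_zero] at h
  have h2 : (1 : ℝ) < 2 ^ q := Real.one_lt_rpow one_lt_two hq
  nlinarith

lemma Homog.abs {f : E → ℝ} (hf : Homog q f) : Homog q fun s => |f s| := fun r s hr => by
  simp only [hf r s hr, abs_mul, abs_of_pos (Real.rpow_pos_of_pos hr q)]

lemma homog_norm_rpow (q : ℝ) : Homog q fun s : E => ‖s‖ ^ q := fun r s hr => by
  simp only [norm_smul, Real.norm_eq_abs, abs_of_pos hr]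
  exact Real.mul_rpow hr.le (norm_nonneg _)

lemma Homog.sub {f g : E → ℝ} (hf : Homog q f) (hg : Homog q g) :
    Homog q fun s => f s - g s := fun r s hr => by
  simp only [hf r s hr, hg r s hr, mul_sub]

lemma Homog.comp_linear {E' : Type*} [NormedAddCommGroup E'] [NormedSpace ℝ E'] {f : E → ℝ}
    (hf : Homog q f) (L : E' →ₗ[ℝ] E) : Homog q fun s => f (L s) := fun r s hr => by
  simp only [map_smul, hf r _ hr]

omit [NormedSpace ℝ E] in
lemma continuous_norm_rpow (hq : 0 < q) : Continuous fun s : E => ‖s‖ ^ q :=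
  continuous_norm.rpow_const fun _ => Or.inr hq.le

/-- Compactness principle for homogeneous functions: if `f ≤ 0` wherever the function `g ≥ 0` vanishes, then
`f` is bounded by a multiple of `g` up to an arbitrarily small homogeneous error. -/
lemma Homog.exists_le [FiniteDimensional ℝ E] (hq : 0 < q) {f g : E → ℝ} (hfc : Continuous f)
    (hgc : Continuous g) (hf : Homog q f) (hg : Homog q g) (hg0 : ∀ x, 0 ≤ g x)
    (h : ∀ x, g x = 0 → f x ≤ 0) {ε : ℝ} (hε : 0 < ε) :
    ∃ C, 0 ≤ C ∧ ∀ x, f x ≤ ε * ‖x‖ ^ q + C * g x := by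
  have hpr : ProperSpace E := FiniteDimensional.proper ℝ E
  -- On this part of the unit sphere g cannot vanish, so max f / min g serves as C; on the rest of
  -- the sphere f < ε already.
  set S : Set E := Metric.sphere 0 1 ∩ {x | ε ≤ f x} with hS
  have hSc : IsCompact S := (isCompact_sphere 0 1).inter_right (isClosed_le continuous_const hfc)
  obtain ⟨C, hC0, hC⟩ : ∃ C, 0 ≤ C ∧ ∀ x ∈ S, f x ≤ C * g x := by
    rcases S.eq_empty_or_nonempty with he | hne
    · exact ⟨0, le_rfl, by simp [he]⟩
    obtain ⟨x₀, hx₀, hmin⟩ := hSc.exists_isMinOn hne hgc.continuousOn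
    obtain ⟨x₁, hx₁, hmax⟩ := hSc.exists_isMaxOn hne hfc.continuousOn
    have hg₀ : 0 < g x₀ := by
      refine lt_of_le_of_ne (hg0 _) fun h0 => ?_
      have := h x₀ h0.symm
      have h2 : ε ≤ f x₀ := hx₀.2
      linarith
    have hf₁ : 0 < f x₁ := hε.trans_le hx₁.2
    refine ⟨f x₁ / g x₀, by positivity, fun x hx => ?_⟩
    calc f x ≤ f x₁ := hmax hx
      _ = f x₁ / g x₀ * g x₀ := by field_simp
      _ ≤ f x₁ / g x₀ * g x := by gcongr; exact hmin hx
  refine ⟨C, hC0, fun x => ?_⟩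
  rcases eq_or_ne x 0 with rfl | hx
  · rw [hf.map_zero hq, hg.map_zero hq]
    simp [Real.zero_rpow hq.ne']
  have hn : 0 < ‖x‖ := norm_pos_iff.2 hx
  have hx' : ‖x‖ • (‖x‖⁻¹ • x) = x := by rw [smul_smul, mul_inv_cancel₀ hn.ne', one_smul]
  have hy : ‖x‖⁻¹ • x ∈ Metric.sphere (0 : E) 1 := by
    simp [norm_smul, hn.ne']
  have key : f (‖x‖⁻¹ • x) ≤ ε + C * g (‖x‖⁻¹ • x) := by
    by_cases hyS : ε ≤ f (‖x‖⁻¹ • x)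
    · have := hC _ ⟨hy, hyS⟩
      linarith
    · have := mul_nonneg hC0 (hg0 (‖x‖⁻¹ • x))
      linarith
  have e1 := hf ‖x‖ (‖x‖⁻¹ • x) hn
  have e2 := hg ‖x‖ (‖x‖⁻¹ • x) hn
  rw [hx'] at e1 e2
  rw [e1, e2]
  have := mul_le_mul_of_nonneg_left key (Real.rpow_nonneg hn.le q)
  linarith

/-- The compactness principle with g = ‖·‖^q, which vanishes only at the origin. -/
lemma Homog.exists_growth [FiniteDimensional ℝ E] (hq : 0 < q) {f : E → ℝ} (hfc : Continuous f)
    (hf : Homog q f) : ∃ C, 0 ≤ C ∧ ∀ x, |f x| ≤ C * ‖x‖ ^ q := by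
  obtain ⟨C, hC0, hC⟩ := Homog.exists_le hq hfc.abs (continuous_norm_rpow hq) hf.abs
    (homog_norm_rpow q) (fun x => by positivity) (fun x hx => by
      have : x = 0 := by
        by_contra h
        exact (Real.rpow_pos_of_pos (norm_pos_iff.2 h) q).ne' hx
      simp [this, hf.map_zero hq]) one_pos
  exact ⟨1 + C, by positivity, fun x => (hC x).trans (by rw [add_mul])⟩

lemma rpow_max_le {a b : ℝ} (ha : 0 ≤ a) (hb : 0 ≤ b) : max a b ^ q ≤ a ^ q + b ^ q := by
  rcases max_cases a b with ⟨h, _⟩ | ⟨h, _⟩ <;> rw [h]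
  · linarith [Real.rpow_nonneg hb q]
  · linarith [Real.rpow_nonneg ha q]

omit [NormedSpace ℝ E] in
lemma prod_norm_rpow_le (a b : E) : ‖(a, b)‖ ^ q ≤ ‖a‖ ^ q + ‖b‖ ^ q :=
  rpow_max_le (norm_nonneg _) (norm_nonneg _)

omit [NormedSpace ℝ E] in
lemma eq_zero_of_norm_rpow_eq_zero {x : E} (h : ‖x‖ ^ q = 0) : x = 0 := by
  by_contra hx
  exact (Real.rpow_pos_of_pos (norm_pos_iff.2 hx) q).ne' h

/-- The compactness principle on E × E: the left side vanishes where b = 0, so ‖b‖^q can serve as g.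
The norm of the pair is split into its two components, which turns C into ε + C. -/
lemma Homog.exists_abs_add_sub_le [FiniteDimensional ℝ E] (hq : 0 < q) {f : E → ℝ}
    (hfc : Continuous f) (hf : Homog q f) {ε : ℝ} (hε : 0 < ε) :
    ∃ C, 0 ≤ C ∧ ∀ a b, |f (a + b) - f a| ≤ ε * ‖a‖ ^ q + C * ‖b‖ ^ q := by
  have h1 : Homog q fun x : E × E => f (x.1 + x.2) :=
    hf.comp_linear (LinearMap.fst ℝ E E + LinearMap.snd ℝ E E)
  have h2 : Homog q fun x : E × E => f x.1 := hf.comp_linear (LinearMap.fst ℝ E E)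
  have h3 : Homog q fun x : E × E => ‖x.2‖ ^ q :=
    (homog_norm_rpow q).comp_linear (LinearMap.snd ℝ E E)
  obtain ⟨C, hC0, hC⟩ := Homog.exists_le (E := E × E) hq
    (f := fun x => |f (x.1 + x.2) - f x.1|) (g := fun x => ‖x.2‖ ^ q)
    (by fun_prop) ((continuous_norm_rpow hq).comp continuous_snd) (h1.sub h2).abs h3
    (fun x => by positivity)
    (fun x hx => by simp [eq_zero_of_norm_rpow_eq_zero hx]) hε
  refine ⟨ε + C, by positivity, fun a b => (hC (a, b)).trans ?_⟩
  have := mul_le_mul_of_nonneg_left (prod_norm_rpow_le (q := q) a b) hε.le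
  simp only
  linarith

/-- The pointwise inequality behind the Brezis–Lieb lemma. -/
lemma Homog.exists_abs_add_sub_sub_le [FiniteDimensional ℝ E] (hq : 0 < q) {f : E → ℝ}
    (hfc : Continuous f) (hf : Homog q f) {ε : ℝ} (hε : 0 < ε) :
    ∃ C, 0 ≤ C ∧ ∀ a b, |f (a + b) - f a - f b| ≤ ε * ‖b‖ ^ q + C * ‖a‖ ^ q := by
  obtain ⟨C, hC0, hC⟩ := hf.exists_abs_add_sub_le hq hfc hε
  obtain ⟨D, hD0, hD⟩ := hf.exists_growth hq hfc
  refine ⟨C + D, by positivity, fun a b => ?_⟩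
  -- The roles are exchanged: b is the base point and a the perturbation. The remaining term f(a) is
  -- absorbed by the growth bound.
  have h1 := hC b a
  have h2 := hD a
  rw [add_comm b a] at h1
  have h3 : f (a + b) - f a - f b = (f (a + b) - f b) - f a := by ring
  rw [h3]
  calc _ ≤ |f (a + b) - f b| + |f a| := abs_sub _ _
    _ ≤ _ := by linarith

end Homogeneous

/-! ### Uniform convexity of powers of a Euclidean norm -/

section UniformConvexity

variable {E : Type*} [NormedAddCommGroup E] [InnerProductSpace ℝ E] {p : ℝ}

lemma norm_midpoint_rpow_le (hp : 1 < p) (a b : E) :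
    ‖(2⁻¹ : ℝ) • (a + b)‖ ^ p ≤ (‖a‖ ^ p + ‖b‖ ^ p) / 2 := by
  have h := (convexOn_rpow hp.le).2 (norm_nonneg a) (norm_nonneg b)
    (by norm_num : (0 : ℝ) ≤ 2⁻¹) (by norm_num : (0 : ℝ) ≤ 2⁻¹) (by norm_num)
  simp only [smul_eq_mul] at h
  have h1 : ‖(2⁻¹ : ℝ) • (a + b)‖ ≤ 2⁻¹ * ‖a‖ + 2⁻¹ * ‖b‖ := by
    rw [norm_smul]
    have := norm_add_le a b
    norm_num
    linarith
  calc _ ≤ (2⁻¹ * ‖a‖ + 2⁻¹ * ‖b‖) ^ p := by gcongr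
    _ ≤ _ := by linarith

/-- If ‖a‖ ≠ ‖b‖, strict convexity of t ↦ t^p gives a strict inequality; if the norms agree, strict
convexity of the inner product norm does, since distinct vectors of equal norm lie on different
rays. -/
lemma eq_of_norm_midpoint_rpow_eq (hp : 1 < p) (a b : E)
    (h : (‖a‖ ^ p + ‖b‖ ^ p) / 2 - ‖(2⁻¹ : ℝ) • (a + b)‖ ^ p = 0) : a = b := by
  have h1 : ‖(2⁻¹ : ℝ) • (a + b)‖ ≤ 2⁻¹ * ‖a‖ + 2⁻¹ * ‖b‖ := by
    rw [norm_smul]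
    have := norm_add_le a b
    norm_num
    linarith
  by_cases hab : ‖a‖ = ‖b‖
  · by_contra hne
    have h2 : ‖a + b‖ < ‖a‖ + ‖b‖ := by
      exact not_sameRay_iff_norm_add_lt.1 fun hs => hne ((sameRay_iff_of_norm_eq hab).1 hs)
    have h3 : ‖(2⁻¹ : ℝ) • (a + b)‖ < ‖a‖ := by
      rw [norm_smul]
      norm_num
      linarith
    have h4 := Real.rpow_lt_rpow (norm_nonneg _) h3 (by linarith : 0 < p)
    rw [← hab] at h
    linarith
  · have h2 := (strictConvexOn_rpow hp).2 (norm_nonneg a) (norm_nonneg b) hab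
      (by norm_num : (0 : ℝ) < 2⁻¹) (by norm_num : (0 : ℝ) < 2⁻¹) (by norm_num)
    simp only [smul_eq_mul] at h2
    have h3 : ‖(2⁻¹ : ℝ) • (a + b)‖ ^ p ≤ (2⁻¹ * ‖a‖ + 2⁻¹ * ‖b‖) ^ p := by gcongr
    linarith

/-- Uniform convexity by compactness, for all p > 1 at once: the midpoint gap is homogeneous,
nonnegative and zero only on the diagonal, where ‖a - b‖^p vanishes too. -/
lemma exists_norm_sub_rpow_le [FiniteDimensional ℝ E] (hp : 1 < p) {ε : ℝ} (hε : 0 < ε) :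
    ∃ C, 0 ≤ C ∧ ∀ a b : E, ‖a - b‖ ^ p ≤ ε * (‖a‖ ^ p + ‖b‖ ^ p) +
      C * ((‖a‖ ^ p + ‖b‖ ^ p) / 2 - ‖(2⁻¹ : ℝ) • (a + b)‖ ^ p) := by
  have hp0 : 0 < p := by linarith
  have hsub : Homog p fun x : E × E => ‖x.1 - x.2‖ ^ p :=
    (homog_norm_rpow p).comp_linear (LinearMap.fst ℝ E E - LinearMap.snd ℝ E E)
  have hgap : Homog p fun x : E × E =>
      (‖x.1‖ ^ p + ‖x.2‖ ^ p) / 2 - ‖(2⁻¹ : ℝ) • (x.1 + x.2)‖ ^ p := fun r s hr => by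
    have e1 := (homog_norm_rpow (E := E) p) r s.1 hr
    have e2 := (homog_norm_rpow (E := E) p) r s.2 hr
    have e3 := (homog_norm_rpow (E := E) p) r ((2⁻¹ : ℝ) • (s.1 + s.2)) hr
    simp only at e1 e2 e3
    have e4 : r • (2⁻¹ : ℝ) • (s.1 + s.2) = (2⁻¹ : ℝ) • (r • s.1 + r • s.2) := by
      rw [smul_comm, smul_add]
    rw [e4] at e3
    simp only [Prod.smul_fst, Prod.smul_snd, e1, e2, e3]
    ring
  obtain ⟨C, hC0, hC⟩ := Homog.exists_le (E := E × E) hp0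
    ((continuous_norm_rpow hp0).comp (continuous_fst.sub continuous_snd))
    (by
      have h1 := (continuous_norm_rpow (E := E) hp0).comp (continuous_fst (X := E) (Y := E))
      have h2 := (continuous_norm_rpow (E := E) hp0).comp (continuous_snd (X := E) (Y := E))
      have h3 := (continuous_norm_rpow (E := E) hp0).comp
        ((continuous_fst (X := E) (Y := E)).add continuous_snd |>.const_smul (2⁻¹ : ℝ))
      exact ((h1.add h2).div_const 2).sub h3)
    hsub hgap
    (fun x => by linarith [norm_midpoint_rpow_le hp x.1 x.2])
    (fun x hx => by
      have := eq_of_norm_midpoint_rpow_eq hp x.1 x.2 hx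
      simp [this, Real.zero_rpow hp0.ne']) hε
  refine ⟨C, hC0, fun a b => (hC (a, b)).trans ?_⟩
  have := mul_le_mul_of_nonneg_left (prod_norm_rpow_le (q := p) a b) hε.le
  simp only
  linarith

end UniformConvexity

/-! ### Gram factorization of the matrices, and auxiliary facts on integrals and limits -/

section
open scoped MatrixOrder ComplexOrder
/-- A symmetric matrix with nonnegative form is the Gram matrix of a linear map. -/
lemma exists_matForm_eq_inner {n : ℕ} {M : Matrix (Fin n) (Fin n) ℝ} (hM : M.transpose = M)
    (hpos : ∀ ξ, 0 ≤ matForm M ξ ξ) :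
    ∃ B : Eucl n →ₗ[ℝ] Eucl n, ∀ ξ η, matForm M ξ η = inner ℝ (B ξ) (B η) := by
  have hps : M.PosSemidef := by
    rw [← Matrix.isPositive_toEuclideanLin_iff]
    refine ⟨?_, fun x => by simpa [matForm] using hpos x⟩
    rw [Matrix.isSymmetric_toEuclideanLin_iff]
    exact hM
  have h1 : CFC.sqrt M * CFC.sqrt M = M := CFC.sqrt_mul_sqrt_self M hps.nonneg
  have h2 : (CFC.sqrt M).conjTranspose = CFC.sqrt M :=
    (Matrix.nonneg_iff_posSemidef.1 (CFC.sqrt_nonneg M)).isHermitian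
  refine ⟨(CFC.sqrt M).toEuclideanLin, fun ξ η => ?_⟩
  rw [← LinearMap.adjoint_inner_left, ← Matrix.toEuclideanLin_conjTranspose_eq_adjoint, h2]
  simp only [matForm]
  congr 1
  nth_rewrite 1 [← h1]
  simp [Matrix.toLpLin_apply, Matrix.mulVec_mulVec]
end

lemma integral_norm_rpow_eq {α E : Type*} [MeasurableSpace α] {μ : Measure α}
    [NormedAddCommGroup E] {p : ℝ} (hp : 0 < p) (f : Lp E (ENNReal.ofReal p) μ) :
    ∫ x, ‖f x‖ ^ p ∂μ = ‖f‖ ^ p := by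
  have h := MemLp.eLpNorm_eq_integral_rpow_norm (by simpa using hp) ENNReal.ofReal_ne_top
    (Lp.memLp f)
  have h0 : 0 ≤ ∫ x, ‖f x‖ ^ p ∂μ := integral_nonneg fun x => by positivity
  rw [Lp.norm_def, h, ENNReal.toReal_ofReal hp.le, ENNReal.toReal_ofReal (by positivity),
    ← Real.rpow_mul h0, inv_mul_cancel₀ hp.ne', Real.rpow_one]

lemma integrable_norm_rpow {α E : Type*} [MeasurableSpace α] {μ : Measure α}
    [NormedAddCommGroup E] {p : ℝ} (hp : 0 < p) {f : α → E} (hf : MemLp f (ENNReal.ofReal p) μ) :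
    Integrable (fun x => ‖f x‖ ^ p) μ := by
  simpa [ENNReal.toReal_ofReal hp.le] using
    hf.integrable_norm_rpow (by simpa using hp) ENNReal.ofReal_ne_top

lemma matForm_eq_sum {n : ℕ} (M : Matrix (Fin n) (Fin n) ℝ) (ξ η : Eucl n) :
    matForm M ξ η = ∑ i, ∑ j, M i j * ξ j * η i := by
  simp [matForm, Matrix.toLpLin_apply, PiLp.inner_apply, Matrix.mulVec, dotProduct,
    Finset.mul_sum, mul_comm]

lemma continuous_matForm (n : ℕ) : Continuous
    fun z : Matrix (Fin n) (Fin n) ℝ × Eucl n × Eucl n => matForm z.1 z.2.1 z.2.2 := by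
  simp only [matForm_eq_sum]
  fun_prop

/-- This is the shape in which the homogeneous inequalities give continuity: a fixed quantity K with
an arbitrarily small factor, plus a constant depending on ε times a null family. -/
lemma tendsto_of_forall_abs_sub_le {ι : Type*} {l : Filter ι} {f d : ι → ℝ} {a K : ℝ}
    (hd : Tendsto d l (𝓝 0))
    (h : ∀ ε, 0 < ε → ∃ C, ∀ i, |f i - a| ≤ ε * K + C * d i) : Tendsto f l (𝓝 a) := by
  rw [Metric.tendsto_nhds]
  intro η hη
  -- K may have any sign; |K| + 1 keeps the denominator positive and makes the first term at most
  -- η/2.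
  obtain ⟨C, hC⟩ := h (η / (2 * (|K| + 1))) (by positivity)
  have h1 : Tendsto (fun i => C * d i) l (𝓝 0) := by simpa using hd.const_mul C
  filter_upwards [h1.eventually (gt_mem_nhds (half_pos hη))] with i hi
  rw [Real.dist_eq]
  have h2 : η / (2 * (|K| + 1)) * K ≤ η / 2 := by
    calc _ ≤ η / (2 * (|K| + 1)) * (|K| + 1) := by
          gcongr
          linarith [le_abs_self K]
      _ = _ := by field_simp
  linarith [hC i]

lemma tendsto_norm_sub_rpow {ι E : Type*} [SeminormedAddCommGroup E] {l : Filter ι} {p : ℝ}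
    (hp : 0 < p) {g : ι → E} {g₀ : E} (h : Tendsto g l (𝓝 g₀)) :
    Tendsto (fun i => ‖g i - g₀‖ ^ p) l (𝓝 0) := by
  have := (tendsto_iff_norm_sub_tendsto_zero.1 h).rpow_const (Or.inr hp.le)
  simpa [Real.zero_rpow hp.ne'] using this

lemma rpow_half_of_eq_norm_sq {E : Type*} [NormedAddCommGroup E] {a : ℝ} {v : E}
    (h : a = ‖v‖ ^ 2) (s : ℝ) : a ^ (s / 2) = ‖v‖ ^ s := by
  rw [h, ← Real.rpow_natCast, ← Real.rpow_mul (norm_nonneg v)]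
  congr 1
  push_cast
  ring

/-! ### The energy density `⟨A(x) ξ, ξ⟩^{p/2}` -/

/-- The energy density `⟨A(x) ξ, ξ⟩^{p/2}`. -/
def density {n : ℕ} (p : ℝ) (A : Eucl n → Matrix (Fin n) (Fin n) ℝ) (x ξ : Eucl n) : ℝ :=
  (matForm (A x) ξ ξ) ^ (p / 2)

section Elliptic

variable {n : ℕ} {p : ℝ} {Ω : Set (Eucl n)} {A : Eucl n → Matrix (Fin n) (Fin n) ℝ}

/-- On the closure of a bounded set an elliptic field of matrices factors pointwise as
`⟨A(x) ξ, η⟩ = ⟨B ξ, B η⟩`, with two-sided bounds on `B` that are uniform in `x`. -/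
lemma IsElliptic.exists_factor (hA : IsElliptic Ω A) (hΩb : Bornology.IsBounded Ω) :
    ∃ l L : ℝ, 0 < l ∧ 0 < L ∧ ∀ x ∈ closure Ω, ∃ B : Eucl n →ₗ[ℝ] Eucl n,
      (∀ ξ η, matForm (A x) ξ η = inner ℝ (B ξ) (B η)) ∧
      ∀ ξ, l * ‖ξ‖ ≤ ‖B ξ‖ ∧ ‖B ξ‖ ≤ L * ‖ξ‖ := by
  obtain ⟨τ, hτ, hpos⟩ := hA.posDef
  have hc : IsCompact (closure Ω ×ˢ Metric.closedBall (0 : Eucl n) 1) :=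
    hΩb.isCompact_closure.prod (isCompact_closedBall _ _)
  have hcont : ContinuousOn (fun z : Eucl n × Eucl n => matForm (A z.1) z.2 z.2)
      (closure Ω ×ˢ Metric.closedBall (0 : Eucl n) 1) := by
    have h1 : ContinuousOn (fun z : Eucl n × Eucl n => (A z.1, z.2, z.2))
        (closure Ω ×ˢ Metric.closedBall (0 : Eucl n) 1) :=
      (hA.continuousOn.comp continuousOn_fst fun z hz => hz.1).prodMk
        (continuousOn_snd.prodMk continuousOn_snd)
    have h2 := (continuous_matForm n).comp_continuousOn h1
    simpa only [Function.comp_def] using h2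
  obtain ⟨Λ, hΛ⟩ := hc.bddAbove_image hcont
  -- The maximum with 1 only secures a positive upper constant.
  have hL : 0 < √(max Λ 1) := Real.sqrt_pos.2 (lt_max_of_lt_right one_pos)
  refine ⟨√τ, √(max Λ 1), Real.sqrt_pos.2 hτ, hL, fun x hx => ?_⟩
  obtain ⟨B, hB⟩ := exists_matForm_eq_inner (hA.symm x hx)
    fun ξ => (by positivity : (0 : ℝ) ≤ τ * ‖ξ‖ ^ 2).trans (hpos x hx ξ)
  have hsq : ∀ ξ, matForm (A x) ξ ξ = ‖B ξ‖ ^ 2 := fun ξ => by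
    rw [hB, real_inner_self_eq_norm_sq]
  refine ⟨B, hB, fun ξ => ⟨?_, ?_⟩⟩
  · have h := hpos x hx ξ
    rw [hsq] at h
    refine le_of_sq_le_sq ?_ (norm_nonneg _)
    rw [mul_pow, Real.sq_sqrt hτ.le]
    exact h
  · rcases eq_or_ne ξ 0 with rfl | hξ
    · simp
    have hn : 0 < ‖ξ‖ := norm_pos_iff.2 hξ
    have h1 : ‖B (‖ξ‖⁻¹ • ξ)‖ ^ 2 ≤ Λ := by
      rw [← hsq]
      refine hΛ ⟨(x, ‖ξ‖⁻¹ • ξ), ⟨hx, ?_⟩, rfl⟩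
      simp [norm_smul, hn.ne']
    rw [map_smul, norm_smul, norm_inv, norm_norm] at h1
    refine le_of_sq_le_sq ?_ (by positivity)
    rw [mul_pow, Real.sq_sqrt (by positivity)]
    rw [mul_pow, inv_pow, inv_mul_le_iff₀ (by positivity)] at h1
    calc _ ≤ _ := h1
      _ ≤ _ := by rw [mul_comm]; gcongr; exact le_max_left _ _

lemma density_eq_of_factor {x : Eucl n} {B : Eucl n →ₗ[ℝ] Eucl n}
    (hB : ∀ ξ η, matForm (A x) ξ η = inner ℝ (B ξ) (B η)) (p : ℝ) (ξ : Eucl n) :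
    density p A x ξ = ‖B ξ‖ ^ p := by
  rw [density]
  exact rpow_half_of_eq_norm_sq (by rw [hB, real_inner_self_eq_norm_sq]) p

lemma IsElliptic.density_nonneg (hA : IsElliptic Ω A) {x : Eucl n} (hx : x ∈ closure Ω)
    (p : ℝ) (ξ : Eucl n) : 0 ≤ density p A x ξ := by
  obtain ⟨τ, hτ, hpos⟩ := hA.posDef
  exact Real.rpow_nonneg ((by positivity : (0 : ℝ) ≤ τ * ‖ξ‖ ^ 2).trans (hpos x hx ξ)) _

lemma IsElliptic.exists_density_bounds (hA : IsElliptic Ω A) (hΩb : Bornology.IsBounded Ω)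
    (hp : 1 < p) : ∃ l L : ℝ, 0 < l ∧ 0 < L ∧ ∀ x ∈ closure Ω, ∀ ξ,
      l * ‖ξ‖ ^ p ≤ density p A x ξ ∧ density p A x ξ ≤ L * ‖ξ‖ ^ p := by
  obtain ⟨l, L, hl, hL, h⟩ := hA.exists_factor hΩb
  refine ⟨l ^ p, L ^ p, by positivity, by positivity, fun x hx ξ => ?_⟩
  obtain ⟨B, hB, hb⟩ := h x hx
  rw [density_eq_of_factor hB, ← Real.mul_rpow hl.le (norm_nonneg _),
    ← Real.mul_rpow hL.le (norm_nonneg _)]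
  have hp0 : 0 ≤ p := by linarith
  exact ⟨Real.rpow_le_rpow (by positivity) (hb ξ).1 hp0,
    Real.rpow_le_rpow (by positivity) (hb ξ).2 hp0⟩

lemma IsElliptic.density_smul (hA : IsElliptic Ω A) (hΩb : Bornology.IsBounded Ω)
    {x : Eucl n} (hx : x ∈ closure Ω) (p : ℝ) (c : ℝ) (ξ : Eucl n) :
    density p A x (c • ξ) = |c| ^ p * density p A x ξ := by
  obtain ⟨l, L, hl, hL, h⟩ := hA.exists_factor hΩb
  obtain ⟨B, hB, hb⟩ := h x hx
  rw [density_eq_of_factor hB, density_eq_of_factor hB, map_smul, norm_smul,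
    Real.mul_rpow (norm_nonneg _) (norm_nonneg _), Real.norm_eq_abs]

/-- The Euclidean inequality is applied to B a and B b. The distortion of B lies between l and L for
every x, so ε l^p / L^p in place of ε gives a constant independent of x. -/
lemma IsElliptic.exists_uniformConvexity (hA : IsElliptic Ω A) (hΩb : Bornology.IsBounded Ω)
    (hp : 1 < p) {ε : ℝ} (hε : 0 < ε) : ∃ C, 0 ≤ C ∧ ∀ x ∈ closure Ω, ∀ a b,
      ‖a - b‖ ^ p ≤ ε * (‖a‖ ^ p + ‖b‖ ^ p) + C * ((density p A x a + density p A x b) / 2 -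
        density p A x ((2⁻¹ : ℝ) • (a + b))) := by
  obtain ⟨l, L, hl, hL, h⟩ := hA.exists_factor hΩb
  have hp0 : 0 ≤ p := by linarith
  have hlp : 0 < l ^ p := by positivity
  have hLp : 0 < L ^ p := by positivity
  obtain ⟨C, hC0, hC⟩ := exists_norm_sub_rpow_le (E := Eucl n) hp
    (by positivity : 0 < ε * l ^ p / L ^ p)
  refine ⟨C / l ^ p, by positivity, fun x hx a b => ?_⟩
  obtain ⟨B, hB, hb⟩ := h x hx
  simp only [density_eq_of_factor hB]
  have h1 := hC (B a) (B b)
  rw [← map_sub, ← map_add, ← map_smul] at h1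
  have h2 : l ^ p * ‖a - b‖ ^ p ≤ ‖B (a - b)‖ ^ p := by
    rw [← Real.mul_rpow hl.le (norm_nonneg _)]
    exact Real.rpow_le_rpow (by positivity) (hb _).1 hp0
  have h3 : ∀ ξ, ‖B ξ‖ ^ p ≤ L ^ p * ‖ξ‖ ^ p := fun ξ => by
    rw [← Real.mul_rpow hL.le (norm_nonneg _)]
    exact Real.rpow_le_rpow (by positivity) (hb _).2 hp0
  have h4 : ε * l ^ p / L ^ p * (‖B a‖ ^ p + ‖B b‖ ^ p) ≤
      l ^ p * (ε * (‖a‖ ^ p + ‖b‖ ^ p)) := by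
    calc _ ≤ ε * l ^ p / L ^ p * (L ^ p * ‖a‖ ^ p + L ^ p * ‖b‖ ^ p) := by
          gcongr <;> exact h3 _
      _ = _ := by field_simp
  refine le_of_mul_le_mul_left ?_ hlp
  calc _ ≤ _ := h2
    _ ≤ _ := h1
    _ ≤ l ^ p * (ε * (‖a‖ ^ p + ‖b‖ ^ p)) +
        C * ((‖B a‖ ^ p + ‖B b‖ ^ p) / 2 - ‖B ((2⁻¹ : ℝ) • (a + b))‖ ^ p) := by gcongr
    _ = _ := by field_simp

/-- Again the Euclidean estimate transported by B, with constants uniform in x because L is. -/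
lemma IsElliptic.exists_abs_density_sub_le (hA : IsElliptic Ω A) (hΩb : Bornology.IsBounded Ω)
    (hp : 1 < p) {ε : ℝ} (hε : 0 < ε) : ∃ C, 0 ≤ C ∧ ∀ x ∈ closure Ω, ∀ a b,
      |density p A x b - density p A x a| ≤ ε * ‖a‖ ^ p + C * ‖b - a‖ ^ p := by
  obtain ⟨l, L, hl, hL, h⟩ := hA.exists_factor hΩb
  have hp0 : 0 < p := by linarith
  have hLp : 0 < L ^ p := by positivity
  obtain ⟨C, hC0, hC⟩ := (homog_norm_rpow (E := Eucl n) p).exists_abs_add_sub_le hp0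
    (continuous_norm_rpow hp0) (by positivity : 0 < ε / L ^ p)
  refine ⟨C * L ^ p, by positivity, fun x hx a b => ?_⟩
  obtain ⟨B, hB, hb⟩ := h x hx
  simp only [density_eq_of_factor hB]
  have h1 := hC (B a) (B (b - a))
  rw [← map_add, add_sub_cancel] at h1
  have h3 : ∀ ξ, ‖B ξ‖ ^ p ≤ L ^ p * ‖ξ‖ ^ p := fun ξ => by
    rw [← Real.mul_rpow hL.le (norm_nonneg _)]
    exact Real.rpow_le_rpow (by positivity) (hb _).2 hp0.le
  calc _ ≤ _ := h1
    _ ≤ ε / L ^ p * (L ^ p * ‖a‖ ^ p) + C * (L ^ p * ‖b - a‖ ^ p) := by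
        gcongr <;> exact h3 _
    _ = _ := by field_simp

lemma IsElliptic.aestronglyMeasurable_matForm (hA : IsElliptic Ω A) (hΩ : IsOpen Ω)
    {f g : Eucl n → Eucl n} (hf : AEStronglyMeasurable f (volume.restrict Ω))
    (hg : AEStronglyMeasurable g (volume.restrict Ω)) :
    AEStronglyMeasurable (fun x => matForm (A x) (f x) (g x)) (volume.restrict Ω) := by
  simp only [matForm_eq_sum]
  refine Finset.aestronglyMeasurable_fun_sum _ fun i _ =>
    Finset.aestronglyMeasurable_fun_sum _ fun j _ => ?_
  have hAij : ContinuousOn (fun x => A x i j) Ω :=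
    ((continuous_apply_apply i j).comp_continuousOn hA.continuousOn).mono subset_closure
  refine ((hAij.aestronglyMeasurable hΩ.measurableSet).mul ?_).mul ?_
  · exact (EuclideanSpace.proj (𝕜 := ℝ) j).continuous.comp_aestronglyMeasurable hf
  · exact (EuclideanSpace.proj (𝕜 := ℝ) i).continuous.comp_aestronglyMeasurable hg

lemma IsElliptic.aestronglyMeasurable_density (hA : IsElliptic Ω A) (hΩ : IsOpen Ω)
    {f : Eucl n → Eucl n} (hf : AEStronglyMeasurable f (volume.restrict Ω)) (p : ℝ) :
    AEStronglyMeasurable (fun x => density p A x (f x)) (volume.restrict Ω) :=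
  ((hA.aestronglyMeasurable_matForm hΩ hf hf).aemeasurable.pow_const _).aestronglyMeasurable

lemma ae_restrict_mem_closure (hΩ : IsOpen Ω) : ∀ᵐ x ∂(volume.restrict Ω), x ∈ closure Ω :=
  (ae_restrict_mem hΩ.measurableSet).mono fun _ hx => subset_closure hx

lemma IsElliptic.integrable_density (hA : IsElliptic Ω A) (hΩ : IsOpen Ω)
    (hΩb : Bornology.IsBounded Ω) (hp : 1 < p) {f : Eucl n → Eucl n}
    (hf : MemLp f (ENNReal.ofReal p) (volume.restrict Ω)) :
    Integrable (fun x => density p A x (f x)) (volume.restrict Ω) := by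
  obtain ⟨l, L, hl, hL, h⟩ := hA.exists_density_bounds hΩb hp
  refine ((integrable_norm_rpow (by linarith) hf).const_mul L).mono'
    (hA.aestronglyMeasurable_density hΩ hf.1 p) ?_
  filter_upwards [ae_restrict_mem_closure hΩ] with x hx
  rw [Real.norm_of_nonneg (hA.density_nonneg hx p _)]
  exact (h x hx _).2

end Elliptic

/-! ### The gradient energy on `L^p(Ω; ℝⁿ)` -/

section GradEnergy

variable {n : ℕ} {p : ℝ} [hp : Fact (1 < p)] {Ω : Set (Eucl n)}
  {A : Eucl n → Matrix (Fin n) (Fin n) ℝ}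

/-- The functional `g ↦ ∫_Ω ⟨A g, g⟩^{p/2}` on vector fields. -/
def gradEnergy (A : Eucl n → Matrix (Fin n) (Fin n) ℝ)
    (g : Lp (Eucl n) (ENNReal.ofReal p) (volume.restrict Ω)) : ℝ :=
  ∫ x in Ω, density p A x (g x)

lemma normApow_eq_gradEnergy (A : Eucl n → Matrix (Fin n) (Fin n) ℝ) (u : W0 p Ω) :
    normApow A u = gradEnergy A (u : LpPair p Ω).2 := rfl

variable (p) in
lemma pos_of_fact : 0 < p := one_pos.trans hp.out

lemma IsElliptic.exists_gradEnergy_bounds (hA : IsElliptic Ω A) (hΩ : IsOpen Ω)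
    (hΩb : Bornology.IsBounded Ω) : ∃ l L : ℝ, 0 < l ∧ 0 < L ∧
      ∀ g : Lp (Eucl n) (ENNReal.ofReal p) (volume.restrict Ω),
        l * ‖g‖ ^ p ≤ gradEnergy A g ∧ gradEnergy A g ≤ L * ‖g‖ ^ p := by
  obtain ⟨l, L, hl, hL, h⟩ := hA.exists_density_bounds hΩb hp.out
  refine ⟨l, L, hl, hL, fun g => ?_⟩
  have hi := integrable_norm_rpow (pos_of_fact p) (Lp.memLp g)
  have hd := hA.integrable_density hΩ hΩb hp.out (Lp.memLp g)
  rw [← integral_norm_rpow_eq (pos_of_fact p), ← integral_const_mul, ← integral_const_mul]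
  constructor
  · refine integral_mono_ae (hi.const_mul l) hd ?_
    filter_upwards [ae_restrict_mem_closure hΩ] with x hx using (h x hx _).1
  · refine integral_mono_ae hd (hi.const_mul L) ?_
    filter_upwards [ae_restrict_mem_closure hΩ] with x hx using (h x hx _).2

omit hp in
lemma IsElliptic.gradEnergy_nonneg (hA : IsElliptic Ω A) (hΩ : IsOpen Ω)
    (g : Lp (Eucl n) (ENNReal.ofReal p) (volume.restrict Ω)) : 0 ≤ gradEnergy A g := by
  refine integral_nonneg_of_ae ?_
  filter_upwards [ae_restrict_mem_closure hΩ] with x hx using hA.density_nonneg hx p _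

omit hp in
lemma IsElliptic.gradEnergy_smul (hA : IsElliptic Ω A) (hΩ : IsOpen Ω)
    (hΩb : Bornology.IsBounded Ω) (c : ℝ)
    (g : Lp (Eucl n) (ENNReal.ofReal p) (volume.restrict Ω)) :
    gradEnergy A (c • g) = |c| ^ p * gradEnergy A g := by
  rw [gradEnergy, gradEnergy, ← integral_const_mul]
  refine integral_congr_ae ?_
  filter_upwards [ae_restrict_mem_closure hΩ, Lp.coeFn_smul c g] with x hx h
  rw [h, Pi.smul_apply, hA.density_smul hΩb hx]

lemma IsElliptic.exists_gradEnergy_uniformConvexity (hA : IsElliptic Ω A) (hΩ : IsOpen Ω)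
    (hΩb : Bornology.IsBounded Ω) {ε : ℝ} (hε : 0 < ε) : ∃ C, 0 ≤ C ∧
      ∀ g h : Lp (Eucl n) (ENNReal.ofReal p) (volume.restrict Ω),
        ‖g - h‖ ^ p ≤ ε * (‖g‖ ^ p + ‖h‖ ^ p) + C * ((gradEnergy A g + gradEnergy A h) / 2 -
          gradEnergy A ((2⁻¹ : ℝ) • (g + h))) := by
  obtain ⟨C, hC0, hC⟩ := hA.exists_uniformConvexity hΩb hp.out hε
  refine ⟨C, hC0, fun g h => ?_⟩
  have ig := integrable_norm_rpow (pos_of_fact p) (Lp.memLp g)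
  have ih := integrable_norm_rpow (pos_of_fact p) (Lp.memLp h)
  have dg := hA.integrable_density hΩ hΩb hp.out (Lp.memLp g)
  have dh := hA.integrable_density hΩ hΩb hp.out (Lp.memLp h)
  have dm := hA.integrable_density hΩ hΩb hp.out (Lp.memLp ((2⁻¹ : ℝ) • (g + h)))
  have i1 : Integrable (fun x => ε * (‖g x‖ ^ p + ‖h x‖ ^ p)) (volume.restrict Ω) :=
    (ig.add ih).const_mul ε
  have i2 : Integrable (fun x => (density p A x (g x) + density p A x (h x)) / 2)
      (volume.restrict Ω) := (dg.add dh).div_const 2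
  have i3 : Integrable (fun x => C * ((density p A x (g x) + density p A x (h x)) / 2 -
      density p A x (((2⁻¹ : ℝ) • (g + h) : Lp (Eucl n) (ENNReal.ofReal p)
        (volume.restrict Ω)) x))) (volume.restrict Ω) := (i2.sub dm).const_mul C
  simp only [gradEnergy, ← integral_norm_rpow_eq (pos_of_fact p)]
  rw [← integral_add ig ih, ← integral_add dg dh, ← integral_div, ← integral_sub i2 dm,
    ← integral_const_mul, ← integral_const_mul, ← integral_add i1 i3]
  refine integral_mono_ae (integrable_norm_rpow (pos_of_fact p) (Lp.memLp (g - h)))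
    (i1.add i3) ?_
  filter_upwards [ae_restrict_mem_closure hΩ, Lp.coeFn_smul (2⁻¹ : ℝ) (g + h),
    Lp.coeFn_add g h, Lp.coeFn_sub g h] with x hx h1 h2 h3
  rw [h1, Pi.smul_apply, h2, h3]
  exact hC x hx _ _

lemma IsElliptic.tendsto_gradEnergy (hA : IsElliptic Ω A) (hΩ : IsOpen Ω)
    (hΩb : Bornology.IsBounded Ω) {ι : Type*} {l : Filter ι}
    {g : ι → Lp (Eucl n) (ENNReal.ofReal p) (volume.restrict Ω)}
    {g₀ : Lp (Eucl n) (ENNReal.ofReal p) (volume.restrict Ω)} (h : Tendsto g l (𝓝 g₀)) :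
    Tendsto (fun i => gradEnergy A (g i)) l (𝓝 (gradEnergy A g₀)) := by
  refine tendsto_of_forall_abs_sub_le (K := ‖g₀‖ ^ p)
    (tendsto_norm_sub_rpow (pos_of_fact p) h) fun ε hε => ?_
  obtain ⟨C, hC0, hC⟩ := hA.exists_abs_density_sub_le hΩb hp.out hε
  refine ⟨C, fun i => ?_⟩
  have i0 := integrable_norm_rpow (pos_of_fact p) (Lp.memLp g₀)
  have ii := integrable_norm_rpow (pos_of_fact p) (Lp.memLp (g i - g₀))
  have d0 := hA.integrable_density hΩ hΩb hp.out (Lp.memLp g₀)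
  have di := hA.integrable_density hΩ hΩb hp.out (Lp.memLp (g i))
  simp only [gradEnergy, ← integral_norm_rpow_eq (pos_of_fact p)]
  rw [← integral_sub di d0, ← integral_const_mul, ← integral_const_mul,
    ← integral_add (i0.const_mul ε) (ii.const_mul C)]
  refine abs_integral_le_integral_abs.trans
    (integral_mono_ae (di.sub d0).abs ((i0.const_mul ε).add (ii.const_mul C)) ?_)
  filter_upwards [ae_restrict_mem_closure hΩ, Lp.coeFn_sub (g i) g₀] with x hx h3
  rw [h3]
  exact hC x hx _ _

end GradEnergy

/-! ### The critical exponent -/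

section CritExp

variable {n : ℕ} {p : ℝ}

lemma lt_critExp (hp : 1 < p) (hpn : p < n) : p < critExp n p := by
  have h : 0 < (n : ℝ) - p := by linarith
  rw [critExp, lt_div_iff₀ h]
  nlinarith

lemma critExp_inv (hp : 1 < p) (hpn : p < n) : (critExp n p)⁻¹ = p⁻¹ - (n : ℝ)⁻¹ := by
  have h : 0 < (n : ℝ) - p := by linarith
  have hn : (0 : ℝ) < n := by linarith
  rw [critExp]
  field_simp

end CritExp

/-! ### The Sobolev inequality on `W_0^{1,p}(Ω)` -/

section Sobolev

variable {n : ℕ} {p : ℝ} {Ω : Set (Eucl n)}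

lemma exists_subseq_tendsto_ae {α E : Type*} [MeasurableSpace α] {μ : Measure α}
    [NormedAddCommGroup E] {r : ENNReal} [Fact (1 ≤ r)] {f : ℕ → Lp E r μ} {g : Lp E r μ}
    (h : Tendsto f atTop (𝓝 g)) : ∃ σ : ℕ → ℕ, StrictMono σ ∧
      ∀ᵐ x ∂μ, Tendsto (fun k => f (σ k) x) atTop (𝓝 (g x)) :=
  (tendstoInMeasure_of_tendsto_Lp h).exists_seq_tendsto_ae

lemma exists_seq_testPairs [Fact (1 < p)] (u : W0 p Ω) : ∃ w : ℕ → LpPair p Ω,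
    (∀ k, w k ∈ testPairs p Ω) ∧ Tendsto w atTop (𝓝 (u : LpPair p Ω)) := by
  have hu : (u : LpPair p Ω) ∈ closure (testPairs p Ω : Set (LpPair p Ω)) := u.2
  exact mem_closure_iff_seq_limit.1 hu

lemma norm_gradient_eq {φ : Eucl n → ℝ} (x : Eucl n) : ‖gradient φ x‖ = ‖fderiv ℝ φ x‖ := by
  simp [gradient]

lemma support_gradient_subset {φ : Eucl n → ℝ} :
    Function.support (gradient φ) ⊆ tsupport φ := fun x hx => by
  refine support_fderiv_subset ℝ (f := φ) fun h => hx ?_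
  simp [gradient, h]

/-- The Gagliardo–Nirenberg–Sobolev inequality on the whole space; the supports lie in Ω, so
restricting the measure changes neither side. -/
lemma eLpNorm_testFunction_le [hp : Fact (1 < p)] (hpn : p < n) {φ : Eucl n → ℝ}
    (hφ : ContDiff ℝ ∞ φ) (hc : HasCompactSupport φ) (hs : tsupport φ ⊆ Ω) :
    eLpNorm φ (ENNReal.ofReal (critExp n p)) (volume.restrict Ω) ≤
      SNormLESNormFDerivOfEqConst ℝ (volume : Measure (Eucl n)) p.toNNReal *
        eLpNorm (gradient φ) (ENNReal.ofReal p) (volume.restrict Ω) := by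
  have hp1 := hp.out
  have hq := (pos_of_fact p).trans (lt_critExp hp1 hpn)
  have hn : 0 < n := by
    have : (0 : ℝ) < n := by linarith
    exact_mod_cast this
  have h := eLpNorm_le_eLpNorm_fderiv_of_eq (volume : Measure (Eucl n)) (u := φ)
    (hφ.of_le (by exact_mod_cast le_top)) hc (p := p.toNNReal) (p' := (critExp n p).toNNReal)
    (by simpa using hp1.le) (by simpa using hn) (by
      rw [NNReal.coe_inv, Real.coe_toNNReal _ hq.le, Real.coe_toNNReal _ (pos_of_fact p).le,
        critExp_inv hp1 hpn]
      simp)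
  rw [eLpNorm_restrict_eq_of_support_subset ((subset_tsupport φ).trans hs),
    eLpNorm_restrict_eq_of_support_subset (support_gradient_subset.trans hs),
    eLpNorm_congr_norm_ae (ae_of_all _ fun x => norm_gradient_eq (φ := φ) x)]
  exact h

/-- Density and Fatou. Test functions converge in L^p only, so on the left an a.e. convergent
subsequence and lower semicontinuity of the L^(p*)-norm are used, while the gradient norms on the
right converge. -/
lemma eLpNorm_fn_le [hp : Fact (1 < p)] (hpn : p < n) (u : W0 p Ω) :
    eLpNorm (W0.fn u) (ENNReal.ofReal (critExp n p)) (volume.restrict Ω) ≤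
      SNormLESNormFDerivOfEqConst ℝ (volume : Measure (Eucl n)) p.toNNReal *
        eLpNorm (W0.grad u) (ENNReal.ofReal p) (volume.restrict Ω) := by
  set C := SNormLESNormFDerivOfEqConst ℝ (volume : Measure (Eucl n)) p.toNNReal
  obtain ⟨w, hw, hwu⟩ := exists_seq_testPairs u
  have h1 : Tendsto (fun k => (w k).1) atTop (𝓝 (u : LpPair p Ω).1) :=
    (continuous_fst.tendsto _).comp hwu
  have h2 : Tendsto (fun k => (w k).2) atTop (𝓝 (u : LpPair p Ω).2) :=
    (continuous_snd.tendsto _).comp hwu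
  obtain ⟨σ, hσ, hae⟩ := exists_subseq_tendsto_ae h1
  have hb : ∀ k, eLpNorm (w k).1 (ENNReal.ofReal (critExp n p)) (volume.restrict Ω) ≤
      C * eLpNorm (w k).2 (ENNReal.ofReal p) (volume.restrict Ω) := fun k => by
    obtain ⟨φ, hφ, hc, hs, e1, e2⟩ := hw k
    rw [eLpNorm_congr_ae e1, eLpNorm_congr_ae e2]
    exact eLpNorm_testFunction_le hpn hφ hc hs
  refine (Lp.eLpNorm_lim_le_liminf_eLpNorm (f := fun k => ⇑(w (σ k)).1)
    (fun k => (Lp.memLp _).1) _ hae).trans ?_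
  have h3 : Tendsto (fun k => (C : ENNReal) * ENNReal.ofReal ‖(w (σ k)).2‖) atTop
      (𝓝 (C * ENNReal.ofReal ‖(u : LpPair p Ω).2‖)) :=
    ENNReal.Tendsto.const_mul (ENNReal.tendsto_ofReal (h2.comp hσ.tendsto_atTop).norm)
      (Or.inr ENNReal.coe_ne_top)
  have h4 : ∀ g : Lp (Eucl n) (ENNReal.ofReal p) (volume.restrict Ω),
      ENNReal.ofReal ‖g‖ = eLpNorm g (ENNReal.ofReal p) (volume.restrict Ω) := fun g => by
    rw [Lp.norm_def, ENNReal.ofReal_toReal (Lp.eLpNorm_ne_top g)]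
  simp only [h4] at h3
  exact (liminf_le_liminf (Eventually.of_forall fun k => hb (σ k))).trans_eq h3.liminf_eq

lemma W0.memLp_fn [Fact (1 < p)] (u : W0 p Ω) :
    MemLp (W0.fn u) (ENNReal.ofReal p) (volume.restrict Ω) := Lp.memLp _

lemma W0.memLp_grad [Fact (1 < p)] (u : W0 p Ω) :
    MemLp (W0.grad u) (ENNReal.ofReal p) (volume.restrict Ω) := Lp.memLp _

lemma W0.memLp_fn_critExp [Fact (1 < p)] (hpn : p < n) (u : W0 p Ω) :
    MemLp (W0.fn u) (ENNReal.ofReal (critExp n p)) (volume.restrict Ω) :=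
  ⟨(W0.memLp_fn u).1, (eLpNorm_fn_le hpn u).trans_lt
    (ENNReal.mul_lt_top ENNReal.coe_lt_top (W0.memLp_grad u).2)⟩

/-- The Sobolev inequality `∫_Ω |u|^{p^*} ≤ C ‖∇u‖_p^{p^*}`. -/
lemma exists_integral_critExp_le [hp : Fact (1 < p)] (hpn : p < n) (Ω : Set (Eucl n)) :
    ∃ C, 0 ≤ C ∧ ∀ u : W0 p Ω, ∫ x in Ω, |W0.fn u x| ^ critExp n p ≤
      C * ‖(u : LpPair p Ω).2‖ ^ critExp n p := by
  have hq := (pos_of_fact p).trans (lt_critExp hp.out hpn)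
  obtain ⟨C, hC⟩ : ∃ C : NNReal, ∀ u : W0 p Ω,
      eLpNorm (W0.fn u) (ENNReal.ofReal (critExp n p)) (volume.restrict Ω) ≤
        C * eLpNorm (W0.grad u) (ENNReal.ofReal p) (volume.restrict Ω) :=
    ⟨_, eLpNorm_fn_le hpn⟩
  refine ⟨(C : ℝ) ^ critExp n p, by positivity, fun u => ?_⟩
  have h := hC u
  have hm := W0.memLp_fn_critExp hpn u
  have h1 := ENNReal.toReal_mono
    (ENNReal.mul_ne_top ENNReal.coe_ne_top (W0.memLp_grad u).2.ne) h
  rw [ENNReal.toReal_mul, ENNReal.coe_toReal] at h1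
  have h2 : ((eLpNorm (W0.fn u) (ENNReal.ofReal (critExp n p)) (volume.restrict Ω)).toReal)
      = (∫ x in Ω, |W0.fn u x| ^ critExp n p) ^ (critExp n p)⁻¹ := by
    rw [hm.eLpNorm_eq_integral_rpow_norm (by simpa using hq) ENNReal.ofReal_ne_top,
      ENNReal.toReal_ofReal hq.le, ENNReal.toReal_ofReal]
    · simp
    · exact Real.rpow_nonneg (integral_nonneg fun x => by positivity) _
  have h0 : 0 ≤ ∫ x in Ω, |W0.fn u x| ^ critExp n p := integral_nonneg fun x => by positivity
  have h3 := Real.rpow_le_rpow ENNReal.toReal_nonneg h1 hq.le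
  rw [h2, ← Real.rpow_mul h0, inv_mul_cancel₀ hq.ne', Real.rpow_one,
    Real.mul_rpow C.coe_nonneg ENNReal.toReal_nonneg] at h3
  exact h3

end Sobolev

/-! ### Composition with smooth contractions -/

lemma add_rpow_le_two_rpow {a b r : ℝ} (ha : 0 ≤ a) (hb : 0 ≤ b) (hr : 0 ≤ r) :
    (a + b) ^ r ≤ 2 ^ r * (a ^ r + b ^ r) := by
  have h : a + b ≤ 2 * max a b := by
    linarith [le_max_left a b, le_max_right a b]
  calc (a + b) ^ r ≤ (2 * max a b) ^ r := by gcongr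
    _ = 2 ^ r * max a b ^ r := Real.mul_rpow (by norm_num) (le_max_of_le_left ha)
    _ ≤ _ := by gcongr; exact rpow_max_le ha hb

lemma tendsto_Lp_of_tendsto_integral {α E ι : Type*} [MeasurableSpace α] {μ : Measure α}
    [NormedAddCommGroup E] {p : ℝ} [Fact (1 < p)] {l : Filter ι}
    {f : ι → Lp E (ENNReal.ofReal p) μ} {g : Lp E (ENNReal.ofReal p) μ}
    (h : Tendsto (fun i => ∫ x, ‖f i x - g x‖ ^ p ∂μ) l (𝓝 0)) : Tendsto f l (𝓝 g) := by
  have hp := pos_of_fact p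
  have h1 : ∀ i, ∫ x, ‖f i x - g x‖ ^ p ∂μ = ‖f i - g‖ ^ p := fun i => by
    rw [← integral_norm_rpow_eq hp]
    refine integral_congr_ae ?_
    filter_upwards [Lp.coeFn_sub (f i) g] with x hx
    rw [hx, Pi.sub_apply]
  simp only [h1] at h
  rw [tendsto_iff_norm_sub_tendsto_zero]
  have h2 := h.rpow_const (p := p⁻¹) (Or.inr (by positivity))
  rw [Real.zero_rpow (inv_pos.2 hp).ne'] at h2
  refine h2.congr fun i => ?_
  rw [← Real.rpow_mul (norm_nonneg _), mul_inv_cancel₀ hp.ne', Real.rpow_one]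

/-- A smooth `1`-Lipschitz function fixing the origin. -/
structure SmoothContraction (T : ℝ → ℝ) : Prop where
  contDiff : ContDiff ℝ ∞ T
  map_zero : T 0 = 0
  abs_deriv_le : ∀ s, |deriv T s| ≤ 1

namespace SmoothContraction

variable {T : ℝ → ℝ}

lemma differentiable (hT : SmoothContraction T) : Differentiable ℝ T :=
  hT.contDiff.differentiable (by simp)

lemma continuous_deriv (hT : SmoothContraction T) : Continuous (deriv T) :=
  hT.contDiff.continuous_deriv (by simp)

lemma abs_sub_le (hT : SmoothContraction T) (a b : ℝ) : |T a - T b| ≤ |a - b| := by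
  have h := convex_univ.norm_image_sub_le_of_norm_deriv_le (f := T) (C := 1) (x := b) (y := a)
    (fun _ _ => hT.differentiable _) (fun x _ => hT.abs_deriv_le x) (Set.mem_univ _)
    (Set.mem_univ _)
  simpa using h

lemma abs_le (hT : SmoothContraction T) (a : ℝ) : |T a| ≤ |a| := by
  simpa [hT.map_zero] using hT.abs_sub_le a 0

lemma gradient_comp {n : ℕ} (hT : SmoothContraction T) {φ : Eucl n → ℝ} (hφ : ContDiff ℝ ∞ φ)
    (x : Eucl n) : gradient (T ∘ φ) x = deriv T (φ x) • gradient φ x := by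
  have h : HasFDerivAt (T ∘ φ) (deriv T (φ x) • fderiv ℝ φ x) x :=
    (hT.differentiable (φ x)).hasDerivAt.comp_hasFDerivAt x
      (hφ.differentiable (by simp) x).hasFDerivAt
  simp [gradient, h.fderiv]

variable {n : ℕ} {p : ℝ} {Ω : Set (Eucl n)}

lemma memLp_comp [Fact (1 < p)] (hT : SmoothContraction T)
    {f : Eucl n → ℝ} (hf : MemLp f (ENNReal.ofReal p) (volume.restrict Ω)) :
    MemLp (fun x => T (f x)) (ENNReal.ofReal p) (volume.restrict Ω) :=
  hf.mono (hT.contDiff.continuous.comp_aestronglyMeasurable hf.1)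
    (ae_of_all _ fun _ => hT.abs_le _)

lemma memLp_deriv_smul [Fact (1 < p)] (hT : SmoothContraction T) {f : Eucl n → ℝ}
    (hf : AEStronglyMeasurable f (volume.restrict Ω)) {g : Eucl n → Eucl n}
    (hg : MemLp g (ENNReal.ofReal p) (volume.restrict Ω)) :
    MemLp (fun x => deriv T (f x) • g x) (ENNReal.ofReal p) (volume.restrict Ω) := by
  refine hg.mono ((hT.continuous_deriv.comp_aestronglyMeasurable hf).smul hg.1)
    (ae_of_all _ fun x => ?_)
  rw [norm_smul]
  exact mul_le_of_le_one_left (norm_nonneg _) (hT.abs_deriv_le _)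

/-- The action of a smooth contraction on pairs `(u, ∇u)`. -/
def pair [Fact (1 < p)] (hT : SmoothContraction T) (w : LpPair p Ω) : LpPair p Ω :=
  ((hT.memLp_comp (Lp.memLp w.1)).toLp _,
    (hT.memLp_deriv_smul (Lp.memLp w.1).1 (Lp.memLp w.2)).toLp _)

lemma pair_fst [Fact (1 < p)] (hT : SmoothContraction T) (w : LpPair p Ω) :
    (hT.pair w).1 =ᵐ[volume.restrict Ω] fun x => T (w.1 x) :=
  MemLp.coeFn_toLp (hT.memLp_comp (Lp.memLp w.1))

lemma pair_snd [Fact (1 < p)] (hT : SmoothContraction T) (w : LpPair p Ω) :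
    (hT.pair w).2 =ᵐ[volume.restrict Ω] fun x => deriv T (w.1 x) • w.2 x :=
  MemLp.coeFn_toLp (hT.memLp_deriv_smul (Lp.memLp w.1).1 (Lp.memLp w.2))

/-- T(0) = 0 is what keeps the support of T ∘ φ inside that of φ. -/
lemma pair_mem_testPairs [Fact (1 < p)] (hT : SmoothContraction T) {w : LpPair p Ω}
    (hw : w ∈ testPairs p Ω) : hT.pair w ∈ testPairs p Ω := by
  obtain ⟨φ, hφ, hc, hs, e1, e2⟩ := hw
  refine ⟨T ∘ φ, hT.contDiff.comp hφ, hc.comp_left hT.map_zero,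
    (closure_mono (Function.support_comp_subset hT.map_zero φ)).trans hs, ?_, ?_⟩
  · filter_upwards [hT.pair_fst w, e1] with x h1 h2
    rw [h1, h2, Function.comp]
  · filter_upwards [hT.pair_snd w, e1, e2] with x h1 h2 h3
    rw [h1, h2, h3, hT.gradient_comp hφ]

/-- The functions converge because T is 1-Lipschitz. For the gradients, T'(w_k) ∇w_k - T'(v) ∇v is
split as T'(w_k)(∇w_k - ∇v) + (T'(w_k) - T'(v)) ∇v: the first term is small since |T'| ≤ 1, the
second by dominated convergence with majorant 2 |∇v|, where a.e. convergence enters. -/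
lemma tendsto_pair [Fact (1 < p)] (hT : SmoothContraction T) {w : ℕ → LpPair p Ω}
    {v : LpPair p Ω} (hw : Tendsto w atTop (𝓝 v))
    (hae : ∀ᵐ x ∂(volume.restrict Ω), Tendsto (fun k => (w k).1 x) atTop (𝓝 (v.1 x))) :
    Tendsto (fun k => hT.pair (w k)) atTop (𝓝 (hT.pair v)) := by
  have hp := pos_of_fact p
  have h1 : Tendsto (fun k => (w k).1) atTop (𝓝 v.1) := (continuous_fst.tendsto _).comp hw
  have h2 : Tendsto (fun k => (w k).2) atTop (𝓝 v.2) := (continuous_snd.tendsto _).comp hw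
  refine Tendsto.prodMk_nhds ?_ ?_
  · change Tendsto (fun k => (hT.pair (w k)).1) atTop (𝓝 (hT.pair v).1)
    rw [tendsto_iff_norm_sub_tendsto_zero] at h1 ⊢
    refine squeeze_zero (fun _ => norm_nonneg _) (fun k => ?_) h1
    refine Lp.norm_le_norm_of_ae_le ?_
    filter_upwards [Lp.coeFn_sub (hT.pair (w k)).1 (hT.pair v).1, Lp.coeFn_sub (w k).1 v.1,
      hT.pair_fst (w k), hT.pair_fst v] with x e1 e2 e3 e4
    rw [e1, e2, Pi.sub_apply, Pi.sub_apply, e3, e4]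
    exact hT.abs_sub_le _ _
  · change Tendsto (fun k => (hT.pair (w k)).2) atTop (𝓝 (hT.pair v).2)
    refine tendsto_Lp_of_tendsto_integral ?_
    have i1 : ∀ k, Integrable (fun x => ‖(w k).2 x - v.2 x‖ ^ p) (volume.restrict Ω) :=
      fun k => integrable_norm_rpow hp ((Lp.memLp (w k).2).sub (Lp.memLp v.2))
    have hm : ∀ k, AEStronglyMeasurable
        (fun x => (deriv T ((w k).1 x) - deriv T (v.1 x)) • v.2 x) (volume.restrict Ω) := fun k =>
      ((hT.continuous_deriv.comp_aestronglyMeasurable (Lp.memLp (w k).1).1).sub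
        (hT.continuous_deriv.comp_aestronglyMeasurable (Lp.memLp v.1).1)).smul (Lp.memLp v.2).1
    have hdom : ∀ k x, ‖(deriv T ((w k).1 x) - deriv T (v.1 x)) • v.2 x‖ ≤ ‖(2 : ℝ) • v.2 x‖ := by
      intro k x
      rw [norm_smul, norm_smul]
      gcongr
      have a1 := hT.abs_deriv_le ((w k).1 x)
      have a2 := hT.abs_deriv_le (v.1 x)
      rw [abs_le'] at a1 a2
      rw [Real.norm_ofNat, Real.norm_eq_abs, abs_le']
      constructor <;> linarith
    have i2 : ∀ k, Integrable (fun x => ‖(deriv T ((w k).1 x) - deriv T (v.1 x)) • v.2 x‖ ^ p)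
        (volume.restrict Ω) := fun k => integrable_norm_rpow hp
      (((Lp.memLp v.2).const_smul (2 : ℝ)).mono (hm k) (ae_of_all _ (hdom k)))
    have l1 : Tendsto (fun k => ∫ x in Ω, ‖(w k).2 x - v.2 x‖ ^ p) atTop (𝓝 0) := by
      refine (tendsto_norm_sub_rpow hp h2).congr fun k => ?_
      rw [← integral_norm_rpow_eq hp]
      refine integral_congr_ae ?_
      filter_upwards [Lp.coeFn_sub (w k).2 v.2] with x hx
      rw [hx, Pi.sub_apply]
    have l2 : Tendsto (fun k => ∫ x in Ω, ‖(deriv T ((w k).1 x) - deriv T (v.1 x)) • v.2 x‖ ^ p)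
        atTop (𝓝 (∫ x in Ω, (0 : ℝ))) := by
      refine tendsto_integral_of_dominated_convergence (fun x => ‖(2 : ℝ) • v.2 x‖ ^ p)
        (fun k => (i2 k).1) (integrable_norm_rpow hp ((Lp.memLp v.2).const_smul (2 : ℝ)))
        (fun k => ae_of_all _ fun x => ?_) ?_
      · rw [Real.norm_of_nonneg (by positivity)]
        exact Real.rpow_le_rpow (norm_nonneg _) (hdom k x) hp.le
      · filter_upwards [hae] with x hx
        have := (((hT.continuous_deriv.tendsto _).comp hx).sub_const
          (deriv T (v.1 x))).smul_const (v.2 x) |>.norm.rpow_const (p := p) (Or.inr hp.le)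
        simpa [Real.zero_rpow hp.ne'] using this
    rw [integral_zero] at l2
    refine squeeze_zero (fun k => integral_nonneg fun x => by positivity) (fun k => ?_)
      (by simpa using (l1.add l2).const_mul ((2 : ℝ) ^ p))
    rw [← integral_add (i1 k) (i2 k), ← integral_const_mul]
    refine integral_mono_of_nonneg (ae_of_all _ fun x => by positivity)
      (((i1 k).add (i2 k)).const_mul _) ?_
    filter_upwards [hT.pair_snd (w k), hT.pair_snd v] with x e1 e2
    rw [e1, e2]
    refine le_trans ?_ (add_rpow_le_two_rpow (norm_nonneg _) (norm_nonneg _) hp.le)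
    refine Real.rpow_le_rpow (norm_nonneg _) ?_ hp.le
    have e3 : deriv T ((w k).1 x) • (w k).2 x - deriv T (v.1 x) • v.2 x =
        deriv T ((w k).1 x) • ((w k).2 x - v.2 x) +
          (deriv T ((w k).1 x) - deriv T (v.1 x)) • v.2 x := by
      rw [smul_sub, sub_smul]
      abel
    rw [e3]
    refine (norm_add_le _ _).trans (add_le_add_left ?_ _)
    rw [norm_smul]
    exact mul_le_of_le_one_left (norm_nonneg _) (hT.abs_deriv_le _)

/-- Chain rule in `W_0^{1,p}(Ω)`. -/
lemma pair_mem_W0 [Fact (1 < p)] (hT : SmoothContraction T) (u : W0 p Ω) :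
    hT.pair (u : LpPair p Ω) ∈ W0 p Ω := by
  obtain ⟨w, hw, hwu⟩ := exists_seq_testPairs u
  obtain ⟨σ, hσ, hae⟩ := exists_subseq_tendsto_ae ((continuous_fst.tendsto _).comp hwu)
  exact mem_closure_of_tendsto (hT.tendsto_pair (hwu.comp hσ.tendsto_atTop) hae)
    (Eventually.of_forall fun k => hT.pair_mem_testPairs (hw (σ k)))

end SmoothContraction

/-! ### Translations and averages of smooth functions -/

section Averages

variable {n : ℕ} {p : ℝ}

/-- Jensen's inequality, read off from the monotonicity of L^r-norms in r on a probability space. -/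
lemma lintegral_rpow_le_of_isProbabilityMeasure {α : Type*} [MeasurableSpace α] {ν : Measure α}
    [IsProbabilityMeasure ν] (hp : 1 ≤ p) {f : α → ENNReal} (hf : AEMeasurable f ν) :
    (∫⁻ a, f a ∂ν) ^ p ≤ ∫⁻ a, f a ^ p ∂ν := by
  have hp0 : 0 < p := by linarith
  have h := eLpNorm'_le_eLpNorm'_of_exponent_le (f := f) one_pos hp ν hf.aestronglyMeasurable
  simp only [eLpNorm', enorm_eq_self, ENNReal.rpow_one, div_one, one_div] at h
  calc _ ≤ ((∫⁻ a, f a ^ p ∂ν) ^ p⁻¹) ^ p := ENNReal.rpow_le_rpow h hp0.le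
    _ = _ := by rw [← ENNReal.rpow_mul, inv_mul_cancel₀ hp0.ne', ENNReal.rpow_one]

/-- The fundamental theorem of calculus along the segment from x to x - y. -/
lemma enorm_sub_translate_le {φ : Eucl n → ℝ} (hφ : ContDiff ℝ ∞ φ) (x y : Eucl n) :
    ‖φ (x - y) - φ x‖ₑ ≤
      ∫⁻ s in Set.Ioc (0 : ℝ) 1, ‖fderiv ℝ φ (x - s • y)‖ₑ * ‖y‖ₑ := by
  have hd : ∀ s : ℝ, HasDerivAt (fun s : ℝ => φ (x - s • y)) (fderiv ℝ φ (x - s • y) (-y)) s := by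
    intro s
    have h1 : HasDerivAt (fun s : ℝ => x - s • y) (-y) s := by
      simpa using ((hasDerivAt_id s).smul_const y).const_sub x
    exact (hφ.differentiable (by simp) _).hasFDerivAt.comp_hasDerivAt s h1
  have hc : Continuous fun s : ℝ => fderiv ℝ φ (x - s • y) (-y) :=
    ((hφ.continuous_fderiv (by simp)).comp (by fun_prop)).clm_apply continuous_const
  have h := intervalIntegral.integral_eq_sub_of_hasDerivAt (a := 0) (b := 1) (fun s _ => hd s)
    (hc.intervalIntegrable 0 1)
  simp only [one_smul, zero_smul, sub_zero] at h
  rw [← h, intervalIntegral.integral_of_le zero_le_one]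
  refine (enorm_integral_le_lintegral_enorm _).trans (lintegral_mono fun s => ?_)
  have := (fderiv ℝ φ (x - s • y)).le_opENorm (-y)
  rwa [enorm_neg] at this

/-- Jensen in the segment parameter s, then Tonelli, then translation invariance of Lebesgue
measure. -/
lemma lintegral_sub_translate_rpow_le (hp : 1 < p) {φ : Eucl n → ℝ} (hφ : ContDiff ℝ ∞ φ)
    (y : Eucl n) : ∫⁻ x, ‖φ (x - y) - φ x‖ₑ ^ p ≤ ‖y‖ₑ ^ p * ∫⁻ x, ‖fderiv ℝ φ x‖ₑ ^ p := by
  have hp0 : 0 ≤ p := by linarith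
  have hprob : IsProbabilityMeasure (volume.restrict (Set.Ioc (0 : ℝ) 1)) := ⟨by simp⟩
  have hfc : Continuous (fderiv ℝ φ) := hφ.continuous_fderiv (by simp)
  have hm : Measurable fun z : Eucl n × ℝ => ‖fderiv ℝ φ (z.1 - z.2 • y)‖ₑ ^ p * ‖y‖ₑ ^ p := by
    have : Continuous fun z : Eucl n × ℝ => fderiv ℝ φ (z.1 - z.2 • y) :=
      hfc.comp (by fun_prop)
    exact (this.measurable.enorm.pow_const p).mul_const _
  calc ∫⁻ x, ‖φ (x - y) - φ x‖ₑ ^ p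
      ≤ ∫⁻ x, ∫⁻ s in Set.Ioc (0 : ℝ) 1, ‖fderiv ℝ φ (x - s • y)‖ₑ ^ p * ‖y‖ₑ ^ p := by
        refine lintegral_mono fun x => ?_
        refine (ENNReal.rpow_le_rpow (enorm_sub_translate_le hφ x y) hp0).trans ?_
        have hms : Measurable fun s : ℝ => ‖fderiv ℝ φ (x - s • y)‖ₑ * ‖y‖ₑ := by
          have : Continuous fun s : ℝ => fderiv ℝ φ (x - s • y) := hfc.comp (by fun_prop)
          exact this.measurable.enorm.mul_const _
        refine (lintegral_rpow_le_of_isProbabilityMeasure hp.le hms.aemeasurable).trans_eq ?_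
        simp only [ENNReal.mul_rpow_of_nonneg _ _ hp0]
    _ = ∫⁻ s in Set.Ioc (0 : ℝ) 1, ∫⁻ x, ‖fderiv ℝ φ (x - s • y)‖ₑ ^ p * ‖y‖ₑ ^ p :=
        lintegral_lintegral_swap hm.aemeasurable
    _ = ∫⁻ _ in Set.Ioc (0 : ℝ) 1, ‖y‖ₑ ^ p * ∫⁻ x, ‖fderiv ℝ φ x‖ₑ ^ p := by
        refine lintegral_congr fun s => ?_
        have hms : Measurable fun x : Eucl n => ‖fderiv ℝ φ (x - s • y)‖ₑ ^ p := by
          have : Continuous fun x : Eucl n => fderiv ℝ φ (x - s • y) := hfc.comp (by fun_prop)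
          exact this.measurable.enorm.pow_const p
        rw [lintegral_mul_const _ hms, mul_comm,
          lintegral_sub_right_eq_self (fun x => ‖fderiv ℝ φ x‖ₑ ^ p) (s • y)]
    _ = _ := by simp

/-- Averaging a smooth function against a probability measure concentrated near the origin
changes it little in `L^p`. -/
lemma lintegral_sub_average_rpow_le (hp : 1 < p) {φ : Eucl n → ℝ} (hφ : ContDiff ℝ ∞ φ)
    (hc : HasCompactSupport φ) {ν : Measure (Eucl n)} [IsProbabilityMeasure ν] {ε : ℝ}
    (hν : ∀ᵐ y ∂ν, ‖y‖ ≤ ε) :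
    ∫⁻ x, ‖(∫ y, φ (x - y) ∂ν) - φ x‖ₑ ^ p ≤
      ENNReal.ofReal ε ^ p * ∫⁻ x, ‖fderiv ℝ φ x‖ₑ ^ p := by
  have hp0 : 0 ≤ p := by linarith
  have hcφ := hφ.continuous
  obtain ⟨C, hC⟩ := hcφ.bounded_above_of_compact_support hc
  have hint : ∀ x, Integrable (fun y => φ (x - y)) ν := fun x =>
    Integrable.of_bound (Continuous.aestronglyMeasurable (by fun_prop)) C
      (ae_of_all _ fun y => hC _)
  have hm : Measurable fun z : Eucl n × Eucl n => ‖φ (z.1 - z.2) - φ z.1‖ₑ ^ p := by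
    have : Continuous fun z : Eucl n × Eucl n => φ (z.1 - z.2) - φ z.1 := by fun_prop
    exact this.measurable.enorm.pow_const p
  calc ∫⁻ x, ‖(∫ y, φ (x - y) ∂ν) - φ x‖ₑ ^ p
      ≤ ∫⁻ x, ∫⁻ y, ‖φ (x - y) - φ x‖ₑ ^ p ∂ν := by
        refine lintegral_mono fun x => ?_
        have e : (∫ y, φ (x - y) ∂ν) - φ x = ∫ y, (φ (x - y) - φ x) ∂ν := by
          rw [integral_sub (hint x) (integrable_const _)]
          simp
        rw [e]
        refine (ENNReal.rpow_le_rpow (enorm_integral_le_lintegral_enorm _) hp0).trans ?_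
        have : Continuous fun y : Eucl n => φ (x - y) - φ x := by fun_prop
        exact lintegral_rpow_le_of_isProbabilityMeasure hp.le this.measurable.enorm.aemeasurable
    _ = ∫⁻ y, (∫⁻ x, ‖φ (x - y) - φ x‖ₑ ^ p) ∂ν := lintegral_lintegral_swap hm.aemeasurable
    _ ≤ ∫⁻ _, (ENNReal.ofReal ε ^ p * ∫⁻ x, ‖fderiv ℝ φ x‖ₑ ^ p) ∂ν := by
        refine lintegral_mono_ae (hν.mono fun y hy => ?_)
        refine (lintegral_sub_translate_rpow_le hp hφ y).trans ?_
        gcongr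
        rw [← ofReal_norm]
        exact ENNReal.ofReal_le_ofReal hy
    _ = _ := by simp

end Averages

/-! ### Weak-* compactness of bounded families of densities -/

section WeakStar

variable {n : ℕ}

/-- Bounded sequences of functionals on a separable space have pointwise convergent
subsequences. -/
lemma exists_subseq_functional_tendsto {V : Type*} [NormedAddCommGroup V] [NormedSpace ℝ V]
    [TopologicalSpace.SeparableSpace V] {L : ℕ → V →ₗ[ℝ] ℝ} {M : ℝ} (hM : 0 ≤ M)
    (hL : ∀ k g, ‖L k g‖ ≤ M * ‖g‖) :
    ∃ σ : ℕ → ℕ, StrictMono σ ∧ ∀ g, ∃ a, Tendsto (fun k => L (σ k) g) atTop (𝓝 a) := by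
  let T : ℕ → StrongDual ℝ V := fun k => (L k).mkContinuous M (hL k)
  have hball : ∀ k, StrongDual.toWeakDual (T k) ∈
      WeakDual.toStrongDual ⁻¹' Metric.closedBall (0 : StrongDual ℝ V) M := fun k => by
    have hn : ‖T k‖ ≤ M := LinearMap.mkContinuous_norm_le _ hM _
    exact mem_closedBall_zero_iff.2 hn
  obtain ⟨ℓ, -, σ, hσ, hlim⟩ := WeakDual.isSeqCompact_closedBall ℝ _ (0 : StrongDual ℝ V) M hball
  exact ⟨σ, hσ, fun g => ⟨ℓ g, ((WeakDual.eval_continuous g).tendsto ℓ).comp hlim⟩⟩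

/-- A sequence of continuous functions bounded in `L^1(K)`, `K` compact, has a subsequence whose
integrals against every continuous function converge. -/
lemma exists_subseq_integral_tendsto {K : Set (Eucl n)} (hK : IsCompact K)
    {φ : ℕ → Eucl n → ℝ} (hφ : ∀ k, Continuous (φ k)) {M : ℝ}
    (hM : ∀ k, ∫ x in K, |φ k x| ≤ M) :
    ∃ σ : ℕ → ℕ, StrictMono σ ∧ ∀ h : Eucl n → ℝ, Continuous h →
      ∃ a, Tendsto (fun k => ∫ x in K, h x * φ (σ k) x) atTop (𝓝 a) := by
  have hKc : CompactSpace K := isCompact_iff_compactSpace.1 hK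
  have hKm := hK.measurableSet
  set μ : Measure K := Measure.comap Subtype.val volume with hμ
  have hfin : IsFiniteMeasure μ := ⟨by
    rw [hμ, comap_subtype_coe_apply hKm]
    simpa using hK.measure_lt_top⟩
  have hint : ∀ f : K → ℝ, Continuous f → Integrable f μ := fun f hf => by
    obtain ⟨C, hC⟩ := isCompact_univ.exists_bound_of_continuousOn hf.continuousOn
    exact Integrable.of_bound hf.aestronglyMeasurable C (ae_of_all _ fun x => hC x trivial)
  have hφK : ∀ k, Continuous fun x : K => φ k x := fun k => (hφ k).comp continuous_subtype_val
  have hgφ : ∀ (g : C(K, ℝ)) k, Integrable (fun x : K => g x * φ k x) μ := fun g k =>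
    hint _ (g.continuous.mul (hφK k))
  -- The functions φ_k become functionals on C(K), which is separable since K is compact and
  -- metrizable; the L^1 bound bounds their norms.
  let L : ℕ → C(K, ℝ) →ₗ[ℝ] ℝ := fun k =>
    { toFun := fun g => ∫ x : K, g x * φ k x ∂μ
      map_add' := fun g h => by
        rw [← integral_add (hgφ g k) (hgφ h k)]
        simp [add_mul]
      map_smul' := fun c g => by
        rw [RingHom.id_apply, smul_eq_mul, ← integral_const_mul]
        simp [mul_assoc] }
  have hL : ∀ k g, ‖L k g‖ ≤ M * ‖g‖ := fun k g => by
    refine (norm_integral_le_integral_norm _).trans ?_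
    have h1 : ∫ x : K, |φ k x| ∂μ ≤ M := by
      rw [hμ, integral_subtype_comap hKm fun x => |φ k x|]
      exact hM k
    calc ∫ x : K, ‖g x * φ k x‖ ∂μ ≤ ∫ x : K, ‖g‖ * |φ k x| ∂μ := by
          refine integral_mono (hgφ g k).norm ((hint _ (hφK k)).abs.const_mul _) fun x => ?_
          simp only [norm_mul, Real.norm_eq_abs]
          gcongr
          exact g.norm_coe_le_norm x
      _ = ‖g‖ * ∫ x : K, |φ k x| ∂μ := integral_const_mul _ _
      _ ≤ M * ‖g‖ := by rw [mul_comm]; gcongr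
  have hM0 : 0 ≤ M := (integral_nonneg fun x => abs_nonneg _).trans (hM 0)
  obtain ⟨σ, hσ, hlim⟩ := exists_subseq_functional_tendsto hM0 hL
  refine ⟨σ, hσ, fun h hh => ?_⟩
  obtain ⟨a, ha⟩ := hlim ⟨fun x => h x, hh.comp continuous_subtype_val⟩
  refine ⟨a, ha.congr fun k => ?_⟩
  rw [← integral_subtype_comap hKm fun x => h x * φ (σ k) x]
  rfl

end WeakStar

/-! ### The Rellich–Kondrachov compactness theorem -/

lemma cauchySeq_of_forall_approx {E : Type*} [SeminormedAddCommGroup E] {w : ℕ → E}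
    (h : ∀ ε, 0 < ε → ∃ v : ℕ → E, CauchySeq v ∧ ∀ k, ‖w k - v k‖ ≤ ε) : CauchySeq w := by
  rw [Metric.cauchySeq_iff]
  intro ε hε
  obtain ⟨v, hv, hwv⟩ := h (ε / 4) (by positivity)
  obtain ⟨N, hN⟩ := Metric.cauchySeq_iff.1 hv (ε / 2) (half_pos hε)
  refine ⟨N, fun i hi j hj => ?_⟩
  have h1 := hN i hi j hj
  rw [dist_eq_norm] at h1 ⊢
  have e : w i - w j = (w i - v i) + (v i - v j) - (w j - v j) := by abel
  rw [e]
  calc _ ≤ ‖w i - v i‖ + ‖v i - v j‖ + ‖w j - v j‖ :=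
        (norm_sub_le _ _).trans (by gcongr; exact norm_add_le _ _)
    _ < ε := by linarith [hwv i, hwv j]

section Rellich

variable {n : ℕ} {p : ℝ} {Ω : Set (Eucl n)}

/-- There are probability measures with a continuous density arbitrarily concentrated near the
origin. -/
lemma exists_mollifier (n : ℕ) {ε : ℝ} (hε : 0 < ε) :
    ∃ (ρ : Eucl n → ℝ) (ν : Measure (Eucl n)), Continuous ρ ∧ (∃ C, ∀ y, |ρ y| ≤ C) ∧
      IsProbabilityMeasure ν ∧ (∀ᵐ y ∂ν, ‖y‖ ≤ ε) ∧
      ∀ f : Eucl n → ℝ, ∫ y, f y ∂ν = ∫ y, ρ y * f y := by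
  let b : ContDiffBump (0 : Eucl n) := ⟨ε / 2, ε, half_pos hε, half_lt_self hε⟩
  have hc : Continuous (b.normed volume) := b.continuous_normed
  have h0 : ∀ y, 0 ≤ b.normed volume y := fun y => b.nonneg_normed y
  obtain ⟨C, hC⟩ := hc.bounded_above_of_compact_support b.hasCompactSupport_normed
  have hm : Measurable fun y => ENNReal.ofReal (b.normed volume y) :=
    hc.measurable.ennreal_ofReal
  refine ⟨b.normed volume, volume.withDensity fun y => ENNReal.ofReal (b.normed volume y), hc,
    ⟨C, hC⟩, ⟨?_⟩, ?_, fun f => ?_⟩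
  · rw [withDensity_apply _ MeasurableSet.univ, Measure.restrict_univ,
      ← ofReal_integral_eq_lintegral_ofReal b.integrable_normed (ae_of_all _ h0),
      b.integral_normed, ENNReal.ofReal_one]
  · rw [ae_withDensity_iff hm]
    refine ae_of_all _ fun y hy => ?_
    have h1 : y ∈ Function.support (b.normed volume) := fun h => hy (by simp [h])
    rw [b.support_normed_eq] at h1
    exact (mem_ball_zero_iff.1 h1).le
  · rw [integral_withDensity_eq_integral_toReal_smul hm (ae_of_all _ fun y => by simp)]
    simp [ENNReal.toReal_ofReal (h0 _)]

lemma norm_le_of_lintegral_rpow_le [Fact (1 < p)] {E α : Type*} [MeasurableSpace α]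
    {μ : Measure α} [NormedAddCommGroup E] (f : Lp E (ENNReal.ofReal p) μ) {c : ℝ} (hc : 0 ≤ c)
    (h : ∫⁻ x, ‖f x‖ₑ ^ p ∂μ ≤ ENNReal.ofReal c ^ p) : ‖f‖ ≤ c := by
  have hp := pos_of_fact p
  rw [Lp.norm_def]
  refine ENNReal.toReal_le_of_le_ofReal hc ?_
  rw [eLpNorm_eq_lintegral_rpow_enorm_toReal (by simpa using hp) ENNReal.ofReal_ne_top,
    ENNReal.toReal_ofReal hp.le, one_div]
  refine (ENNReal.rpow_le_rpow h (by positivity)).trans_eq ?_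
  rw [← ENNReal.rpow_mul, mul_inv_cancel₀ hp.ne', ENNReal.rpow_one]

lemma lintegral_rpow_eq_norm [Fact (1 < p)] {E α : Type*} [MeasurableSpace α]
    {μ : Measure α} [NormedAddCommGroup E] (f : Lp E (ENNReal.ofReal p) μ) :
    ∫⁻ x, ‖f x‖ₑ ^ p ∂μ = ENNReal.ofReal ‖f‖ ^ p := by
  have hp := pos_of_fact p
  rw [Lp.norm_def, ENNReal.ofReal_toReal (Lp.eLpNorm_ne_top f),
    eLpNorm_eq_lintegral_rpow_enorm_toReal (by simpa using hp) ENNReal.ofReal_ne_top,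
    ENNReal.toReal_ofReal hp.le, one_div, ← ENNReal.rpow_mul, inv_mul_cancel₀ hp.ne',
    ENNReal.rpow_one]

/-- Compactness by mollification. The φ_k are bounded in L^1, so one subsequence converges against
every continuous function, in particular against z ↦ ρ(x - z) for all x and all mollifiers ρ. For a
fixed ρ the mollified functions thus converge pointwise; being uniformly bounded on a set of finite
measure, they converge in L^p. Mollifying at radius r moves φ_k in L^p by at most r ‖∇φ_k‖_p,
uniformly in k. -/
lemma exists_subseq_cauchySeq_testPairs [hp : Fact (1 < p)] (hΩ : IsOpen Ω)
    (hΩb : Bornology.IsBounded Ω) {w : ℕ → LpPair p Ω} (hw : ∀ k, w k ∈ testPairs p Ω) {M : ℝ}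
    (hM : ∀ k, ‖w k‖ ≤ M) :
    ∃ σ : ℕ → ℕ, StrictMono σ ∧ CauchySeq fun k => (w (σ k)).1 := by
  have hp0 := pos_of_fact p
  have hM0 : 0 ≤ M := (norm_nonneg _).trans (hM 0)
  choose φ hφ hφc hφs e1 e2 using hw
  set K := closure Ω
  have hK : IsCompact K := hΩb.isCompact_closure
  have hfin : IsFiniteMeasure (volume.restrict Ω) := ⟨by
    rw [Measure.restrict_apply_univ]; exact hΩb.measure_lt_top⟩
  have hzero : ∀ k x, x ∉ Ω → φ k x = 0 := fun k x hx =>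
    image_eq_zero_of_notMem_tsupport fun h => hx (hφs k h)
  have hzeroK : ∀ k x, x ∉ K → φ k x = 0 := fun k x hx => hzero k x fun h => hx (subset_closure h)
  -- From t ≤ 1 + t^p, as Ω has finite measure.
  have hL1 : ∀ k, ∫ x in K, |φ k x| ≤ (volume.restrict Ω).real Set.univ + M ^ p := by
    intro k
    have i1 := integrable_norm_rpow hp0 (Lp.memLp (w k).1)
    have s1 : ∫ x in K, |φ k x| = ∫ x in Ω, |φ k x| := by
      rw [setIntegral_eq_integral_of_forall_compl_eq_zero fun x hx => by simp [hzeroK k x hx],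
        setIntegral_eq_integral_of_forall_compl_eq_zero fun x hx => by simp [hzero k x hx]]
    rw [s1]
    calc ∫ x in Ω, |φ k x| ≤ ∫ x in Ω, (1 + ‖(w k).1 x‖ ^ p) := by
          refine integral_mono_of_nonneg (ae_of_all _ fun x => abs_nonneg _)
            ((integrable_const _).add i1) ?_
          filter_upwards [e1 k] with x hx
          rw [← hx, ← Real.norm_eq_abs]
          rcases le_total ‖(w k).1 x‖ 1 with h | h
          · have : 0 ≤ ‖(w k).1 x‖ ^ p := by positivity
            linarith
          · have := Real.self_le_rpow_of_one_le h hp.out.le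
            linarith
      _ = (volume.restrict Ω).real Set.univ + ‖(w k).1‖ ^ p := by
          rw [integral_add (integrable_const _) i1, integral_norm_rpow_eq hp0]
          simp
      _ ≤ _ := by
          gcongr
          exact (norm_fst_le _).trans (hM k)
  obtain ⟨σ, hσ, hlim⟩ := exists_subseq_integral_tendsto hK (fun k => (hφ k).continuous) hL1
  refine ⟨σ, hσ, cauchySeq_of_forall_approx fun ε hε => ?_⟩
  -- With radius ε/(M + 1) the mollification error is at most ε M/(M + 1) ≤ ε.
  obtain ⟨ρ, ν, hρ, ⟨C, hC⟩, hν, hνε, hνρ⟩ := exists_mollifier n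
    (by positivity : 0 < ε / (M + 1))
  have hconv : ∀ k x, ∫ y, φ k (x - y) ∂ν = ∫ z in K, ρ (x - z) * φ k z := by
    intro k x
    rw [hνρ, setIntegral_eq_integral_of_forall_compl_eq_zero
      fun z hz => by simp [hzeroK k z hz],
      ← integral_sub_left_eq_self (fun z => ρ (x - z) * φ k z) volume x]
    simp
  have hcont : ∀ k, Continuous fun x => ∫ y, φ k (x - y) ∂ν := by
    intro k
    obtain ⟨D, hD⟩ := (hφ k).continuous.bounded_above_of_compact_support (hφc k)
    have hφk := (hφ k).continuous
    exact continuous_of_dominated (bound := fun _ => D)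
      (fun x => Continuous.aestronglyMeasurable (by fun_prop))
      (fun x => ae_of_all _ fun y => hD _) (integrable_const _)
      (ae_of_all _ fun y => by fun_prop)
  set D := C * ((volume.restrict Ω).real Set.univ + M ^ p)
  have hbd : ∀ k x, ‖∫ y, φ k (x - y) ∂ν‖ ≤ D := by
    intro k x
    have hφk := (hφ k).continuous
    have hC0 : 0 ≤ C := (abs_nonneg _).trans (hC 0)
    have i1 : IntegrableOn (fun z => |φ k z|) K :=
      (Continuous.continuousOn (by fun_prop)).integrableOn_compact hK
    rw [hconv]
    refine (norm_integral_le_integral_norm _).trans ?_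
    calc ∫ z in K, ‖ρ (x - z) * φ k z‖ ≤ ∫ z in K, C * |φ k z| := by
          refine integral_mono_of_nonneg (ae_of_all _ fun _ => norm_nonneg _)
            (i1.const_mul C) (ae_of_all _ fun z => ?_)
          simp only [norm_mul, Real.norm_eq_abs]
          gcongr
          exact hC _
      _ = C * ∫ z in K, |φ k z| := integral_const_mul _ _
      _ ≤ _ := mul_le_mul_of_nonneg_left (hL1 k) hC0
  have hmem : ∀ k, MemLp (fun x => ∫ y, φ k (x - y) ∂ν) (ENNReal.ofReal p)
      (volume.restrict Ω) := fun k =>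
    MemLp.of_bound (hcont k).aestronglyMeasurable D (ae_of_all _ (hbd k))
  have hpt : ∀ x, ∃ a, Tendsto (fun k => ∫ y, φ (σ k) (x - y) ∂ν) atTop (𝓝 a) := fun x => by
    simp only [hconv]
    exact hlim (fun z => ρ (x - z)) (by fun_prop)
  choose ψ hψ using hpt
  have hψm : Measurable ψ := measurable_of_tendsto_metrizable
    (fun k => (hcont (σ k)).measurable) (tendsto_pi_nhds.2 hψ)
  have hψbd : ∀ x, ‖ψ x‖ ≤ D := fun x =>
    le_of_tendsto (hψ x).norm (Eventually.of_forall fun k => hbd (σ k) x)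
  have hψmem : MemLp ψ (ENNReal.ofReal p) (volume.restrict Ω) :=
    MemLp.of_bound hψm.aestronglyMeasurable D (ae_of_all _ hψbd)
  refine ⟨fun k => (hmem (σ k)).toLp _, Tendsto.cauchySeq (x := hψmem.toLp ψ)
    (tendsto_Lp_of_tendsto_integral ?_), fun k => ?_⟩
  · have l1 : Tendsto (fun k => ∫ x in Ω, ‖(∫ y, φ (σ k) (x - y) ∂ν) - ψ x‖ ^ p) atTop
        (𝓝 (∫ x in Ω, (0 : ℝ))) := by
      refine tendsto_integral_of_dominated_convergence (fun _ => (D + D) ^ p) (fun k => ?_)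
        (integrable_const _) (fun k => ae_of_all _ fun x => ?_) (ae_of_all _ fun x => ?_)
      · exact (integrable_norm_rpow hp0 ((hmem (σ k)).sub hψmem)).1
      · rw [Real.norm_of_nonneg (by positivity)]
        refine Real.rpow_le_rpow (norm_nonneg _) ?_ hp0.le
        exact (norm_sub_le _ _).trans (add_le_add (hbd _ _) (hψbd _))
      · exact tendsto_norm_sub_rpow hp0 (hψ x)
    rw [integral_zero] at l1
    refine l1.congr fun k => integral_congr_ae ?_
    filter_upwards [(hmem (σ k)).coeFn_toLp, hψmem.coeFn_toLp] with x h1 h2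
    rw [h1, h2]
  · refine norm_le_of_lintegral_rpow_le _ hε.le ?_
    have hgrad : ∫⁻ x, ‖fderiv ℝ (φ (σ k)) x‖ₑ ^ p ≤ ENNReal.ofReal M ^ p := by
      have s1 : ∫⁻ x, ‖fderiv ℝ (φ (σ k)) x‖ₑ ^ p = ∫⁻ x in Ω, ‖gradient (φ (σ k)) x‖ₑ ^ p := by
        rw [← lintegral_indicator hΩ.measurableSet]
        refine lintegral_congr fun x => ?_
        by_cases hx : x ∈ Ω
        · rw [Set.indicator_of_mem hx, ← ofReal_norm, ← ofReal_norm, norm_gradient_eq]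
        · rw [Set.indicator_of_notMem hx]
          have : fderiv ℝ (φ (σ k)) x = 0 := by
            by_contra h
            exact hx (hφs (σ k) (support_fderiv_subset ℝ h))
          rw [this, ← ofReal_norm, norm_zero, ENNReal.ofReal_zero, ENNReal.zero_rpow_of_pos hp0]
      rw [s1]
      calc _ = ∫⁻ x in Ω, ‖(w (σ k)).2 x‖ₑ ^ p := by
            refine lintegral_congr_ae ?_
            filter_upwards [e2 (σ k)] with x hx
            rw [hx]
        _ = _ := lintegral_rpow_eq_norm _
        _ ≤ _ := by
            gcongr
            exact (norm_snd_le _).trans (hM (σ k))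
    calc _ = ∫⁻ x in Ω, ‖(∫ y, φ (σ k) (x - y) ∂ν) - φ (σ k) x‖ₑ ^ p := by
          refine lintegral_congr_ae ?_
          filter_upwards [Lp.coeFn_sub (w (σ k)).1 ((hmem (σ k)).toLp _),
            (hmem (σ k)).coeFn_toLp, e1 (σ k)] with x h1 h2 h3
          rw [h1, Pi.sub_apply, h2, h3, ← enorm_neg, neg_sub]
      _ ≤ ∫⁻ x, ‖(∫ y, φ (σ k) (x - y) ∂ν) - φ (σ k) x‖ₑ ^ p := setLIntegral_le_lintegral _ _
      _ ≤ ENNReal.ofReal (ε / (M + 1)) ^ p * ∫⁻ x, ‖fderiv ℝ (φ (σ k)) x‖ₑ ^ p :=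
          lintegral_sub_average_rpow_le hp.out (hφ _) (hφc _) hνε
      _ ≤ ENNReal.ofReal (ε / (M + 1)) ^ p * ENNReal.ofReal M ^ p := by gcongr
      _ = ENNReal.ofReal (ε / (M + 1) * M) ^ p := by
          rw [← ENNReal.mul_rpow_of_nonneg _ _ hp0.le, ← ENNReal.ofReal_mul (by positivity)]
      _ ≤ ENNReal.ofReal ε ^ p := by
          gcongr
          rw [div_mul_eq_mul_div, div_le_iff₀ (by positivity)]
          nlinarith

/-- **Rellich–Kondrachov**: a bounded sequence in `W_0^{1,p}(Ω)` has a subsequence that converges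
in `L^p(Ω)`. -/
lemma exists_subseq_tendsto_fn [Fact (1 < p)] (hΩ : IsOpen Ω) (hΩb : Bornology.IsBounded Ω)
    {u : ℕ → W0 p Ω} {M : ℝ} (hM : ∀ k, ‖(u k : LpPair p Ω)‖ ≤ M) :
    ∃ (σ : ℕ → ℕ) (f : Lp ℝ (ENNReal.ofReal p) (volume.restrict Ω)), StrictMono σ ∧
      Tendsto (fun k => (u (σ k) : LpPair p Ω).1) atTop (𝓝 f) := by
  -- A test pair at distance less than 1/(k + 1) from u_k has the same limit behaviour, so smooth
  -- functions suffice.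
  have happ : ∀ k : ℕ, ∃ w ∈ testPairs p Ω, ‖(u k : LpPair p Ω) - w‖ < 1 / ((k : ℝ) + 1) := by
    intro k
    have hu : (u k : LpPair p Ω) ∈ closure (testPairs p Ω : Set (LpPair p Ω)) := (u k).2
    obtain ⟨w, hw, hd⟩ := Metric.mem_closure_iff.1 hu _ (Nat.one_div_pos_of_nat (α := ℝ) (n := k))
    exact ⟨w, hw, by rwa [dist_eq_norm] at hd⟩
  choose w hw hd using happ
  have hb : ∀ k, ‖w k‖ ≤ M + 1 := fun k => by
    have h1 : (1 : ℝ) / ((k : ℝ) + 1) ≤ 1 := by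
      rw [div_le_one (by positivity)]
      have : (0 : ℝ) ≤ k := Nat.cast_nonneg k
      linarith
    calc ‖w k‖ = ‖(u k : LpPair p Ω) - ((u k : LpPair p Ω) - w k)‖ := by congr 1; abel
      _ ≤ _ := norm_sub_le _ _
      _ ≤ M + 1 := add_le_add (hM k) ((hd k).le.trans h1)
  obtain ⟨σ, hσ, hc⟩ := exists_subseq_cauchySeq_testPairs hΩ hΩb hw hb
  obtain ⟨f, hf⟩ := cauchySeq_tendsto_of_complete hc
  refine ⟨σ, f, hσ, ?_⟩
  have h0 : Tendsto (fun k => (u (σ k) : LpPair p Ω).1 - (w (σ k)).1) atTop (𝓝 0) := by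
    refine squeeze_zero_norm (fun k => ?_)
      (tendsto_one_div_add_atTop_nhds_zero_nat.comp hσ.tendsto_atTop)
    exact (norm_fst_le ((u (σ k) : LpPair p Ω) - w (σ k))).trans (hd (σ k)).le
  simpa using h0.add hf

end Rellich

/-! ### Compactness and lower semicontinuity -/

section LowerSemicontinuity

variable {n : ℕ} {p : ℝ} [hp : Fact (1 < p)] {Ω : Set (Eucl n)}
  {A : Eucl n → Matrix (Fin n) (Fin n) ℝ}

/-- Uniform convexity: a sequence of fields of bounded energy whose convexity gaps tend to zero is
a Cauchy sequence. -/
lemma IsElliptic.cauchySeq_of_gap (hA : IsElliptic Ω A) (hΩ : IsOpen Ω)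
    (hΩb : Bornology.IsBounded Ω) {g : ℕ → Lp (Eucl n) (ENNReal.ofReal p) (volume.restrict Ω)}
    {M : ℝ} (hM : ∀ k, ‖g k‖ ^ p ≤ M) {δ : ℕ → ℝ} (hδ : Tendsto δ atTop (𝓝 0))
    (hgap : ∀ N i j, N ≤ i → N ≤ j → (gradEnergy A (g i) + gradEnergy A (g j)) / 2 -
      gradEnergy A ((2⁻¹ : ℝ) • (g i + g j)) ≤ δ N) : CauchySeq g := by
  have hp0 := pos_of_fact p
  have hM0 : 0 ≤ M := (Real.rpow_nonneg (norm_nonneg _) p).trans (hM 0)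
  rw [Metric.cauchySeq_iff]
  intro η hη
  -- This choice makes the first term at most η^p/2; the gap term is below η^p/2 for N large.
  obtain ⟨C, hC0, hC⟩ := hA.exists_gradEnergy_uniformConvexity (p := p) hΩ hΩb
    (by positivity : 0 < η ^ p / (4 * (M + 1)))
  have h1 : Tendsto (fun N => C * δ N) atTop (𝓝 0) := by simpa using hδ.const_mul C
  obtain ⟨N, hN⟩ := (h1.eventually (gt_mem_nhds (by positivity : 0 < η ^ p / 2))).exists
  refine ⟨N, fun i hi j hj => ?_⟩
  rw [dist_eq_norm]
  refine (Real.rpow_lt_rpow_iff (norm_nonneg _) hη.le hp0).1 ?_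
  have h2 : η ^ p / (4 * (M + 1)) * (‖g i‖ ^ p + ‖g j‖ ^ p) ≤ η ^ p / 2 := by
    calc _ ≤ η ^ p / (4 * (M + 1)) * ((M + 1) + (M + 1)) := by
          gcongr <;> linarith [hM i, hM j]
      _ = _ := by field_simp; ring
  have h3 := mul_le_mul_of_nonneg_left (hgap N i j hi hj) hC0
  linarith [hC (g i) (g j)]

/-- If `u_k → f` in `L^p(Ω)` and the energies of `u_k ∈ W_0^{1,p}(Ω)` converge, then `f` belongs to
`W_0^{1,p}(Ω)` with no larger energy. -/
lemma IsElliptic.exists_normApow_le_of_tendsto (hA : IsElliptic Ω A) (hΩ : IsOpen Ω)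
    (hΩb : Bornology.IsBounded Ω) {u : ℕ → W0 p Ω}
    {f : Lp ℝ (ENNReal.ofReal p) (volume.restrict Ω)} {L : ℝ}
    (hf : Tendsto (fun k => (u k : LpPair p Ω).1) atTop (𝓝 f))
    (hL : Tendsto (fun k => normApow A (u k)) atTop (𝓝 L)) :
    ∃ v : W0 p Ω, (v : LpPair p Ω).1 = f ∧ normApow A v ≤ L := by
  obtain ⟨l, Λ, hl, hΛ, hbd⟩ := hA.exists_gradEnergy_bounds (p := p) hΩ hΩb
  -- In place of weak limits, convex hulls of the tails of the sequence are used. Their minimal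
  -- energies ν k increase to some ν₀ ≤ L.
  set C : ℕ → Set (W0 p Ω) := fun k => convexHull ℝ (u '' Set.Ici k) with hCdef
  have hCanti : Antitone C := fun i j hij =>
    convexHull_mono (Set.image_mono (Set.Ici_subset_Ici.2 hij))
  have hCu : ∀ k i, k ≤ i → u i ∈ C k := fun k i hi => subset_convexHull ℝ _ ⟨i, hi, rfl⟩
  have hE0 : ∀ w : W0 p Ω, 0 ≤ normApow A w := fun w => hA.gradEnergy_nonneg hΩ _
  have hbb : ∀ k, BddBelow (normApow A '' C k) := fun k => ⟨0, by
    rintro _ ⟨w, -, rfl⟩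
    exact hE0 w⟩
  have hne : ∀ k, (normApow A '' C k).Nonempty := fun k => ⟨_, u k, hCu k k le_rfl, rfl⟩
  set ν : ℕ → ℝ := fun k => sInf (normApow A '' C k) with hν
  have hνle : ∀ k, ∀ w ∈ C k, ν k ≤ normApow A w := fun k w hw => csInf_le (hbb k) ⟨w, hw, rfl⟩
  have hνmono : Monotone ν := fun i j hij =>
    csInf_le_csInf (hbb i) (hne j) (Set.image_mono (hCanti hij))
  have hνL : ∀ k, ν k ≤ L := fun k => ge_of_tendsto hL
    ((eventually_ge_atTop k).mono fun i hi => hνle k _ (hCu k i hi))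
  have hνbdd : BddAbove (Set.range ν) := ⟨L, by rintro _ ⟨k, rfl⟩; exact hνL k⟩
  have hνlim := tendsto_atTop_ciSup hνmono hνbdd
  set ν₀ := ⨆ k, ν k with hν₀
  have hνν₀ : ∀ k, ν k ≤ ν₀ := fun k => le_ciSup hνbdd k
  have hν₀L : ν₀ ≤ L := ciSup_le hνL
  -- Near-minimizers of the energy on the hulls: these will converge strongly, unlike the u_k.
  have hex : ∀ k : ℕ, ∃ w ∈ C k, normApow A w < ν k + 1 / ((k : ℝ) + 1) := fun k => by
    obtain ⟨_, ⟨w, hw, rfl⟩, hlt⟩ := exists_lt_of_csInf_lt (hne k)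
      (lt_add_of_pos_right (ν k) (Nat.one_div_pos_of_nat (α := ℝ) (n := k)))
    exact ⟨w, hw, hlt⟩
  choose v hvC hvlt using hex
  have hone : ∀ N i : ℕ, N ≤ i → (1 : ℝ) / ((i : ℝ) + 1) ≤ 1 / ((N : ℝ) + 1) := fun N i hi =>
    Nat.one_div_le_one_div hi
  have hvν : ∀ N i, N ≤ i → normApow A (v i) ≤ ν₀ + 1 / ((N : ℝ) + 1) := fun N i hi => by
    linarith [hvlt i, hνν₀ i, hone N i hi]
  have hvM : ∀ i, ‖(v i : LpPair p Ω).2‖ ^ p ≤ (L + 1) / l := fun i => by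
    rw [le_div_iff₀ hl, mul_comm]
    have h1 := (hbd (v i : LpPair p Ω).2).1
    have h2 := hvν 0 i (Nat.zero_le i)
    rw [normApow_eq_gradEnergy] at h2
    norm_num at h2
    linarith
  have hcau : CauchySeq fun k => (v k : LpPair p Ω).2 := by
    -- For i, j ≥ N the midpoint of v_i and v_j lies in C N, so its energy is at least ν N, while
    -- both endpoints have energy at most ν₀ + 1/(N + 1). The difference bounds the convexity gap
    -- and tends to 0.
    refine hA.cauchySeq_of_gap hΩ hΩb hvM (δ := fun N => ν₀ - ν N + 1 / ((N : ℝ) + 1)) ?_ ?_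
    · have := (tendsto_const_nhds (x := ν₀)).sub hνlim |>.add
        tendsto_one_div_add_atTop_nhds_zero_nat
      simpa using this
    · intro N i j hi hj
      have hmid : (2⁻¹ : ℝ) • (v i + v j) ∈ C N := by
        rw [smul_add]
        exact (convex_convexHull ℝ _) (hCanti hi (hvC i)) (hCanti hj (hvC j))
          (by norm_num) (by norm_num) (by norm_num)
      have h1 := hνle N _ hmid
      have h2 := hvν N i hi
      have h3 := hvν N j hj
      rw [normApow_eq_gradEnergy] at h1 h2 h3
      have h4 : (((2⁻¹ : ℝ) • (v i + v j) : W0 p Ω) : LpPair p Ω).2 =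
        (2⁻¹ : ℝ) • ((v i : LpPair p Ω).2 + (v j : LpPair p Ω).2) := rfl
      rw [h4] at h1
      linarith
  obtain ⟨g, hg⟩ := cauchySeq_tendsto_of_complete hcau
  have hvf : Tendsto (fun k => (v k : LpPair p Ω).1) atTop (𝓝 f) := by
    rw [Metric.tendsto_atTop] at hf ⊢
    intro ε hε
    obtain ⟨N, hN⟩ := hf (ε / 2) (half_pos hε)
    refine ⟨N, fun k hk => ?_⟩
    -- Balls are convex: once the tail of (u_k) is close to f in L^p, so is its hull, and v_k
    -- inherits the limit f.
    have hconv : Convex ℝ {w : W0 p Ω | (w : LpPair p Ω).1 ∈ Metric.closedBall f (ε / 2)} :=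
      (convex_closedBall f (ε / 2)).linear_preimage
        ((LinearMap.fst ℝ _ _).comp (W0 p Ω).subtype)
    have hsub : C k ⊆ {w : W0 p Ω | (w : LpPair p Ω).1 ∈ Metric.closedBall f (ε / 2)} := by
      refine convexHull_min ?_ hconv
      rintro _ ⟨i, hi, rfl⟩
      exact (hN i (le_trans hk hi)).le
    have := hsub (hvC k)
    rw [Set.mem_ofPred_eq, Metric.mem_closedBall] at this
    linarith
  have hlim : Tendsto (fun k => (v k : LpPair p Ω)) atTop (𝓝 (f, g)) := hvf.prodMk_nhds hg
  have hmem : ((f, g) : LpPair p Ω) ∈ W0 p Ω :=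
    (Submodule.isClosed_topologicalClosure _).mem_of_tendsto hlim
      (Eventually.of_forall fun k => (v k).2)
  refine ⟨⟨(f, g), hmem⟩, rfl, ?_⟩
  have hE := hA.tendsto_gradEnergy hΩ hΩb hg
  have hup : Tendsto (fun k : ℕ => ν₀ + 1 / ((k : ℝ) + 1)) atTop (𝓝 ν₀) := by
    simpa using tendsto_one_div_add_atTop_nhds_zero_nat.const_add ν₀
  exact (le_of_tendsto_of_tendsto' hE hup fun k => hvν k k le_rfl).trans hν₀L

/-- Bounded sequences in `W_0^{1,p}(Ω)` have subsequences that converge in `L^p(Ω)` to an element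
of `W_0^{1,p}(Ω)`, along which the energy is lower semicontinuous. -/
lemma IsElliptic.exists_subseq_limit (hA : IsElliptic Ω A) (hΩ : IsOpen Ω)
    (hΩb : Bornology.IsBounded Ω) {u : ℕ → W0 p Ω} {M : ℝ}
    (hM : ∀ k, normApow A (u k) ≤ M) (hM' : ∀ k, ‖(u k : LpPair p Ω)‖ ≤ M) :
    ∃ (σ : ℕ → ℕ) (v : W0 p Ω) (L : ℝ), StrictMono σ ∧
      Tendsto (fun k => (u (σ k) : LpPair p Ω).1) atTop (𝓝 (v : LpPair p Ω).1) ∧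
      Tendsto (fun k => normApow A (u (σ k))) atTop (𝓝 L) ∧ normApow A v ≤ L := by
  obtain ⟨σ, f, hσ, hf⟩ := exists_subseq_tendsto_fn hΩ hΩb hM'
  obtain ⟨L, -, τ, hτ, hL⟩ := isCompact_Icc.tendsto_subseq (x := fun k => normApow A (u (σ k)))
    (s := Set.Icc 0 M) fun k => ⟨hA.gradEnergy_nonneg hΩ _, hM _⟩
  have hf' := hf.comp hτ.tendsto_atTop
  obtain ⟨v, hv, hle⟩ := hA.exists_normApow_le_of_tendsto hΩ hΩb hf' hL
  exact ⟨σ ∘ τ, v, L, hσ.comp hτ, hv ▸ hf', hL, hle⟩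

/-- The same for vector-valued sequences. -/
lemma IsElliptic.exists_subseq_limit_vec (hA : IsElliptic Ω A) (hΩ : IsOpen Ω)
    (hΩb : Bornology.IsBounded Ω) {d : ℕ} {u : ℕ → W0Vec p Ω d} {M : ℝ}
    (hM : ∀ k j, normApow A (u k j) ≤ M) (hM' : ∀ k j, ‖(u k j : LpPair p Ω)‖ ≤ M) :
    ∃ (σ : ℕ → ℕ) (v : W0Vec p Ω d) (L : Fin d → ℝ), StrictMono σ ∧ ∀ j,
      Tendsto (fun k => (u (σ k) j : LpPair p Ω).1) atTop (𝓝 (v j : LpPair p Ω).1) ∧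
      Tendsto (fun k => normApow A (u (σ k) j)) atTop (𝓝 (L j)) ∧ normApow A (v j) ≤ L j ∧
      ∀ᵐ x ∂(volume.restrict Ω),
        Tendsto (fun k => W0.fn (u (σ k) j) x) atTop (𝓝 (W0.fn (v j) x)) := by
  suffices h : ∀ s : Finset (Fin d), ∃ σ : ℕ → ℕ, StrictMono σ ∧ ∀ j ∈ s,
      ∃ (v : W0 p Ω) (L : ℝ),
      Tendsto (fun k => (u (σ k) j : LpPair p Ω).1) atTop (𝓝 (v : LpPair p Ω).1) ∧
      Tendsto (fun k => normApow A (u (σ k) j)) atTop (𝓝 L) ∧ normApow A v ≤ L ∧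
      ∀ᵐ x ∂(volume.restrict Ω),
        Tendsto (fun k => W0.fn (u (σ k) j) x) atTop (𝓝 (W0.fn v x)) by
    obtain ⟨σ, hσ, h⟩ := h Finset.univ
    choose v L h using fun j => h j (Finset.mem_univ j)
    exact ⟨σ, v, L, hσ, h⟩
  intro s
  -- Successive extraction, one component at a time; earlier limits survive further subsequences.
  induction s using Finset.induction_on with
  | empty => exact ⟨id, strictMono_id, by simp⟩
  | insert i s _ ih =>
    obtain ⟨σ, hσ, h⟩ := ih
    obtain ⟨τ, w, L, hτ, h1, h2, h3⟩ := hA.exists_subseq_limit hΩ hΩb (u := fun k => u (σ k) i)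
      (fun k => hM _ _) (fun k => hM' _ _)
    obtain ⟨ρ, hρ, hae⟩ := exists_subseq_tendsto_ae h1
    refine ⟨σ ∘ τ ∘ ρ, hσ.comp (hτ.comp hρ), fun j hj => ?_⟩
    rcases Finset.mem_insert.1 hj with rfl | hj
    · exact ⟨w, L, h1.comp hρ.tendsto_atTop, h2.comp hρ.tendsto_atTop, h3, hae⟩
    · obtain ⟨v, L, g1, g2, g3, g4⟩ := h j hj
      have ht := (hτ.comp hρ).tendsto_atTop
      exact ⟨v, L, g1.comp ht, g2.comp ht, g3, g4.mono fun x hx => hx.comp ht⟩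

end LowerSemicontinuity

/-! ### Integral functionals of homogeneous functions -/

section HomogeneousIntegrals

variable {α E : Type*} [MeasurableSpace α] {μ : Measure α} [NormedAddCommGroup E]
  [NormedSpace ℝ E] [FiniteDimensional ℝ E] {r : ℝ} {H : E → ℝ}

lemma Homog.integrable_comp (hr : 0 < r) (hH : Homog r H) (hHc : Continuous H) {f : α → E}
    (hf : MemLp f (ENNReal.ofReal r) μ) : Integrable (fun x => H (f x)) μ := by
  obtain ⟨C, hC0, hC⟩ := hH.exists_growth hr hHc
  exact ((integrable_norm_rpow hr hf).const_mul C).mono' (hHc.comp_aestronglyMeasurable hf.1)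
    (ae_of_all _ fun x => hC _)

lemma Homog.tendsto_integral_comp (hr : 0 < r) (hH : Homog r H) (hHc : Continuous H) {ι : Type*}
    {l : Filter ι} {f : ι → α → E} {g : α → E} (hf : ∀ i, MemLp (f i) (ENNReal.ofReal r) μ)
    (hg : MemLp g (ENNReal.ofReal r) μ)
    (h : Tendsto (fun i => ∫ x, ‖f i x - g x‖ ^ r ∂μ) l (𝓝 0)) :
    Tendsto (fun i => ∫ x, H (f i x) ∂μ) l (𝓝 (∫ x, H (g x) ∂μ)) := by
  refine tendsto_of_forall_abs_sub_le (K := ∫ x, ‖g x‖ ^ r ∂μ) h fun ε hε => ?_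
  obtain ⟨C, hC0, hC⟩ := hH.exists_abs_add_sub_le hr hHc hε
  refine ⟨C, fun i => ?_⟩
  have i1 := integrable_norm_rpow hr hg
  have i2 : Integrable (fun x => ‖f i x - g x‖ ^ r) μ := integrable_norm_rpow hr ((hf i).sub hg)
  have i3 := hH.integrable_comp hr hHc (hf i)
  have i4 := hH.integrable_comp hr hHc hg
  rw [← integral_sub i3 i4, ← integral_const_mul, ← integral_const_mul,
    ← integral_add (i1.const_mul ε) (i2.const_mul C)]
  refine abs_integral_le_integral_abs.trans
    (integral_mono (i3.sub i4).abs ((i1.const_mul ε).add (i2.const_mul C)) fun x => ?_)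
  have := hC (g x) (f i x - g x)
  rwa [add_sub_cancel] at this

/-- Dominated convergence for homogeneous integrands. -/
lemma Homog.tendsto_integral_of_dominated (hr : 0 < r) (hH : Homog r H) (hHc : Continuous H)
    {f : ℕ → α → E} {g : α → E} {b : α → ℝ} (hf : ∀ i, AEStronglyMeasurable (f i) μ)
    (hb : Integrable (fun x => b x ^ r) μ) (hfb : ∀ i x, ‖f i x‖ ≤ b x)
    (h : ∀ᵐ x ∂μ, Tendsto (fun i => f i x) atTop (𝓝 (g x))) :
    Tendsto (fun i => ∫ x, H (f i x) ∂μ) atTop (𝓝 (∫ x, H (g x) ∂μ)) := by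
  obtain ⟨C, hC0, hC⟩ := hH.exists_growth hr hHc
  refine tendsto_integral_of_dominated_convergence (fun x => C * b x ^ r)
    (fun i => hHc.comp_aestronglyMeasurable (hf i)) (hb.const_mul C)
    (fun i => ae_of_all _ fun x => ?_) (h.mono fun x hx => (hHc.tendsto _).comp hx)
  refine (hC _).trans ?_
  gcongr
  exact hfb i x

end HomogeneousIntegrals

/-! ### Vector-valued functions -/

/-- The norm of `Fin d → ℝ` is the sup norm, whereas the problem is phrased with sums of |s_j|^r;
this is the comparison needed. -/
lemma norm_rpow_le_sum {d : ℕ} {r : ℝ} (hr : 0 < r) (s : Fin d → ℝ) :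
    ‖s‖ ^ r ≤ ∑ j, |s j| ^ r := by
  have h0 : 0 ≤ ∑ j, |s j| ^ r := Finset.sum_nonneg fun j _ => by positivity
  have h : ‖s‖ ≤ (∑ j, |s j| ^ r) ^ r⁻¹ := by
    refine (pi_norm_le_iff_of_nonneg (by positivity)).2 fun j => ?_
    have h1 : |s j| ^ r ≤ ∑ j, |s j| ^ r :=
      Finset.single_le_sum (f := fun j => |s j| ^ r) (fun j _ => by positivity)
        (Finset.mem_univ j)
    have h2 := Real.rpow_le_rpow (by positivity) h1 (inv_pos.2 hr).le
    rwa [← Real.rpow_mul (abs_nonneg _), mul_inv_cancel₀ hr.ne', Real.rpow_one] at h2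
  have h2 := Real.rpow_le_rpow (norm_nonneg _) h hr.le
  rwa [← Real.rpow_mul h0, inv_mul_cancel₀ hr.ne', Real.rpow_one] at h2

section Vec

variable {n d : ℕ} {p : ℝ} [hp : Fact (1 < p)] {Ω : Set (Eucl n)}
  {A : Eucl n → Matrix (Fin n) (Fin n) ℝ}

lemma isFiniteMeasure_restrict (hΩb : Bornology.IsBounded Ω) :
    IsFiniteMeasure (volume.restrict Ω) :=
  ⟨by rw [Measure.restrict_apply_univ]; exact hΩb.measure_lt_top⟩

lemma W0Vec.memLp_fn (u : W0Vec p Ω d) :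
    MemLp (W0Vec.fn u) (ENNReal.ofReal p) (volume.restrict Ω) :=
  memLp_pi_iff.2 fun j => W0.memLp_fn (u j)

lemma W0Vec.memLp_fn_critExp (hpn : p < n) (u : W0Vec p Ω d) :
    MemLp (W0Vec.fn u) (ENNReal.ofReal (critExp n p)) (volume.restrict Ω) :=
  memLp_pi_iff.2 fun j => W0.memLp_fn_critExp hpn (u j)

lemma normLpow_eq_norm (u : W0 p Ω) : normLpow u = ‖(u : LpPair p Ω).1‖ ^ p := by
  rw [← integral_norm_rpow_eq (pos_of_fact p)]
  rfl

lemma W0.fn_smul (c : ℝ) (u : W0 p Ω) :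
    W0.fn (c • u) =ᵐ[volume.restrict Ω] fun x => c * W0.fn u x :=
  Lp.coeFn_smul c (u : LpPair p Ω).1

lemma W0.fn_add (u v : W0 p Ω) :
    W0.fn (u + v) =ᵐ[volume.restrict Ω] fun x => W0.fn u x + W0.fn v x :=
  Lp.coeFn_add (u : LpPair p Ω).1 (v : LpPair p Ω).1

lemma W0.fn_sub (u v : W0 p Ω) :
    W0.fn (u - v) =ᵐ[volume.restrict Ω] fun x => W0.fn u x - W0.fn v x :=
  Lp.coeFn_sub (u : LpPair p Ω).1 (v : LpPair p Ω).1

lemma W0.grad_smul (c : ℝ) (u : W0 p Ω) :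
    W0.grad (c • u) =ᵐ[volume.restrict Ω] fun x => c • W0.grad u x :=
  Lp.coeFn_smul c (u : LpPair p Ω).2

lemma W0.grad_add (u v : W0 p Ω) :
    W0.grad (u + v) =ᵐ[volume.restrict Ω] fun x => W0.grad u x + W0.grad v x :=
  Lp.coeFn_add (u : LpPair p Ω).2 (v : LpPair p Ω).2

lemma W0.grad_sub (u v : W0 p Ω) :
    W0.grad (u - v) =ᵐ[volume.restrict Ω] fun x => W0.grad u x - W0.grad v x :=
  Lp.coeFn_sub (u : LpPair p Ω).2 (v : LpPair p Ω).2

lemma W0Vec.fn_smul (c : ℝ) (u : W0Vec p Ω d) :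
    W0Vec.fn (c • u) =ᵐ[volume.restrict Ω] fun x => c • W0Vec.fn u x := by
  filter_upwards [ae_all_iff.2 fun j => W0.fn_smul c (u j)] with x hx
  funext j
  exact hx j

lemma W0Vec.fn_sub (u v : W0Vec p Ω d) :
    W0Vec.fn (u - v) =ᵐ[volume.restrict Ω] fun x => W0Vec.fn u x - W0Vec.fn v x := by
  filter_upwards [ae_all_iff.2 fun j => W0.fn_sub (u j) (v j)] with x hx
  funext j
  exact hx j

lemma W0Vec.fn_add (u v : W0Vec p Ω d) :
    W0Vec.fn (u + v) =ᵐ[volume.restrict Ω] fun x => W0Vec.fn u x + W0Vec.fn v x := by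
  filter_upwards [ae_all_iff.2 fun j => W0.fn_add (u j) (v j)] with x hx
  funext j
  exact hx j

lemma normLpow_nonneg (u : W0 p Ω) : 0 ≤ normLpow u :=
  integral_nonneg fun x => by positivity

lemma IsElliptic.normApow_nonneg (hA : IsElliptic Ω A) (hΩ : IsOpen Ω) (u : W0 p Ω) :
    0 ≤ normApow A u := hA.gradEnergy_nonneg hΩ _

lemma IsElliptic.normApowVec_nonneg (hA : IsElliptic Ω A) (hΩ : IsOpen Ω) (u : W0Vec p Ω d) :
    0 ≤ normApowVec A u := Finset.sum_nonneg fun _ _ => hA.normApow_nonneg hΩ _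

lemma IsElliptic.normApow_smul (hA : IsElliptic Ω A) (hΩ : IsOpen Ω)
    (hΩb : Bornology.IsBounded Ω) (c : ℝ) (u : W0 p Ω) :
    normApow A (c • u) = |c| ^ p * normApow A u :=
  hA.gradEnergy_smul hΩ hΩb c (u : LpPair p Ω).2

lemma IsElliptic.normApowVec_smul (hA : IsElliptic Ω A) (hΩ : IsOpen Ω)
    (hΩb : Bornology.IsBounded Ω) (c : ℝ) (u : W0Vec p Ω d) :
    normApowVec A (c • u) = |c| ^ p * normApowVec A u := by
  simp only [normApowVec, Pi.smul_apply, hA.normApow_smul hΩ hΩb, Finset.mul_sum]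

lemma normLpow_smul (c : ℝ) (u : W0 p Ω) : normLpow (c • u) = |c| ^ p * normLpow u := by
  have h : ((c • u : W0 p Ω) : LpPair p Ω).1 = c • (u : LpPair p Ω).1 := rfl
  rw [normLpow_eq_norm, normLpow_eq_norm, h, norm_smul,
    Real.mul_rpow (norm_nonneg _) (norm_nonneg _), Real.norm_eq_abs]

omit hp in
lemma integralOf_congr {f g : Eucl n → Fin d → ℝ} {H : (Fin d → ℝ) → ℝ}
    (h : f =ᵐ[volume.restrict Ω] g) : ∫ x in Ω, H (f x) = ∫ x in Ω, H (g x) :=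
  integral_congr_ae (h.mono fun x hx => by simp only [hx])

lemma Homog.integralOf_smul {r : ℝ} {H : (Fin d → ℝ) → ℝ} (hH : Homog r H) {c : ℝ} (hc : 0 < c)
    (u : W0Vec p Ω d) : integralOf H (c • u) = c ^ r * integralOf H u := by
  rw [integralOf, integralOf, integralOf_congr (W0Vec.fn_smul c u), ← integral_const_mul]
  simp only [hH c _ hc]

/-- Convergence of the components in `L^p(Ω)` implies convergence of `∫_Ω H(u)`. -/
lemma tendsto_integral_norm_sub_rpow {u : ℕ → W0Vec p Ω d} {v : W0Vec p Ω d}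
    (h : ∀ j, Tendsto (fun k => (u k j : LpPair p Ω).1) atTop (𝓝 (v j : LpPair p Ω).1)) :
    Tendsto (fun k => ∫ x in Ω, ‖W0Vec.fn (u k) x - W0Vec.fn v x‖ ^ p) atTop (𝓝 0) := by
  have hp0 := pos_of_fact p
  have h1 : Tendsto (fun k => ∑ j, ‖(u k j : LpPair p Ω).1 - (v j : LpPair p Ω).1‖ ^ p) atTop
      (𝓝 (∑ _j : Fin d, 0)) :=
    tendsto_finsetSum _ fun j _ => tendsto_norm_sub_rpow hp0 (h j)
  rw [Finset.sum_const_zero] at h1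
  refine squeeze_zero (fun k => integral_nonneg fun x => by positivity) (fun k => ?_) h1
  have i1 : ∀ j, Integrable (fun x => |W0.fn (u k j) x - W0.fn (v j) x| ^ p)
      (volume.restrict Ω) := fun j =>
    integrable_norm_rpow hp0 ((W0.memLp_fn (u k j)).sub (W0.memLp_fn (v j)))
  calc ∫ x in Ω, ‖W0Vec.fn (u k) x - W0Vec.fn v x‖ ^ p
      ≤ ∫ x in Ω, ∑ j, |W0.fn (u k j) x - W0.fn (v j) x| ^ p :=
        integral_mono (integrable_norm_rpow hp0 ((W0Vec.memLp_fn (u k)).sub (W0Vec.memLp_fn v)))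
          (integrable_finsetSum _ fun j _ => i1 j) fun x => norm_rpow_le_sum hp0 _
    _ = ∑ j, ∫ x in Ω, |W0.fn (u k j) x - W0.fn (v j) x| ^ p :=
        integral_finsetSum _ fun j _ => i1 j
    _ = _ := by
        refine Finset.sum_congr rfl fun j _ => ?_
        rw [← integral_norm_rpow_eq hp0]
        refine integral_congr_ae ?_
        filter_upwards [Lp.coeFn_sub (u k j : LpPair p Ω).1 (v j : LpPair p Ω).1] with x hx
        rw [hx, Pi.sub_apply, Real.norm_eq_abs]
        rfl

/-- The Sobolev inequality for `∫_Ω ‖u‖^{p^*}`. -/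
lemma IsElliptic.exists_integral_norm_critExp_le (hA : IsElliptic Ω A) (hpn : p < n)
    (hΩ : IsOpen Ω) (hΩb : Bornology.IsBounded Ω) (d : ℕ) : ∃ S, 0 ≤ S ∧ ∀ u : W0Vec p Ω d,
      ∫ x in Ω, ‖W0Vec.fn u x‖ ^ critExp n p ≤ S * normApowVec A u ^ (critExp n p / p) := by
  have hp0 := pos_of_fact p
  have hq := hp0.trans (lt_critExp hp.out hpn)
  obtain ⟨C, hC0, hC⟩ := exists_integral_critExp_le hpn Ω
  obtain ⟨l, L, hl, hL, hbd⟩ := hA.exists_gradEnergy_bounds (p := p) hΩ hΩb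
  -- One Sobolev constant per component; 1/l converts ‖∇u_j‖^p into the A-energy before the power
  -- p*/p is taken.
  refine ⟨d * (C * (1 / l) ^ (critExp n p / p)), by positivity, fun u => ?_⟩
  have i1 : ∀ j, Integrable (fun x => |W0.fn (u j) x| ^ critExp n p) (volume.restrict Ω) :=
    fun j => integrable_norm_rpow hq (W0.memLp_fn_critExp hpn (u j))
  have hj : ∀ j, ∫ x in Ω, |W0.fn (u j) x| ^ critExp n p ≤
      C * (1 / l) ^ (critExp n p / p) * normApowVec A u ^ (critExp n p / p) := fun j => by
    refine (hC (u j)).trans ?_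
    rw [mul_assoc, ← Real.mul_rpow (by positivity) (hA.normApowVec_nonneg hΩ u)]
    refine mul_le_mul_of_nonneg_left ?_ hC0
    have h1 : ‖(u j : LpPair p Ω).2‖ ^ p ≤ 1 / l * normApowVec A u := by
      rw [one_div, ← div_eq_inv_mul, le_div_iff₀ hl, mul_comm]
      exact (hbd _).1.trans (Finset.single_le_sum (f := fun j => normApow A (u j))
        (fun j _ => hA.normApow_nonneg hΩ _) (Finset.mem_univ j))
    calc ‖(u j : LpPair p Ω).2‖ ^ critExp n p
        = (‖(u j : LpPair p Ω).2‖ ^ p) ^ (critExp n p / p) := by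
          rw [← Real.rpow_mul (norm_nonneg _), mul_div_cancel₀ _ hp0.ne']
      _ ≤ _ := Real.rpow_le_rpow (by positivity) h1 (by positivity)
  calc ∫ x in Ω, ‖W0Vec.fn u x‖ ^ critExp n p
      ≤ ∫ x in Ω, ∑ j, |W0.fn (u j) x| ^ critExp n p :=
        integral_mono (integrable_norm_rpow hq (W0Vec.memLp_fn_critExp hpn u))
          (integrable_finsetSum _ fun j _ => i1 j) fun x => norm_rpow_le_sum hq _
    _ = ∑ j, ∫ x in Ω, |W0.fn (u j) x| ^ critExp n p := integral_finsetSum _ fun j _ => i1 j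
    _ ≤ ∑ _j : Fin d, C * (1 / l) ^ (critExp n p / p) * normApowVec A u ^ (critExp n p / p) :=
        Finset.sum_le_sum fun j _ => hj j
    _ = _ := by
        rw [Finset.sum_const, Finset.card_univ, Fintype.card_fin, nsmul_eq_mul]
        ring

end Vec

/-! ### Coercivity of the energy -/

section Coercivity

variable {n d : ℕ} {p : ℝ} [hp : Fact (1 < p)] {Ω : Set (Eucl n)}
  {A : Eucl n → Matrix (Fin n) (Fin n) ℝ} {F G : (Fin d → ℝ) → ℝ}

/-- Both sides have degree p, so u is normalized to unit L^p-norm; the case of norm zero is treated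
apart. -/
lemma IsElliptic.lambdaOne_mul_normLpow_le (hA : IsElliptic Ω A) (hΩ : IsOpen Ω)
    (hΩb : Bornology.IsBounded Ω) (u : W0 p Ω) :
    lambdaOne p Ω A * normLpow u ≤ normApow A u := by
  have hp0 := pos_of_fact p
  rcases (normLpow_nonneg u).eq_or_lt with h0 | h0
  · rw [← h0, mul_zero]
    exact hA.normApow_nonneg hΩ u
  have hc : |(normLpow u) ^ (-p⁻¹)| ^ p = (normLpow u)⁻¹ := by
    rw [abs_of_pos (by positivity), ← Real.rpow_mul h0.le, neg_mul, inv_mul_cancel₀ hp0.ne',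
      Real.rpow_neg_one]
  have h1 : normLpow ((normLpow u) ^ (-p⁻¹) • u) = 1 := by
    rw [normLpow_smul, hc, inv_mul_cancel₀ h0.ne']
  have h2 : lambdaOne p Ω A ≤ normApow A ((normLpow u) ^ (-p⁻¹) • u) :=
    csInf_le ⟨0, by rintro _ ⟨v, -, rfl⟩; exact hA.normApow_nonneg hΩ v⟩ ⟨_, h1, rfl⟩
  rw [hA.normApow_smul hΩ hΩb, hc, inv_mul_eq_div, le_div_iff₀ h0] at h2
  exact h2

/-- The infimum of the empty set is 0 by convention, so a positive λ₁ rules out an empty admissible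
class; in particular W_0^{1,p}(Ω) is not trivial. -/
lemma exists_normLpow_eq_one (h : 0 < lambdaOne p Ω A) : ∃ u : W0 p Ω, normLpow u = 1 := by
  by_contra hne
  push Not at hne
  have : {u : W0 p Ω | normLpow u = 1} = ∅ := Set.eq_empty_of_forall_notMem hne
  rw [lambdaOne, this, Set.image_empty, Real.sInf_empty] at h
  exact lt_irrefl _ h

omit hp in
-- Rescaling to the p-sphere. The growth bound makes F bounded above there, without which the
-- supremum would be a default value.
lemma Homog.le_maxOnSphere_mul (hp0 : 0 < p) (hF : Homog p F) (hFc : Continuous F)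
    (s : Fin d → ℝ) : F s ≤ maxOnSphere p F * ∑ j, |s j| ^ p := by
  have hbdd : BddAbove (F '' pSphere d p) := by
    obtain ⟨C, hC0, hC⟩ := hF.exists_growth hp0 hFc
    refine ⟨C, ?_⟩
    rintro _ ⟨s, hs, rfl⟩
    calc F s ≤ C * ‖s‖ ^ p := (le_abs_self _).trans (hC s)
      _ ≤ C * ∑ j, |s j| ^ p := by gcongr; exact norm_rpow_le_sum hp0 s
      _ = C := by rw [show ∑ j, |s j| ^ p = 1 from hs, mul_one]
  rcases (Finset.sum_nonneg fun j _ => by positivity :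
    0 ≤ ∑ j, |s j| ^ p).eq_or_lt with h0 | h0
  · have hs : s = 0 := by
      have h1 := norm_rpow_le_sum hp0 s
      rw [← h0] at h1
      exact eq_zero_of_norm_rpow_eq_zero (le_antisymm h1 (by positivity))
    rw [← h0, mul_zero, hs, hF.map_zero hp0]
  set S := ∑ j, |s j| ^ p with hS
  have hc0 : 0 < S ^ (-p⁻¹) := by positivity
  have hc : (S ^ (-p⁻¹)) ^ p = S⁻¹ := by
    rw [← Real.rpow_mul h0.le, neg_mul, inv_mul_cancel₀ hp0.ne', Real.rpow_neg_one]
  have h1 : S ^ (-p⁻¹) • s ∈ pSphere d p := by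
    change ∑ j, |(S ^ (-p⁻¹) • s) j| ^ p = 1
    simp only [Pi.smul_apply, smul_eq_mul, abs_mul, abs_of_pos hc0,
      Real.mul_rpow hc0.le (abs_nonneg _), ← Finset.mul_sum, hc, ← hS]
    exact inv_mul_cancel₀ h0.ne'
  have h2 : F (S ^ (-p⁻¹) • s) ≤ maxOnSphere p F := le_csSup hbdd ⟨_, h1, rfl⟩
  rwa [hF _ _ hc0, hc, inv_mul_eq_div, div_le_iff₀ h0] at h2

lemma Homog.integralOf_le (hF : Homog p F) (hFc : Continuous F) (u : W0Vec p Ω d) :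
    integralOf F u ≤ maxOnSphere p F * normLpowVec u := by
  have hp0 := pos_of_fact p
  have i1 : ∀ j, Integrable (fun x => |W0.fn (u j) x| ^ p) (volume.restrict Ω) := fun j =>
    integrable_norm_rpow hp0 (W0.memLp_fn (u j))
  calc integralOf F u ≤ ∫ x in Ω, maxOnSphere p F * ∑ j, |W0.fn (u j) x| ^ p :=
        integral_mono (hF.integrable_comp hp0 hFc (W0Vec.memLp_fn u))
          ((integrable_finsetSum _ fun j _ => i1 j).const_mul _)
          fun x => hF.le_maxOnSphere_mul hp0 hFc _
    _ = _ := by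
        rw [integral_const_mul, integral_finsetSum _ fun j _ => i1 j]
        rfl

namespace AssumptionsAFG

variable (h : AssumptionsAFG p Ω A F G)
include h

lemma homog_F : Homog p F := h.homogeneous_F

lemma homog_G : Homog (critExp n p) G := h.posHomogeneous_G.1

lemma continuous_F : Continuous F := h.contDiff_F.continuous

lemma continuous_G : Continuous G := h.contDiff_G.continuous

lemma lambdaOne_pos : 0 < lambdaOne p Ω A := h.maxF_pos.trans h.maxF_lt

lemma G_nonneg (hpn : p < n) (s : Fin d → ℝ) : 0 ≤ G s := by
  rcases eq_or_ne s 0 with rfl | hs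
  · rw [h.homog_G.map_zero ((pos_of_fact p).trans (lt_critExp hp.out hpn))]
  · exact (h.posHomogeneous_G.2 s hs).le

lemma integralOf_G_nonneg (hpn : p < n) (u : W0Vec p Ω d) : 0 ≤ integralOf G u :=
  integral_nonneg fun _ => h.G_nonneg hpn _

lemma integrable_G (hpn : p < n) (u : W0Vec p Ω d) :
    Integrable (fun x => G (u.fn x)) (volume.restrict Ω) :=
  h.homog_G.integrable_comp ((pos_of_fact p).trans (lt_critExp hp.out hpn)) h.continuous_G
    (W0Vec.memLp_fn_critExp hpn u)

lemma fn_ae_eq_zero_of_integralOf_G (hpn : p < n) {u : W0Vec p Ω d} (hu : integralOf G u = 0) :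
    u.fn =ᵐ[volume.restrict Ω] 0 := by
  have h1 := (integral_eq_zero_iff_of_nonneg (fun x => h.G_nonneg hpn _) (h.integrable_G hpn u)).1
    hu
  filter_upwards [h1] with x hx
  by_contra hne
  exact (h.posHomogeneous_G.2 _ hne).ne' hx

/-- The energy is coercive, since `M_F < λ₁(A, p)`. -/
lemma coercive (hΩ : IsOpen Ω) (hΩb : Bornology.IsBounded Ω) (u : W0Vec p Ω d) :
    (1 - maxOnSphere p F / lambdaOne p Ω A) * normApowVec A u ≤ energy A F u := by
  have h1 := h.homog_F.integralOf_le h.continuous_F u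
  have h2 : normLpowVec u ≤ normApowVec A u / lambdaOne p Ω A := by
    rw [le_div_iff₀ h.lambdaOne_pos, mul_comm, normLpowVec, Finset.mul_sum]
    exact Finset.sum_le_sum fun j _ => h.elliptic.lambdaOne_mul_normLpow_le hΩ hΩb (u j)
  have h3 := mul_le_mul_of_nonneg_left h2 h.maxF_pos.le
  have h4 : maxOnSphere p F / lambdaOne p Ω A * normApowVec A u =
    maxOnSphere p F * (normApowVec A u / lambdaOne p Ω A) := by ring
  rw [energy, sub_mul, one_mul]
  linarith

lemma coercivity_const_pos : 0 < 1 - maxOnSphere p F / lambdaOne p Ω A := by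
  rw [sub_pos, div_lt_one h.lambdaOne_pos]
  exact h.maxF_lt

lemma energy_nonneg (hΩ : IsOpen Ω) (hΩb : Bornology.IsBounded Ω) (u : W0Vec p Ω d) :
    0 ≤ energy A F u :=
  (mul_nonneg h.coercivity_const_pos.le (h.elliptic.normApowVec_nonneg hΩ u)).trans
    (h.coercive hΩ hΩb u)

lemma energy_smul (hΩ : IsOpen Ω) (hΩb : Bornology.IsBounded Ω) {c : ℝ} (hc : 0 < c)
    (u : W0Vec p Ω d) : energy A F (c • u) = c ^ p * energy A F u := by
  rw [energy, energy, h.elliptic.normApowVec_smul hΩ hΩb, h.homog_F.integralOf_smul hc,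
    abs_of_pos hc, mul_sub]

/-- Gives m > 0 below and shows that the set of constants defining 𝒩(A; G) is nonempty. -/
lemma exists_sobolev (hpn : p < n) (hΩ : IsOpen Ω) (hΩb : Bornology.IsBounded Ω) :
    ∃ S, 0 < S ∧ ∀ u : W0Vec p Ω d,
      integralOf G u ^ (p / critExp n p) ≤ S * normApowVec A u := by
  have hp0 := pos_of_fact p
  have hq := hp0.trans (lt_critExp hp.out hpn)
  obtain ⟨S, hS0, hS⟩ := h.elliptic.exists_integral_norm_critExp_le hpn hΩ hΩb d
  obtain ⟨C, hC0, hC⟩ := h.homog_G.exists_growth hq h.continuous_G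
  -- The added 1 makes the constant strictly positive, as is needed to divide by it.
  refine ⟨(C * S) ^ (p / critExp n p) + 1, by positivity, fun u => ?_⟩
  have hN := h.elliptic.normApowVec_nonneg hΩ u
  have h1 : integralOf G u ≤ C * S * normApowVec A u ^ (critExp n p / p) := by
    calc integralOf G u ≤ ∫ x in Ω, C * ‖u.fn x‖ ^ critExp n p :=
          integral_mono (h.integrable_G hpn u)
            ((integrable_norm_rpow hq (W0Vec.memLp_fn_critExp hpn u)).const_mul C)
            fun x => (le_abs_self _).trans (hC _)
      _ = C * ∫ x in Ω, ‖u.fn x‖ ^ critExp n p := integral_const_mul _ _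
      _ ≤ C * (S * normApowVec A u ^ (critExp n p / p)) := by gcongr; exact hS u
      _ = _ := by ring
  calc integralOf G u ^ (p / critExp n p)
      ≤ (C * S * normApowVec A u ^ (critExp n p / p)) ^ (p / critExp n p) :=
        Real.rpow_le_rpow (h.integralOf_G_nonneg hpn u) h1 (by positivity)
    _ = (C * S) ^ (p / critExp n p) * normApowVec A u := by
        rw [Real.mul_rpow (by positivity) (by positivity), ← Real.rpow_mul hN]
        have : critExp n p / p * (p / critExp n p) = 1 := by field_simp
        rw [this, Real.rpow_one]
    _ ≤ _ := by
        rw [add_mul, one_mul]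
        linarith

/-- A positive λ₁ provides a nonzero u, and M_F > 0 forces d ≥ 1, since for d = 0 the p-sphere is
empty and its supremum 0. The vector (u, …, u) then has positive G-integral and is rescaled. -/
lemma constraintSet_nonempty (hpn : p < n) : (constraintSet p Ω G).Nonempty := by
  have hq := (pos_of_fact p).trans (lt_critExp hp.out hpn)
  obtain ⟨u, hu⟩ := exists_normLpow_eq_one h.lambdaOne_pos
  have hd : Nonempty (Fin d) := by
    by_contra hd
    rw [not_nonempty_iff] at hd
    have h1 := h.maxF_pos
    have h2 : pSphere d p = ∅ := Set.eq_empty_of_forall_notMem fun s hs => by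
      have : ∑ j, |s j| ^ p = 1 := hs
      simp at this
    rw [maxOnSphere, h2, Set.image_empty, Real.sSup_empty] at h1
    exact lt_irrefl _ h1
  obtain ⟨j⟩ := hd
  set v : W0Vec p Ω d := fun _ => u with hv
  have hpos : 0 < integralOf G v := by
    refine lt_of_le_of_ne (h.integralOf_G_nonneg hpn v) fun h0 => ?_
    have h1 := h.fn_ae_eq_zero_of_integralOf_G hpn h0.symm
    have h2 : normLpow u = 0 := by
      refine (integral_congr_ae (g := fun _ => (0 : ℝ)) ?_).trans (integral_zero _ _)
      filter_upwards [h1] with x hx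
      have : W0.fn u x = 0 := congrFun hx j
      simp [this, (pos_of_fact p).ne']
    rw [hu] at h2
    exact one_ne_zero h2
  refine ⟨(integralOf G v) ^ (-(critExp n p)⁻¹) • v, ?_⟩
  change integralOf G _ = 1
  rw [h.homog_G.integralOf_smul (by positivity), ← Real.rpow_mul hpos.le, neg_mul,
    inv_mul_cancel₀ hq.ne', Real.rpow_neg_one, inv_mul_cancel₀ hpos.ne']

/-- The infimum of the energy on the constraint set is positive, i.e. `K(A, F, G) > 0`. -/
lemma sInf_energy_pos (hpn : p < n) (hΩ : IsOpen Ω) (hΩb : Bornology.IsBounded Ω) :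
    0 < sInf (energy A F '' constraintSet p Ω G) := by
  obtain ⟨S, hS, hSob⟩ := h.exists_sobolev hpn hΩ hΩb
  have hκ := h.coercivity_const_pos
  set κ := 1 - maxOnSphere p F / lambdaOne p Ω A
  -- On the constraint set 1 ≤ S ‖u‖^p by Sobolev and κ ‖u‖^p ≤ Φ(u) by coercivity, with ‖·‖ the
  -- 𝒲_A-norm.
  refine lt_of_lt_of_le (by positivity : 0 < κ / S)
    (le_csInf ((h.constraintSet_nonempty hpn).image _) ?_)
  rintro _ ⟨u, hu, rfl⟩
  have h1 := hSob u
  rw [show integralOf G u = 1 from hu, Real.one_rpow] at h1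
  refine le_trans ?_ (h.coercive hΩ hΩb u)
  rw [div_le_iff₀ hS, mul_assoc, mul_comm _ S]
  exact le_mul_of_one_le_right hκ.le h1

lemma sInf_energy_le (hΩ : IsOpen Ω) (hΩb : Bornology.IsBounded Ω) {u : W0Vec p Ω d}
    (hu : u ∈ constraintSet p Ω G) : sInf (energy A F '' constraintSet p Ω G) ≤ energy A F u :=
  csInf_le ⟨0, by rintro _ ⟨v, -, rfl⟩; exact h.energy_nonneg hΩ hΩb v⟩ ⟨u, hu, rfl⟩

/-- The scale-invariant form of the minimization: both sides have degree p in u. It is applied to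
the two pieces of the splitting, and it replaces a Lagrange multiplier in the Euler–Lagrange
equation. -/
lemma sInf_energy_mul_le (hpn : p < n) (hΩ : IsOpen Ω) (hΩb : Bornology.IsBounded Ω)
    (u : W0Vec p Ω d) : sInf (energy A F '' constraintSet p Ω G) *
      integralOf G u ^ (p / critExp n p) ≤ energy A F u := by
  have hp0 := pos_of_fact p
  have hq := hp0.trans (lt_critExp hp.out hpn)
  rcases (h.integralOf_G_nonneg hpn u).eq_or_lt with h0 | h0
  · rw [← h0, Real.zero_rpow (by positivity), mul_zero]
    exact h.energy_nonneg hΩ hΩb u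
  have hmem : (integralOf G u) ^ (-(critExp n p)⁻¹) • u ∈ constraintSet p Ω G := by
    change integralOf G _ = 1
    rw [h.homog_G.integralOf_smul (by positivity), ← Real.rpow_mul h0.le, neg_mul,
      inv_mul_cancel₀ hq.ne', Real.rpow_neg_one, inv_mul_cancel₀ h0.ne']
  have h1 := h.sInf_energy_le hΩ hΩb hmem
  rw [h.energy_smul hΩ hΩb (by positivity), ← Real.rpow_mul h0.le,
    show -(critExp n p)⁻¹ * p = -(p / critExp n p) by ring, Real.rpow_neg h0.le,
    inv_mul_eq_div, le_div_iff₀ (by positivity)] at h1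
  exact h1

/-- Below `K(A, F, G)` there is an admissible constant in the Sobolev inequality. -/
lemma exists_sobolevIneq_lt (hpn : p < n) (hΩ : IsOpen Ω) (hΩb : Bornology.IsBounded Ω)
    (hNK : sharpN p Ω A G < energyK p Ω A F G) :
    ∃ C₁ C₂, SobolevIneq p Ω A G C₁ C₂ ∧ C₁ < energyK p Ω A F G := by
  obtain ⟨S, hS, hSob⟩ := h.exists_sobolev hpn hΩ hΩb
  have hne : {C₁ : ℝ | ∃ C₂ : ℝ, 0 < C₂ ∧ SobolevIneq p Ω A G C₁ C₂}.Nonempty := by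
    refine ⟨S, 1, one_pos, fun u => (hSob u).trans ?_⟩
    rw [one_mul]
    exact le_add_of_nonneg_right (Finset.sum_nonneg fun j _ => normLpow_nonneg (u j))
  obtain ⟨C₁, ⟨C₂, -, hC⟩, hlt⟩ := exists_lt_of_csInf_lt hne hNK
  exact ⟨C₁, C₂, hC, hlt⟩

end AssumptionsAFG

end Coercivity

/-! ### Smooth truncations -/

/-- The smooth truncation `s ↦ arctan (e s) / e` at height of order `1 / e`. -/
def trunc (e s : ℝ) : ℝ := e⁻¹ * Real.arctan (e * s)

lemma hasDerivAt_trunc {e : ℝ} (he : 0 < e) (s : ℝ) :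
    HasDerivAt (trunc e) (1 / (1 + (e * s) ^ 2)) s := by
  have h1 : HasDerivAt (fun s : ℝ => e * s) e s := by simpa using (hasDerivAt_id s).const_mul e
  have h2 := ((Real.hasDerivAt_arctan (e * s)).comp s h1).const_mul e⁻¹
  have h3 : 1 / (1 + (e * s) ^ 2) = e⁻¹ * (1 / (1 + (e * s) ^ 2) * e) := by field_simp
  rw [h3]
  exact h2

/-- Derivatives between 0 and 1 make both T and id - T contractions, and are what the energy
splitting rests on. -/
lemma deriv_trunc_mem {e : ℝ} (he : 0 < e) (s : ℝ) : deriv (trunc e) s ∈ Set.Icc (0 : ℝ) 1 := by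
  rw [(hasDerivAt_trunc he s).deriv]
  refine ⟨by positivity, ?_⟩
  rw [div_le_one (by positivity)]
  nlinarith [sq_nonneg (e * s)]

lemma contDiff_trunc (e : ℝ) : ContDiff ℝ ∞ (trunc e) :=
  contDiff_const.mul (Real.contDiff_arctan.comp (contDiff_const.mul contDiff_id))

lemma smoothContraction_trunc {e : ℝ} (he : 0 < e) : SmoothContraction (trunc e) where
  contDiff := contDiff_trunc e
  map_zero := by simp [trunc]
  abs_deriv_le s := by
    have := deriv_trunc_mem he s
    rw [abs_of_nonneg this.1]
    exact this.2

lemma smoothContraction_sub_trunc {e : ℝ} (he : 0 < e) :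
    SmoothContraction fun s => s - trunc e s where
  contDiff := contDiff_id.sub (contDiff_trunc e)
  map_zero := by simp [trunc]
  abs_deriv_le s := by
    have h := deriv_trunc_mem he s
    have h1 : HasDerivAt (fun s => s - trunc e s) (1 - deriv (trunc e) s) s :=
      (hasDerivAt_id s).sub (smoothContraction_trunc he).differentiable.differentiableAt.hasDerivAt
    rw [h1.deriv, abs_of_nonneg (by linarith [h.2])]
    linarith [h.1]

lemma abs_trunc_le {e : ℝ} (he : 0 < e) (s : ℝ) : |trunc e s| ≤ 2 * e⁻¹ := by
  have h1 := Real.arctan_lt_pi_div_two (e * s)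
  have h2 := Real.neg_pi_div_two_lt_arctan (e * s)
  have h3 := Real.pi_le_four
  rw [trunc, abs_mul, abs_of_pos (inv_pos.2 he), mul_comm]
  gcongr
  rw [abs_le]
  constructor <;> linarith

/-- `trunc e s` is the difference quotient at 0 of e ↦ arctan(e s), whose derivative there is s. -/
lemma tendsto_trunc (s : ℝ) :
    Tendsto (fun i : ℕ => trunc (1 / ((i : ℝ) + 1)) s) atTop (𝓝 s) := by
  have h1 : HasDerivAt (fun e : ℝ => Real.arctan (e * s)) s 0 := by
    have h2 : HasDerivAt (fun e : ℝ => e * s) s 0 := by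
      simpa using (hasDerivAt_id (0 : ℝ)).mul_const s
    have h3 := (Real.hasDerivAt_arctan (0 * s)).comp (0 : ℝ) h2
    simpa [Function.comp_def] using h3
  have h3 := h1.tendsto_slope_zero_right
  have h4 : Tendsto (fun i : ℕ => 1 / ((i : ℝ) + 1)) atTop (𝓝[>] 0) :=
    tendsto_nhdsWithin_iff.2 ⟨tendsto_one_div_add_atTop_nhds_zero_nat,
      Eventually.of_forall fun i => Set.mem_Ioi.2 Nat.one_div_pos_of_nat⟩
  refine (h3.comp h4).congr fun i => ?_
  simp [trunc]

section Vec

variable {d : ℕ}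

/-- Componentwise truncation. -/
def truncVec (e : ℝ) (s : Fin d → ℝ) : Fin d → ℝ := fun j => trunc e (s j)

lemma continuous_truncVec (e : ℝ) : Continuous (truncVec e : (Fin d → ℝ) → Fin d → ℝ) :=
  continuous_pi fun j => (contDiff_trunc e).continuous.comp (continuous_apply j)

lemma norm_truncVec_sub_le {e : ℝ} (he : 0 < e) (s t : Fin d → ℝ) :
    ‖truncVec e s - truncVec e t‖ ≤ ‖s - t‖ :=
  (pi_norm_le_iff_of_nonneg (norm_nonneg _)).2 fun j =>
    ((smoothContraction_trunc he).abs_sub_le _ _).trans (norm_le_pi_norm (s - t) j)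

lemma norm_sub_truncVec_sub_le {e : ℝ} (he : 0 < e) (s t : Fin d → ℝ) :
    ‖(s - truncVec e s) - (t - truncVec e t)‖ ≤ ‖s - t‖ :=
  (pi_norm_le_iff_of_nonneg (norm_nonneg _)).2 fun j =>
    ((smoothContraction_sub_trunc he).abs_sub_le _ _).trans (norm_le_pi_norm (s - t) j)

lemma truncVec_zero (e : ℝ) : truncVec e (0 : Fin d → ℝ) = 0 := by
  funext j
  simp [truncVec, trunc]

lemma norm_truncVec_le {e : ℝ} (he : 0 < e) (s : Fin d → ℝ) : ‖truncVec e s‖ ≤ ‖s‖ := by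
  simpa [truncVec_zero] using norm_truncVec_sub_le he s 0

lemma norm_sub_truncVec_le {e : ℝ} (he : 0 < e) (s : Fin d → ℝ) : ‖s - truncVec e s‖ ≤ ‖s‖ := by
  simpa [truncVec_zero] using norm_sub_truncVec_sub_le he s 0

lemma norm_truncVec_le_const {e : ℝ} (he : 0 < e) (s : Fin d → ℝ) : ‖truncVec e s‖ ≤ 2 * e⁻¹ :=
  (pi_norm_le_iff_of_nonneg (by positivity)).2 fun j => abs_trunc_le he _

lemma tendsto_truncVec (s : Fin d → ℝ) :
    Tendsto (fun i : ℕ => truncVec (1 / ((i : ℝ) + 1)) s) atTop (𝓝 s) :=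
  tendsto_pi_nhds.2 fun j => tendsto_trunc (s j)

end Vec

section TruncW0

variable {n d : ℕ} {p : ℝ} [hp : Fact (1 < p)] {Ω : Set (Eucl n)}
  {A : Eucl n → Matrix (Fin n) (Fin n) ℝ}

/-- Truncation of an element of `W_0^{1,p}(Ω)`. -/
def W0.trunc {e : ℝ} (he : 0 < e) (u : W0 p Ω) : W0 p Ω :=
  ⟨(smoothContraction_trunc he).pair u, (smoothContraction_trunc he).pair_mem_W0 u⟩

/-- Componentwise truncation in `𝒲`. -/
def W0Vec.trunc {e : ℝ} (he : 0 < e) (u : W0Vec p Ω d) : W0Vec p Ω d :=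
  fun j => W0.trunc he (u j)

lemma W0Vec.fn_trunc {e : ℝ} (he : 0 < e) (u : W0Vec p Ω d) :
    (W0Vec.trunc he u).fn =ᵐ[volume.restrict Ω] fun x => truncVec e (u.fn x) := by
  filter_upwards [ae_all_iff.2 fun j => (smoothContraction_trunc he).pair_fst (u j : LpPair p Ω)]
    with x hx
  funext j
  exact hx j

lemma W0Vec.fn_sub_trunc {e : ℝ} (he : 0 < e) (u : W0Vec p Ω d) :
    W0Vec.fn (u - W0Vec.trunc he u) =ᵐ[volume.restrict Ω]
      fun x => u.fn x - truncVec e (u.fn x) := by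
  filter_upwards [W0Vec.fn_sub u (W0Vec.trunc he u), W0Vec.fn_trunc he u] with x h1 h2
  rw [h1, h2]

/-- With t = T'(u) the two gradients are t ∇u and (1 - t) ∇u, and t^p + (1 - t)^p ≤ t + (1 - t) = 1.
The inequality is exact for each u, which spares any a.e. convergence of gradients. -/
lemma IsElliptic.normApow_trunc_add_le (hA : IsElliptic Ω A) (hΩ : IsOpen Ω)
    (hΩb : Bornology.IsBounded Ω) {e : ℝ} (he : 0 < e) (u : W0 p Ω) :
    normApow A (W0.trunc he u) + normApow A (u - W0.trunc he u) ≤ normApow A u := by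
  have i1 := hA.integrable_density hΩ hΩb hp.out (W0.memLp_grad (W0.trunc he u))
  have i2 := hA.integrable_density hΩ hΩb hp.out (W0.memLp_grad (u - W0.trunc he u))
  have i3 := hA.integrable_density hΩ hΩb hp.out (W0.memLp_grad u)
  change (∫ x in Ω, density p A x (W0.grad (W0.trunc he u) x)) +
    (∫ x in Ω, density p A x (W0.grad (u - W0.trunc he u) x)) ≤
      ∫ x in Ω, density p A x (W0.grad u x)
  rw [← integral_add i1 i2]
  refine integral_mono_ae (i1.add i2) i3 ?_
  have h2 : W0.grad (W0.trunc he u) =ᵐ[volume.restrict Ω]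
      fun x => deriv (AnisoSystem.trunc e) (W0.fn u x) • W0.grad u x :=
    (smoothContraction_trunc he).pair_snd (u : LpPair p Ω)
  filter_upwards [ae_restrict_mem_closure hΩ, W0.grad_sub u (W0.trunc he u), h2] with x hx h1 h2
  have ht := deriv_trunc_mem he (W0.fn u x)
  set t := deriv (AnisoSystem.trunc e) (W0.fn u x)
  have h3 : W0.grad u x - t • W0.grad u x = (1 - t) • W0.grad u x := by rw [sub_smul, one_smul]
  rw [h1, h2, h3, hA.density_smul hΩb hx, hA.density_smul hΩb hx, ← add_mul, abs_of_nonneg ht.1,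
    abs_of_nonneg (by linarith [ht.2])]
  refine mul_le_of_le_one_left (hA.density_nonneg hx p _) ?_
  have h4 := Real.rpow_le_self_of_le_one ht.1 ht.2 hp.out.le
  have h5 := Real.rpow_le_self_of_le_one (by linarith [ht.2] : 0 ≤ 1 - t) (by linarith [ht.1])
    hp.out.le
  linarith

lemma IsElliptic.normApowVec_trunc_add_le (hA : IsElliptic Ω A) (hΩ : IsOpen Ω)
    (hΩb : Bornology.IsBounded Ω) {e : ℝ} (he : 0 < e) (u : W0Vec p Ω d) :
    normApowVec A (W0Vec.trunc he u) + normApowVec A (u - W0Vec.trunc he u) ≤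
      normApowVec A u := by
  rw [normApowVec, normApowVec, normApowVec, ← Finset.sum_add_distrib]
  exact Finset.sum_le_sum fun j _ => hA.normApow_trunc_add_le hΩ hΩb he (u j)

end TruncW0

/-! ### Splitting of sequences into a truncated part and a tail -/

section Splitting

variable {α : Type*} [MeasurableSpace α] {μ : Measure α} [IsFiniteMeasure μ] {d : ℕ}

lemma tendsto_integral_comp_of_bounded {E : Type*} [NormedAddCommGroup E] {P : E → ℝ}
    (hP : Continuous P) {B : ℝ} (hB : ∀ s, ‖P s‖ ≤ B) {f : ℕ → α → E} {g : α → E}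
    (hf : ∀ k, AEStronglyMeasurable (f k) μ)
    (h : ∀ᵐ x ∂μ, Tendsto (fun k => f k x) atTop (𝓝 (g x))) :
    Tendsto (fun k => ∫ x, P (f k x) ∂μ) atTop (𝓝 (∫ x, P (g x) ∂μ)) :=
  tendsto_integral_of_dominated_convergence (fun _ => B)
    (fun k => hP.comp_aestronglyMeasurable (hf k)) (integrable_const _)
    (fun _ => ae_of_all _ fun _ => hB _) (h.mono fun _ hx => (hP.tendsto _).comp hx)

omit [IsFiniteMeasure μ] in
-- Used with T the truncation and with T its complement: a 1-Lipschitz map fixing 0 preserves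
-- convergence in L^r.
lemma tendsto_integral_lipschitz_comp {E : Type*} [NormedAddCommGroup E] [NormedSpace ℝ E]
    [FiniteDimensional ℝ E] {r : ℝ} (hr : 0 < r) {H : E → ℝ} (hH : Homog r H)
    (hHc : Continuous H) {T : E → E} (hTc : Continuous T) (hT0 : T 0 = 0)
    (hT : ∀ s t, ‖T s - T t‖ ≤ ‖s - t‖) {f : ℕ → α → E} {g : α → E}
    (hf : ∀ k, MemLp (f k) (ENNReal.ofReal r) μ) (hg : MemLp g (ENNReal.ofReal r) μ)
    (h : Tendsto (fun k => ∫ x, ‖f k x - g x‖ ^ r ∂μ) atTop (𝓝 0)) :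
    Tendsto (fun k => ∫ x, H (T (f k x)) ∂μ) atTop (𝓝 (∫ x, H (T (g x)) ∂μ)) := by
  have hm : ∀ {w : α → E}, MemLp w (ENNReal.ofReal r) μ →
      MemLp (fun x => T (w x)) (ENNReal.ofReal r) μ := fun {w} hw =>
    hw.mono (hTc.comp_aestronglyMeasurable hw.1) (ae_of_all _ fun x => by
      simpa [hT0] using hT (w x) 0)
  refine hH.tendsto_integral_comp hr hHc (fun k => hm (hf k)) (hm hg) ?_
  refine squeeze_zero (fun k => integral_nonneg fun x => by positivity) (fun k => ?_) h
  refine integral_mono (integrable_norm_rpow hr ((hm (hf k)).sub (hm hg)))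
    (integrable_norm_rpow hr ((hf k).sub hg)) fun x => ?_
  exact Real.rpow_le_rpow (norm_nonneg _) (hT _ _) hr.le

/-- A Brezis–Lieb type splitting by truncation at a fixed level. -/
lemma Homog.eventually_abs_integral_split_le {q : ℝ} (hq : 0 < q) {G : (Fin d → ℝ) → ℝ}
    (hG : Homog q G) (hGc : Continuous G) {e : ℝ} (he : 0 < e) {f : ℕ → α → Fin d → ℝ}
    {g : α → Fin d → ℝ} (hf : ∀ k, MemLp (f k) (ENNReal.ofReal q) μ)
    (hg : MemLp g (ENNReal.ofReal q) μ) {M : ℝ} (hM : ∀ k, ∫ x, ‖f k x‖ ^ q ∂μ ≤ M)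
    (h : ∀ᵐ x ∂μ, Tendsto (fun k => f k x) atTop (𝓝 (g x))) {η : ℝ}
    (hη : ∫ x, |G (g x) - G (truncVec e (g x)) - G (g x - truncVec e (g x))| ∂μ < η) :
    ∀ᶠ k in atTop, |(∫ x, G (f k x) ∂μ) - (∫ x, G (truncVec e (f k x)) ∂μ) -
      ∫ x, G (f k x - truncVec e (f k x)) ∂μ| < η := by
  set D : (Fin d → ℝ) → ℝ := fun s => |G s - G (truncVec e s) - G (s - truncVec e s)| with hD
  have hTc := continuous_truncVec (d := d) e
  have hDc : Continuous D :=
    ((hGc.sub (hGc.comp hTc)).sub (hGc.comp (continuous_id.sub hTc))).abs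
  have hM0 : 0 ≤ M := (integral_nonneg fun x => by positivity).trans (hM 0)
  set δ := η - ∫ x, D (g x) ∂μ with hδ
  have hδ0 : 0 < δ := sub_pos.2 hη
  -- The factor of the error term is such that ε ∫ ‖f_k‖^q ≤ δ/2, where δ is the slack in the
  -- hypothesis on g.
  obtain ⟨C, hC0, hC⟩ := hG.exists_abs_add_sub_sub_le hq hGc
    (by positivity : 0 < δ / (2 * (M + 1)))
  set ε := δ / (2 * (M + 1)) with hε
  have hε0 : 0 < ε := by positivity
  have hmT : ∀ {w : α → Fin d → ℝ}, MemLp w (ENNReal.ofReal q) μ →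
      MemLp (fun x => truncVec e (w x)) (ENNReal.ofReal q) μ := fun {w} hw =>
    hw.mono (hTc.comp_aestronglyMeasurable hw.1) (ae_of_all _ fun x => norm_truncVec_le he _)
  have hDi : ∀ {w : α → Fin d → ℝ}, MemLp w (ENNReal.ofReal q) μ →
      Integrable (fun x => D (w x)) μ := fun {w} hw =>
    (((hG.integrable_comp hq hGc hw).sub (hG.integrable_comp hq hGc (hmT hw))).sub
      (hG.integrable_comp hq hGc (hw.sub (hmT hw)))).abs
  -- The part of the defect D exceeding the ε-term. By the Brezis–Lieb inequality it is at most C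
  -- ‖T(s)‖^q, hence bounded as T is, and bounded convergence applies to it although f_k converges
  -- only a.e.
  set P : (Fin d → ℝ) → ℝ := fun s => max (D s - ε * ‖s - truncVec e s‖ ^ q) 0 with hP
  have hPc : Continuous P := by
    refine (hDc.sub (continuous_const.mul ?_)).max continuous_const
    exact (continuous_norm_rpow hq).comp (continuous_id.sub hTc)
  have hPB : ∀ s, ‖P s‖ ≤ C * (2 * e⁻¹) ^ q := fun s => by
    rw [Real.norm_of_nonneg (le_max_right _ _)]
    refine max_le ?_ (by positivity)
    have h1 := hC (truncVec e s) (s - truncVec e s)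
    rw [add_sub_cancel] at h1
    have h2 : ‖truncVec e s‖ ^ q ≤ (2 * e⁻¹) ^ q :=
      Real.rpow_le_rpow (norm_nonneg _) (norm_truncVec_le_const he s) hq.le
    have h3 := mul_le_mul_of_nonneg_left h2 hC0
    simp only [hD]
    linarith
  have hPi : ∀ {w : α → Fin d → ℝ}, AEStronglyMeasurable w μ →
      Integrable (fun x => P (w x)) μ := fun {w} hw =>
    Integrable.of_bound (hPc.comp_aestronglyMeasurable hw) _ (ae_of_all _ fun x => hPB _)
  have hlim := tendsto_integral_comp_of_bounded hPc hPB (fun k => (hf k).1) h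
  have hPg : ∫ x, P (g x) ∂μ ≤ ∫ x, D (g x) ∂μ :=
    integral_mono (hPi hg.1) (hDi hg) fun x => max_le
      (sub_le_self _ (by positivity)) (abs_nonneg _)
  have hlt : ∫ x, P (g x) ∂μ < (∫ x, D (g x) ∂μ) + δ / 2 := by linarith
  filter_upwards [hlim.eventually (gt_mem_nhds hlt)] with k hk
  have i1 := hG.integrable_comp hq hGc (hf k)
  have i2 := hG.integrable_comp hq hGc (hmT (hf k))
  have i3 : Integrable (fun x => G (f k x - truncVec e (f k x))) μ :=
    hG.integrable_comp hq hGc ((hf k).sub (hmT (hf k)))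
  have i4 := integrable_norm_rpow hq (hf k)
  have hεM : ε * ∫ x, ‖f k x‖ ^ q ∂μ ≤ δ / 2 := by
    calc _ ≤ ε * (M + 1) := by
          gcongr
          linarith [hM k]
      _ = _ := by rw [hε]; field_simp
  have i12 : Integrable (fun x => G (f k x) - G (truncVec e (f k x))) μ := i1.sub i2
  rw [← integral_sub i1 i2, ← integral_sub i12 i3]
  calc _ ≤ ∫ x, D (f k x) ∂μ := abs_integral_le_integral_abs
    _ ≤ ∫ x, (ε * ‖f k x‖ ^ q + P (f k x)) ∂μ := by
        refine integral_mono (hDi (hf k)) ((i4.const_mul ε).add (hPi (hf k).1)) fun x => ?_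
        have h1 : D (f k x) - ε * ‖f k x - truncVec e (f k x)‖ ^ q ≤ P (f k x) :=
          le_max_left _ _
        have h2 : ‖f k x - truncVec e (f k x)‖ ^ q ≤ ‖f k x‖ ^ q :=
          Real.rpow_le_rpow (norm_nonneg _) (norm_sub_truncVec_le he _) hq.le
        have h3 := mul_le_mul_of_nonneg_left h2 hε0.le
        simp only
        linarith
    _ = ε * (∫ x, ‖f k x‖ ^ q ∂μ) + ∫ x, P (f k x) ∂μ := by
        rw [integral_add (i4.const_mul ε) (hPi (hf k).1), integral_const_mul]
    _ < η := by linarith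

omit [IsFiniteMeasure μ] in
-- As the level rises, T(s) → s and s - T(s) → 0, so the defect tends to |G(s) - G(s) - G(0)| = 0,
-- dominated by 3 C ‖g‖^q. This supplies the smallness hypothesis of the preceding splitting.
lemma Homog.tendsto_integral_abs_split {q : ℝ} (hq : 0 < q) {G : (Fin d → ℝ) → ℝ}
    (hG : Homog q G) (hGc : Continuous G) {g : α → Fin d → ℝ}
    (hg : MemLp g (ENNReal.ofReal q) μ) :
    Tendsto (fun i : ℕ => ∫ x, |G (g x) - G (truncVec (1 / ((i : ℝ) + 1)) (g x)) -
      G (g x - truncVec (1 / ((i : ℝ) + 1)) (g x))| ∂μ) atTop (𝓝 0) := by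
  obtain ⟨C, hC0, hC⟩ := hG.exists_growth hq hGc
  have hTc := fun e => continuous_truncVec (d := d) e
  have hlim : Tendsto (fun i : ℕ => ∫ x, |G (g x) - G (truncVec (1 / ((i : ℝ) + 1)) (g x)) -
      G (g x - truncVec (1 / ((i : ℝ) + 1)) (g x))| ∂μ) atTop (𝓝 (∫ _x, (0 : ℝ) ∂μ)) := by
    refine tendsto_integral_of_dominated_convergence (fun x => 3 * (C * ‖g x‖ ^ q))
      (fun i => ?_) (((integrable_norm_rpow hq hg).const_mul C).const_mul 3)
      (fun i => ae_of_all _ fun x => ?_) (ae_of_all _ fun x => ?_)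
    · have hDc : Continuous fun s => |G s - G (truncVec (1 / ((i : ℝ) + 1)) s) -
          G (s - truncVec (1 / ((i : ℝ) + 1)) s)| :=
        ((hGc.sub (hGc.comp (hTc _))).sub (hGc.comp (continuous_id.sub (hTc _)))).abs
      exact hDc.comp_aestronglyMeasurable hg.1
    · have he : (0 : ℝ) < 1 / ((i : ℝ) + 1) := Nat.one_div_pos_of_nat
      rw [Real.norm_eq_abs, abs_abs]
      have h1 := hC (g x)
      have h2 : |G (truncVec (1 / ((i : ℝ) + 1)) (g x))| ≤ C * ‖g x‖ ^ q :=
        (hC _).trans (by gcongr; exact norm_truncVec_le he _)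
      have h3 : |G (g x - truncVec (1 / ((i : ℝ) + 1)) (g x))| ≤ C * ‖g x‖ ^ q :=
        (hC _).trans (by gcongr; exact norm_sub_truncVec_le he _)
      refine (abs_sub _ _).trans ?_
      have h4 := abs_sub (G (g x)) (G (truncVec (1 / ((i : ℝ) + 1)) (g x)))
      linarith
    · have h1 := tendsto_truncVec (g x)
      have h2 : Tendsto (fun i : ℕ => g x - truncVec (1 / ((i : ℝ) + 1)) (g x)) atTop (𝓝 0) := by
        simpa using (tendsto_const_nhds (x := g x)).sub h1
      have h3 := ((tendsto_const_nhds (x := G (g x))).sub ((hGc.tendsto _).comp h1)).sub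
        ((hGc.tendsto _).comp h2) |>.abs
      simpa [hG.map_zero hq] using h3
  simpa using hlim

end Splitting

/-! ### Existence of a minimizer -/

/-- Strict subadditivity of `t ↦ t^θ`, `0 < θ < 1`. -/
lemma eq_zero_or_eq_one_of_rpow_add_le {t θ : ℝ} (ht0 : 0 ≤ t) (ht1 : t ≤ 1) (hθ : θ < 1)
    (h : t ^ θ + (1 - t) ^ θ ≤ 1) : t = 0 ∨ t = 1 := by
  by_contra! hne
  have h0 : 0 < t := lt_of_le_of_ne ht0 hne.1.symm
  have h1 : t < 1 := lt_of_le_of_ne ht1 hne.2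
  have h2 := Real.rpow_lt_rpow_of_exponent_gt h0 h1 hθ
  have h3 := Real.rpow_lt_rpow_of_exponent_gt (by linarith : 0 < 1 - t) (by linarith) hθ
  rw [Real.rpow_one] at h2 h3
  linarith

namespace AssumptionsAFG

variable {n d : ℕ} {p : ℝ} [hp : Fact (1 < p)] {Ω : Set (Eucl n)}
  {A : Eucl n → Matrix (Fin n) (Fin n) ℝ} {F G : (Fin d → ℝ) → ℝ}
  (h : AssumptionsAFG p Ω A F G)
include h

lemma tendsto_integralOf_F {u : ℕ → W0Vec p Ω d} {v : W0Vec p Ω d}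
    (hconv : ∀ j, Tendsto (fun k => (u k j : LpPair p Ω).1) atTop (𝓝 (v j : LpPair p Ω).1)) :
    Tendsto (fun k => integralOf F (u k)) atTop (𝓝 (integralOf F v)) :=
  h.homog_F.tendsto_integral_comp (pos_of_fact p) h.continuous_F (fun k => (u k).memLp_fn)
    v.memLp_fn (tendsto_integral_norm_sub_rpow hconv)

/-- A convergent sequence in the constraint set splits into a part carrying the mass of the limit
and a tail carrying the remaining mass, without increase of energy. -/
lemma eventually_split (hpn : p < n) (hΩ : IsOpen Ω) (hΩb : Bornology.IsBounded Ω)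
    {u : ℕ → W0Vec p Ω d} {v : W0Vec p Ω d}
    (hconv : ∀ j, Tendsto (fun k => (u k j : LpPair p Ω).1) atTop (𝓝 (v j : LpPair p Ω).1))
    (hae : ∀ᵐ x ∂(volume.restrict Ω), Tendsto (fun k => (u k).fn x) atTop (𝓝 (v.fn x)))
    {M : ℝ} (hM : ∀ k, ∫ x in Ω, ‖(u k).fn x‖ ^ critExp n p ≤ M)
    (hJ : ∀ k, integralOf G (u k) = 1) {η : ℝ} (hη : 0 < η) :
    ∀ᶠ k in atTop, ∃ a b : W0Vec p Ω d, energy A F a + energy A F b ≤ energy A F (u k) + η ∧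
      |integralOf G a - integralOf G v| ≤ η ∧ |integralOf G b - (1 - integralOf G v)| ≤ η := by
  have hfin := isFiniteMeasure_restrict hΩb
  have hp0 := pos_of_fact p
  have hq := hp0.trans (lt_critExp hp.out hpn)
  have hGm := W0Vec.memLp_fn_critExp hpn v
  have hFm := W0Vec.memLp_fn v
  have hTm : ∀ e, AEStronglyMeasurable (fun x => truncVec e (v.fn x)) (volume.restrict Ω) :=
    fun e => (continuous_truncVec e).comp_aestronglyMeasurable hFm.1
  have he : ∀ i : ℕ, (0 : ℝ) < 1 / ((i : ℝ) + 1) := fun i => Nat.one_div_pos_of_nat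
  have l1 : Tendsto (fun i : ℕ => ∫ x in Ω, F (truncVec (1 / ((i : ℝ) + 1)) (v.fn x))) atTop
      (𝓝 (∫ x in Ω, F (v.fn x))) :=
    h.homog_F.tendsto_integral_of_dominated hp0 h.continuous_F (fun i => hTm _)
      (integrable_norm_rpow hp0 hFm) (fun i x => norm_truncVec_le (he i) _)
      (ae_of_all _ fun x => tendsto_truncVec _)
  have l2 : Tendsto (fun i : ℕ => ∫ x in Ω, F (v.fn x - truncVec (1 / ((i : ℝ) + 1)) (v.fn x)))
      atTop (𝓝 (∫ x in Ω, F 0)) :=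
    h.homog_F.tendsto_integral_of_dominated hp0 h.continuous_F (fun i => hFm.1.sub (hTm _))
      (integrable_norm_rpow hp0 hFm) (fun i x => norm_sub_truncVec_le (he i) _)
      (ae_of_all _ fun x => by
        simpa using (tendsto_const_nhds (x := v.fn x)).sub (tendsto_truncVec (v.fn x)))
  have l3 : Tendsto (fun i : ℕ => ∫ x in Ω, G (truncVec (1 / ((i : ℝ) + 1)) (v.fn x))) atTop
      (𝓝 (∫ x in Ω, G (v.fn x))) :=
    h.homog_G.tendsto_integral_of_dominated hq h.continuous_G (fun i => hTm _)
      (integrable_norm_rpow hq hGm) (fun i x => norm_truncVec_le (he i) _)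
      (ae_of_all _ fun x => tendsto_truncVec _)
  have l4 := h.homog_G.tendsto_integral_abs_split hq h.continuous_G hGm
  rw [h.homog_F.map_zero hp0, integral_zero] at l2
  have l12 : Tendsto (fun i : ℕ => (∫ x in Ω, F (truncVec (1 / ((i : ℝ) + 1)) (v.fn x))) +
      (∫ x in Ω, F (v.fn x - truncVec (1 / ((i : ℝ) + 1)) (v.fn x))) - ∫ x in Ω, F (v.fn x))
      atTop (𝓝 0) := by
    simpa using (l1.add l2).sub_const (∫ x in Ω, F (v.fn x))
  have l3' : Tendsto (fun i : ℕ => |(∫ x in Ω, G (truncVec (1 / ((i : ℝ) + 1)) (v.fn x))) -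
      ∫ x in Ω, G (v.fn x)|) atTop (𝓝 0) := by
    simpa using (l3.sub_const (∫ x in Ω, G (v.fn x))).abs
  -- The truncation level is fixed first, using only the limit v; k is sent to infinity afterwards.
  -- Two errors are held below η/2 because both enter the estimate for the mass of the tail.
  obtain ⟨i, hi1, hi3, hi4⟩ := ((l12.eventually (lt_mem_nhds (neg_lt_zero.2 hη))).and
    ((l3'.eventually (gt_mem_nhds (half_pos hη))).and
      (l4.eventually (gt_mem_nhds (half_pos hη))))).exists
  have hei := he i
  generalize 1 / ((i : ℝ) + 1) = e at hi1 hi3 hi4 hei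
  clear l1 l2 l3 l4 l12 l3'
  have hp1 := tendsto_integral_norm_sub_rpow hconv
  have hTc := continuous_truncVec (d := d) e
  have k1 := tendsto_integral_lipschitz_comp hp0 h.homog_F h.continuous_F hTc (truncVec_zero e)
    (norm_truncVec_sub_le hei) (fun k => (u k).memLp_fn) hFm hp1
  have k2 := tendsto_integral_lipschitz_comp hp0 h.homog_F h.continuous_F
    (T := fun s => s - truncVec e s) (continuous_id.sub hTc) (by simp [truncVec_zero])
    (norm_sub_truncVec_sub_le hei) (fun k => (u k).memLp_fn) hFm hp1
  have k3 := h.tendsto_integralOf_F hconv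
  obtain ⟨B, hB⟩ : ∃ B, ∀ s : Fin d → ℝ, ‖G (truncVec e s)‖ ≤ B := by
    obtain ⟨C, hC0, hC⟩ := h.homog_G.exists_growth hq h.continuous_G
    refine ⟨C * (2 * e⁻¹) ^ critExp n p, fun s => (hC _).trans ?_⟩
    gcongr
    exact norm_truncVec_le_const hei s
  have k4 := tendsto_integral_comp_of_bounded (h.continuous_G.comp hTc) hB
    (fun k => (u k).memLp_fn.1) hae
  have k5 := h.homog_G.eventually_abs_integral_split_le hq h.continuous_G hei
    (fun k => W0Vec.memLp_fn_critExp hpn (u k)) hGm hM hae hi4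
  have k12 := ((k1.add k2).sub k3).eventually (lt_mem_nhds hi1)
  have k4' := (k4.sub_const (∫ x in Ω, G (v.fn x))).abs.eventually (gt_mem_nhds hi3)
  filter_upwards [k12, k4', k5] with k g1 g2 g3
  have s1 : ∀ H : (Fin d → ℝ) → ℝ, integralOf H (W0Vec.trunc hei (u k)) =
      ∫ x in Ω, H (truncVec e ((u k).fn x)) := fun H => integralOf_congr (W0Vec.fn_trunc hei _)
  have s2 : ∀ H : (Fin d → ℝ) → ℝ, integralOf H (u k - W0Vec.trunc hei (u k)) =
      ∫ x in Ω, H ((u k).fn x - truncVec e ((u k).fn x)) :=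
    fun H => integralOf_congr (W0Vec.fn_sub_trunc hei _)
  simp only [← s1, ← s2, Function.comp_def] at g1 g2 g3
  refine ⟨W0Vec.trunc hei (u k), u k - W0Vec.trunc hei (u k), ?_, ?_, ?_⟩
  · have h1 := h.elliptic.normApowVec_trunc_add_le hΩ hΩb hei (u k)
    simp only [energy]
    linarith
  · change |_ - ∫ x in Ω, G (v.fn x)| ≤ η
    linarith
  · change |(integralOf G (u k)) - _ - _| < _ at g3
    change |_ - integralOf G v| < _ at g2
    rw [hJ] at g3
    -- The mass of the tail is 1 minus that of the truncated part, up to the splitting defect: η/2 +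
    -- η/2.
    rw [abs_lt] at g2 g3
    rw [abs_le]
    constructor <;> linarith [g2.1, g2.2, g3.1, g3.2]

/-- Under `𝒩(A; G) < K(A, F, G)` the energy attains its infimum on the constraint set. -/
theorem exists_minimizer (hpn : p < n) (hΩ : IsOpen Ω) (hΩb : Bornology.IsBounded Ω)
    (hNK : sharpN p Ω A G < energyK p Ω A F G) :
    ∃ u ∈ constraintSet p Ω G, energy A F u = sInf (energy A F '' constraintSet p Ω G) := by
  have hp0 := pos_of_fact p
  have hpq := lt_critExp hp.out hpn
  have hq := hp0.trans hpq
  set m := sInf (energy A F '' constraintSet p Ω G) with hm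
  have hm0 : 0 < m := h.sInf_energy_pos hpn hΩ hΩb
  have hθ0 : 0 < p / critExp n p := by positivity
  have hθ1 : p / critExp n p < 1 := (div_lt_one hq).2 hpq
  have hκ := h.coercivity_const_pos
  set κ := 1 - maxOnSphere p F / lambdaOne p Ω A
  have hseq : ∀ k : ℕ, ∃ w ∈ constraintSet p Ω G, energy A F w < m + 1 / ((k : ℝ) + 1) := by
    intro k
    obtain ⟨_, ⟨w, hw, rfl⟩, hlt⟩ := exists_lt_of_csInf_lt ((h.constraintSet_nonempty hpn).image _)
      (lt_add_of_pos_right m (Nat.one_div_pos_of_nat (α := ℝ) (n := k)))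
    exact ⟨w, hw, hlt⟩
  choose w hwJ hwE using hseq
  have hwE1 : ∀ k, energy A F (w k) ≤ m + 1 := fun k => by
    have h1 : (1 : ℝ) / ((k : ℝ) + 1) ≤ 1 := by
      rw [div_le_one (by positivity)]
      linarith [Nat.cast_nonneg (α := ℝ) k]
    linarith [hwE k]
  have hwN : ∀ k, normApowVec A (w k) ≤ (m + 1) / κ := fun k => by
    rw [le_div_iff₀ hκ, mul_comm]
    exact (h.coercive hΩ hΩb (w k)).trans (hwE1 k)
  have hwNj : ∀ k j, normApow A (w k j) ≤ (m + 1) / κ := fun k j =>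
    (Finset.single_le_sum (f := fun j => normApow A (w k j))
      (fun j _ => h.elliptic.normApow_nonneg hΩ _) (Finset.mem_univ j)).trans (hwN k)
  obtain ⟨l, L, hl, -, hbd⟩ := h.elliptic.exists_gradEnergy_bounds (p := p) hΩ hΩb
  have hnorm : ∃ M', ∀ k j, ‖(w k j : LpPair p Ω)‖ ≤ M' := by
    have hroot : ∀ {a b : ℝ}, 0 ≤ a → a ^ p ≤ b → a ≤ b ^ p⁻¹ := fun {a b} ha hab => by
      have := Real.rpow_le_rpow (by positivity) hab (inv_pos.2 hp0).le
      rwa [← Real.rpow_mul ha, mul_inv_cancel₀ hp0.ne', Real.rpow_one] at this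
    -- The function is controlled through λ₁ and the gradient through the ellipticity bound l.
    refine ⟨max (((m + 1) / κ / lambdaOne p Ω A) ^ p⁻¹) (((m + 1) / κ / l) ^ p⁻¹),
      fun k j => max_le_max ?_ ?_⟩
    · refine hroot (norm_nonneg _) ?_
      rw [← normLpow_eq_norm, le_div_iff₀ h.lambdaOne_pos, mul_comm]
      exact (h.elliptic.lambdaOne_mul_normLpow_le hΩ hΩb _).trans (hwNj k j)
    · refine hroot (norm_nonneg _) ?_
      rw [le_div_iff₀ hl, mul_comm]
      exact (hbd _).1.trans (hwNj k j)
  obtain ⟨M', hM'⟩ := hnorm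
  obtain ⟨σ, v, ℓ, hσ, hlim⟩ := h.elliptic.exists_subseq_limit_vec hΩ hΩb
    (u := w) (M := max ((m + 1) / κ) M') (fun k j => (hwNj k j).trans (le_max_left _ _))
    (fun k j => (hM' k j).trans (le_max_right _ _))
  have hconv := fun j => (hlim j).1
  have hae : ∀ᵐ x ∂(volume.restrict Ω), Tendsto (fun k => (w (σ k)).fn x) atTop (𝓝 (v.fn x)) := by
    filter_upwards [ae_all_iff.2 fun j => (hlim j).2.2.2] with x hx
    exact tendsto_pi_nhds.2 hx
  obtain ⟨S, hS0, hS⟩ := h.elliptic.exists_integral_norm_critExp_le hpn hΩ hΩb d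
  have hM : ∀ k, ∫ x in Ω, ‖(w (σ k)).fn x‖ ^ critExp n p ≤
      S * ((m + 1) / κ) ^ (critExp n p / p) := fun k => (hS _).trans (by
    have := h.elliptic.normApowVec_nonneg hΩ (w (σ k))
    gcongr
    exact hwN _)
  have hE : Tendsto (fun k => energy A F (w (σ k))) atTop (𝓝 m) := by
    have hup : Tendsto (fun k : ℕ => m + 1 / ((k : ℝ) + 1)) atTop (𝓝 m) := by
      simpa using tendsto_one_div_add_atTop_nhds_zero_nat.const_add m
    exact tendsto_of_tendsto_of_tendsto_of_le_of_le tendsto_const_nhds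
      (hup.comp hσ.tendsto_atTop) (fun k => h.sInf_energy_le hΩ hΩb (hwJ _))
      fun k => (hwE _).le
  -- Since ∫ F(w_k) → ∫ F(v), convergence of Φ fixes the limit of the 𝒲_A-energies as m + ∫ F(v);
  -- lower semicontinuity then bounds that of v.
  have hN : Tendsto (fun k => normApowVec A (w (σ k))) atTop (𝓝 (m + integralOf F v)) := by
    refine (hE.add (h.tendsto_integralOf_F hconv)).congr fun k => ?_
    rw [energy, sub_add_cancel]
  have hNv : normApowVec A v ≤ m + integralOf F v := by
    have h1 : Tendsto (fun k => normApowVec A (w (σ k))) atTop (𝓝 (∑ j, ℓ j)) :=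
      tendsto_finsetSum _ fun j _ => (hlim j).2.1
    rw [tendsto_nhds_unique hN h1]
    exact Finset.sum_le_sum fun j _ => (hlim j).2.2.1
  set t := integralOf G v with ht
  have ht0 : 0 ≤ t := h.integralOf_G_nonneg hpn v
  have hab : ∀ i : ℕ, ∃ a b : W0Vec p Ω d,
      energy A F a + energy A F b ≤ m + 1 / ((i : ℝ) + 1) + 1 / ((i : ℝ) + 1) ∧
      |integralOf G a - t| ≤ 1 / ((i : ℝ) + 1) ∧
      |integralOf G b - (1 - t)| ≤ 1 / ((i : ℝ) + 1) := by
    intro i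
    have hi : (0 : ℝ) < 1 / ((i : ℝ) + 1) := Nat.one_div_pos_of_nat
    obtain ⟨k, ⟨a, b, h1, h2, h3⟩, h4⟩ := ((h.eventually_split hpn hΩ hΩb hconv hae hM
      (fun k => hwJ _) hi).and (hE.eventually (gt_mem_nhds (lt_add_of_pos_right m hi)))).exists
    exact ⟨a, b, by linarith, h2, h3⟩
  choose a b habE haJ hbJ using hab
  have hone := tendsto_one_div_add_atTop_nhds_zero_nat (𝕜 := ℝ)
  have ha : Tendsto (fun i => integralOf G (a i)) atTop (𝓝 t) :=
    tendsto_iff_norm_sub_tendsto_zero.2 (squeeze_zero (fun _ => norm_nonneg _) haJ hone)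
  have hb : Tendsto (fun i => integralOf G (b i)) atTop (𝓝 (1 - t)) :=
    tendsto_iff_norm_sub_tendsto_zero.2 (squeeze_zero (fun _ => norm_nonneg _) hbJ hone)
  have ht1 : t ≤ 1 := by
    have := ge_of_tendsto' hb fun i => h.integralOf_G_nonneg hpn (b i)
    linarith
  -- The scale-invariant bound is applied to both pieces, and the errors 1/(i + 1) tend to 0.
  have hsub : m * t ^ (p / critExp n p) + m * (1 - t) ^ (p / critExp n p) ≤ m := by
    have l1 := ((ha.rpow_const (Or.inr hθ0.le)).const_mul m).add
      ((hb.rpow_const (p := p / critExp n p) (Or.inr hθ0.le)).const_mul m)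
    have l2 : Tendsto (fun i : ℕ => m + 1 / ((i : ℝ) + 1) + 1 / ((i : ℝ) + 1)) atTop (𝓝 m) := by
      simpa using (hone.const_add m).add hone
    refine le_of_tendsto_of_tendsto' l1 l2 fun i => ?_
    have h1 := h.sInf_energy_mul_le hpn hΩ hΩb (a i)
    have h2 := h.sInf_energy_mul_le hpn hΩ hΩb (b i)
    linarith [habE i]
  have hsub' : t ^ (p / critExp n p) + (1 - t) ^ (p / critExp n p) ≤ 1 := by
    refine le_of_mul_le_mul_left ?_ hm0
    linarith
  rcases eq_zero_or_eq_one_of_rpow_add_le ht0 ht1 hθ1 hsub' with h0 | h1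
  -- No mass in the limit: v = 0, so the L^p term of the Sobolev inequality disappears and only C₁ m
  -- remains, which is less than 1 as C₁ < K = m⁻¹.
  · exfalso
    obtain ⟨C₁, C₂, hC, hlt⟩ := h.exists_sobolevIneq_lt hpn hΩ hΩb hNK
    have hv0 := h.fn_ae_eq_zero_of_integralOf_G hpn h0
    have hF0 : integralOf F v = 0 := by
      rw [integralOf, integralOf_congr hv0]
      simp [h.homog_F.map_zero hp0]
    have hvj : ∀ j, (v j : LpPair p Ω).1 = 0 := fun j => by
      refine (Lp.eq_zero_iff_ae_eq_zero).2 ?_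
      filter_upwards [hv0] with x hx
      exact congrFun hx j
    have hLp : Tendsto (fun k => normLpowVec (w (σ k))) atTop (𝓝 0) := by
      have h1 : Tendsto (fun k => normLpowVec (w (σ k))) atTop (𝓝 (∑ _j : Fin d, 0)) := by
        refine tendsto_finsetSum _ fun j _ => ?_
        have h2 := tendsto_norm_sub_rpow hp0 (hconv j)
        simp only [hvj, sub_zero] at h2
        exact h2.congr fun k => (normLpow_eq_norm _).symm
      simpa using h1
    rw [hF0, add_zero] at hN
    have h1 : 1 ≤ C₁ * m + C₂ * 0 := by
      refine ge_of_tendsto' ((hN.const_mul C₁).add (hLp.const_mul C₂)) fun k => ?_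
      have := hC (w (σ k))
      rwa [show integralOf G (w (σ k)) = 1 from hwJ _, Real.one_rpow] at this
    have h2 : C₁ * m < 1 := by
      rw [energyK, ← hm] at hlt
      calc C₁ * m < m⁻¹ * m := by gcongr
        _ = 1 := inv_mul_cancel₀ hm0.ne'
    linarith
  -- All the mass is kept, so v is admissible and Φ(v) ≤ m.
  · refine ⟨v, h1, le_antisymm ?_ (h.sInf_energy_le hΩ hΩb h1)⟩
    rw [energy]
    linarith

end AssumptionsAFG

/-! ### Differentiability of the functionals along lines -/

/-- Furnishes the integrable majorants for differentiation under the integral: b ≤ a + b restores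
the full power r. -/
lemma rpow_sub_one_mul_le {a b r : ℝ} (ha : 0 ≤ a) (hb : 0 ≤ b) (hr : 1 < r) :
    (a + b) ^ (r - 1) * b ≤ 2 ^ r * (a ^ r + b ^ r) := by
  refine le_trans ?_ (add_rpow_le_two_rpow ha hb (by linarith))
  rcases hb.eq_or_lt with rfl | hb
  · rw [mul_zero]
    positivity
  calc (a + b) ^ (r - 1) * b ≤ (a + b) ^ (r - 1) * (a + b) := by gcongr; linarith
    _ = (a + b) ^ r := by
        rw [← Real.rpow_add_one (by positivity)]
        congr 1
        ring

section HomogeneousDerivative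

variable {d : ℕ} {r : ℝ} {H : (Fin d → ℝ) → ℝ}

/-- Both sides of H(ρ s) = ρ^r H(s) are differentiated in s and one factor ρ is divided out. -/
lemma Homog.partialD (hH : Homog r H) (hd : Differentiable ℝ H) (j : Fin d) :
    Homog (r - 1) (partialD H j) := fun ρ s hρ => by
  have h1 : HasFDerivAt (fun s : Fin d → ℝ => H (ρ • s)) (ρ • fderiv ℝ H (ρ • s)) s := by
    have h2 : HasFDerivAt (fun s : Fin d → ℝ => ρ • s)
        (ρ • ContinuousLinearMap.id ℝ (Fin d → ℝ)) s := (hasFDerivAt_id s).const_smul ρ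
    have h3 := (hd (ρ • s)).hasFDerivAt.comp s h2
    rwa [ContinuousLinearMap.comp_smul, ContinuousLinearMap.comp_id] at h3
  have h2 : HasFDerivAt (fun s : Fin d → ℝ => H (ρ • s)) (ρ ^ r • fderiv ℝ H s) s := by
    have h3 : (fun s : Fin d → ℝ => H (ρ • s)) = fun s => ρ ^ r • H s :=
      funext fun s => hH ρ s hρ
    rw [h3]
    exact (hd s).hasFDerivAt.const_smul (ρ ^ r)
  have h3 := congrArg (fun L : (Fin d → ℝ) →L[ℝ] ℝ => L (Pi.single j 1)) (h1.unique h2)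
  simp only [smul_apply, smul_eq_mul] at h3
  rw [AnisoSystem.partialD, AnisoSystem.partialD, Real.rpow_sub_one hρ.ne']
  field_simp
  linarith

lemma continuous_partialD (hH : ContDiff ℝ 1 H) (j : Fin d) : Continuous (partialD H j) :=
  (hH.continuous_fderiv (by simp)).clm_apply continuous_const

/-- Differentiation under the integral. The partial derivative grows like ‖·‖^(r - 1), so for |s| <
1 the derivative of the integrand is at most a constant times ‖f‖^r + |φ|^r. -/
lemma Homog.hasDerivAt_integral {α : Type*} [MeasurableSpace α] {μ : Measure α} (hr : 1 < r)
    (hH : Homog r H) (hHd : ContDiff ℝ 1 H) {f : α → Fin d → ℝ} {φ : α → ℝ}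
    (hf : MemLp f (ENNReal.ofReal r) μ) (hφ : MemLp φ (ENNReal.ofReal r) μ) (j : Fin d) :
    Integrable (fun x => AnisoSystem.partialD H j (f x) * φ x) μ ∧
      HasDerivAt (fun s : ℝ => ∫ x, H (f x + s • φ x • Pi.single j 1) ∂μ)
        (∫ x, AnisoSystem.partialD H j (f x) * φ x ∂μ) 0 := by
  have hr0 : 0 < r := by linarith
  have hdiff : Differentiable ℝ H := hHd.differentiable (by simp)
  have hPc := continuous_partialD hHd j
  obtain ⟨C, hC0, hC⟩ := (hH.partialD hdiff j).exists_growth (by linarith : 0 < r - 1) hPc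
  obtain ⟨e, he⟩ : ∃ e : Fin d → ℝ, e = Pi.single j 1 := ⟨_, rfl⟩
  have hen : ‖e‖ = 1 := by rw [he, Pi.norm_single, norm_one]
  rw [← he]
  have hmeas : ∀ s : ℝ, AEStronglyMeasurable (fun x => f x + s • φ x • e) μ :=
    fun s => hf.1.add ((hφ.1.smul_const e).const_smul s)
  have hbound : ∀ᵐ x ∂μ, ∀ s ∈ Metric.ball (0 : ℝ) 1,
      ‖AnisoSystem.partialD H j (f x + s • φ x • e) * φ x‖ ≤
        C * (2 ^ r * (‖f x‖ ^ r + ‖φ x‖ ^ r)) := ae_of_all _ fun x s hs => by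
    rw [norm_mul, Real.norm_eq_abs]
    have h1 : ‖f x + s • φ x • e‖ ≤ ‖f x‖ + ‖φ x‖ := by
      refine (norm_add_le _ _).trans (add_le_add le_rfl ?_)
      rw [norm_smul, norm_smul, hen, mul_one]
      exact mul_le_of_le_one_left (norm_nonneg _) (mem_ball_zero_iff.1 hs).le
    calc _ ≤ C * ‖f x + s • φ x • e‖ ^ (r - 1) * ‖φ x‖ := by
          gcongr
          exact hC _
      _ ≤ C * (‖f x‖ + ‖φ x‖) ^ (r - 1) * ‖φ x‖ := by
          have : 0 ≤ r - 1 := by linarith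
          gcongr
      _ = C * ((‖f x‖ + ‖φ x‖) ^ (r - 1) * ‖φ x‖) := by ring
      _ ≤ _ := mul_le_mul_of_nonneg_left
          (rpow_sub_one_mul_le (norm_nonneg _) (norm_nonneg _) hr) hC0
  have hderiv : ∀ᵐ x ∂μ, ∀ s ∈ Metric.ball (0 : ℝ) 1,
      HasDerivAt (fun s : ℝ => H (f x + s • φ x • e))
        (AnisoSystem.partialD H j (f x + s • φ x • e) * φ x) s := ae_of_all _ fun x s _ => by
    have h1 : HasDerivAt (fun s : ℝ => f x + s • φ x • e) (φ x • e) s := by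
      simpa using ((hasDerivAt_id s).smul_const (φ x • e)).const_add (f x)
    have h2 := (hdiff (f x + s • φ x • e)).hasFDerivAt.comp_hasDerivAt s h1
    rw [map_smul, smul_eq_mul, mul_comm, he] at h2
    rw [he]
    exact h2
  have hint : Integrable (fun x => H (f x + (0 : ℝ) • φ x • e)) μ := by
    simp only [zero_smul, add_zero]
    exact hH.integrable_comp hr0 hHd.continuous hf
  have hbi : Integrable (fun x => C * (2 ^ r * (‖f x‖ ^ r + ‖φ x‖ ^ r))) μ :=
    (((integrable_norm_rpow hr0 hf).add (integrable_norm_rpow hr0 hφ)).const_mul _).const_mul _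
  have hm' : AEStronglyMeasurable
      (fun x => AnisoSystem.partialD H j (f x + (0 : ℝ) • φ x • e) * φ x) μ :=
    (hPc.comp_aestronglyMeasurable (hmeas 0)).mul hφ.1
  have key := hasDerivAt_integral_of_dominated_loc_of_deriv_le
    (F := fun s x => H (f x + s • φ x • e))
    (F' := fun s x => AnisoSystem.partialD H j (f x + s • φ x • e) * φ x)
    (Metric.ball_mem_nhds (0 : ℝ) one_pos)
    (Eventually.of_forall fun s => hHd.continuous.comp_aestronglyMeasurable (hmeas s))
    hint hm' hbound hbi hderiv
  simp only [zero_smul, add_zero] at key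
  exact key

end HomogeneousDerivative

section EnergyDerivative

variable {n d : ℕ} {p : ℝ} [hp : Fact (1 < p)] {Ω : Set (Eucl n)}
  {A : Eucl n → Matrix (Fin n) (Fin n) ℝ}

/-- The integrand `⟨A ξ, ξ⟩^{(p-2)/2} ⟨A ξ, η⟩` of the weak formulation. -/
def fluxPairing (p : ℝ) (M : Matrix (Fin n) (Fin n) ℝ) (ξ η : Eucl n) : ℝ :=
  (matForm M ξ ξ) ^ ((p - 2) / 2) * matForm M ξ η

lemma fluxPairing_eq_of_factor {M : Matrix (Fin n) (Fin n) ℝ} {B : Eucl n →ₗ[ℝ] Eucl n}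
    (hB : ∀ ξ η, matForm M ξ η = inner ℝ (B ξ) (B η)) (p : ℝ) (ξ η : Eucl n) :
    fluxPairing p M ξ η = ‖B ξ‖ ^ (p - 2) * inner ℝ (B ξ) (B η) := by
  rw [fluxPairing, rpow_half_of_eq_norm_sq (v := B ξ)
    (by rw [hB, real_inner_self_eq_norm_sq]) (p - 2), hB]

omit hp in
lemma abs_norm_rpow_mul_inner_le {E : Type*} [NormedAddCommGroup E] [InnerProductSpace ℝ E]
    (v w : E) : |‖v‖ ^ (p - 2) * inner ℝ v w| ≤ ‖v‖ ^ (p - 1) * ‖w‖ := by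
  -- Separated because p - 2 may be negative; the inner product then vanishes.
  rcases eq_or_ne v 0 with rfl | hv
  · simp only [inner_zero_left, mul_zero, abs_zero]
    positivity
  have hn : 0 < ‖v‖ := norm_pos_iff.2 hv
  rw [abs_mul, abs_of_nonneg (by positivity)]
  calc _ ≤ ‖v‖ ^ (p - 2) * (‖v‖ * ‖w‖) := by gcongr; exact abs_real_inner_le_norm v w
    _ = ‖v‖ ^ (p - 1) * ‖w‖ := by
        rw [← mul_assoc, ← Real.rpow_add_one hn.ne']
        congr 2
        ring

omit hp in
lemma hasDerivAt_norm_rpow_line {E : Type*} [NormedAddCommGroup E] [InnerProductSpace ℝ E]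
    (hp1 : 1 < p) (a b : E) (s : ℝ) : HasDerivAt (fun s : ℝ => ‖a + s • b‖ ^ p)
      (p * (‖a + s • b‖ ^ (p - 2) * inner ℝ (a + s • b) b)) s := by
  have h1 : HasDerivAt (fun s : ℝ => a + s • b) b s := by
    simpa using ((hasDerivAt_id s).smul_const b).const_add a
  have h2 := (hasFDerivAt_norm_rpow (a + s • b) hp1).comp_hasDerivAt s h1
  refine h2.congr_deriv ?_
  simp only [smul_apply, innerSL_apply_apply, smul_eq_mul, mul_assoc]

/-- Through the factor B the integrand is ‖B(g + s γ)‖^p, differentiable also at the origin since p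
> 1. Only the upper bound L enters the majorant, so it does not depend on x. -/
lemma IsElliptic.hasDerivAt_integral_density (hA : IsElliptic Ω A) (hΩ : IsOpen Ω)
    (hΩb : Bornology.IsBounded Ω) {g γ : Eucl n → Eucl n}
    (hg : MemLp g (ENNReal.ofReal p) (volume.restrict Ω))
    (hγ : MemLp γ (ENNReal.ofReal p) (volume.restrict Ω)) :
    HasDerivAt (fun s : ℝ => ∫ x in Ω, density p A x (g x + s • γ x))
      (∫ x in Ω, p * fluxPairing p (A x) (g x) (γ x)) 0 := by
  have hp0 := pos_of_fact p
  have hp1 := hp.out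
  obtain ⟨l, L, hl, hL, hfac⟩ := hA.exists_factor hΩb
  have hline : ∀ s : ℝ, MemLp (fun x => g x + s • γ x) (ENNReal.ofReal p) (volume.restrict Ω) :=
    fun s => hg.add (hγ.const_smul s)
  have hflux : AEStronglyMeasurable (fun x => p * fluxPairing p (A x) (g x + (0 : ℝ) • γ x) (γ x))
      (volume.restrict Ω) := by
    have h1 := hA.aestronglyMeasurable_matForm hΩ (hline 0).1 (hline 0).1
    have h2 := hA.aestronglyMeasurable_matForm hΩ (hline 0).1 hγ.1
    exact ((h1.aemeasurable.pow_const ((p - 2) / 2)).aestronglyMeasurable.mul h2).const_mul p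
  have key := hasDerivAt_integral_of_dominated_loc_of_deriv_le (μ := volume.restrict Ω)
    (x₀ := (0 : ℝ)) (s := Metric.ball 0 1)
    (F := fun s x => density p A x (g x + s • γ x))
    (F' := fun s x => p * fluxPairing p (A x) (g x + s • γ x) (γ x))
    (bound := fun x => p * (L ^ p * (2 ^ p * (‖g x‖ ^ p + ‖γ x‖ ^ p))))
    (Metric.ball_mem_nhds _ one_pos)
    (Eventually.of_forall fun s => hA.aestronglyMeasurable_density hΩ (hline s).1 p)
    (hA.integrable_density hΩ hΩb hp1 (hline 0)) hflux ?_
    (((((integrable_norm_rpow hp0 hg).add (integrable_norm_rpow hp0 hγ)).const_mul _).const_mul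
      _).const_mul _) ?_
  · simpa using key.2
  · filter_upwards [ae_restrict_mem_closure hΩ] with x hx s hs
    obtain ⟨B, hB, hb⟩ := hfac x hx
    rw [norm_mul, Real.norm_of_nonneg hp0.le, fluxPairing_eq_of_factor hB]
    refine mul_le_mul_of_nonneg_left ?_ hp0.le
    have h1 : ‖B (g x + s • γ x)‖ ≤ L * (‖g x‖ + ‖γ x‖) := by
      refine (hb _).2.trans (mul_le_mul_of_nonneg_left ?_ hL.le)
      refine (norm_add_le _ _).trans (add_le_add le_rfl ?_)
      rw [norm_smul]
      exact mul_le_of_le_one_left (norm_nonneg _) (mem_ball_zero_iff.1 hs).le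
    have hp2 : 0 ≤ p - 1 := by linarith
    calc _ ≤ ‖B (g x + s • γ x)‖ ^ (p - 1) * ‖B (γ x)‖ := abs_norm_rpow_mul_inner_le _ _
      _ ≤ (L * (‖g x‖ + ‖γ x‖)) ^ (p - 1) * (L * ‖γ x‖) := by
          gcongr
          exact (hb _).2
      _ = L ^ p * ((‖g x‖ + ‖γ x‖) ^ (p - 1) * ‖γ x‖) := by
          rw [Real.mul_rpow hL.le (by positivity), Real.rpow_sub_one hL.ne']
          field_simp
      _ ≤ _ := mul_le_mul_of_nonneg_left
          (rpow_sub_one_mul_le (norm_nonneg _) (norm_nonneg _) hp1) (by positivity)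
  · filter_upwards [ae_restrict_mem_closure hΩ] with x hx s _
    obtain ⟨B, hB, -⟩ := hfac x hx
    simp only [density_eq_of_factor hB, fluxPairing_eq_of_factor hB, map_add, map_smul]
    exact hasDerivAt_norm_rpow_line hp1 _ _ _

lemma IsElliptic.hasDerivAt_normApow (hA : IsElliptic Ω A) (hΩ : IsOpen Ω)
    (hΩb : Bornology.IsBounded Ω) (u φ : W0 p Ω) :
    HasDerivAt (fun s : ℝ => normApow A (u + s • φ))
      (∫ x in Ω, p * fluxPairing p (A x) (W0.grad u x) (W0.grad φ x)) 0 := by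
  refine (hA.hasDerivAt_integral_density hΩ hΩb (W0.memLp_grad u) (W0.memLp_grad φ)).congr_deriv
    rfl |>.congr_of_eventuallyEq (Eventually.of_forall fun s => ?_)
  refine integral_congr_ae ?_
  filter_upwards [W0.grad_add u (s • φ), W0.grad_smul s φ] with x h1 h2
  simp only [density]
  rw [h1, h2]

lemma IsElliptic.hasDerivAt_normApowVec (hA : IsElliptic Ω A) (hΩ : IsOpen Ω)
    (hΩb : Bornology.IsBounded Ω) (u : W0Vec p Ω d) (j : Fin d) (φ : W0 p Ω) :
    HasDerivAt (fun s : ℝ => normApowVec A (u + s • (Pi.single j φ : W0Vec p Ω d)))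
      (∫ x in Ω, p * fluxPairing p (A x) (W0.grad (u j) x) (W0.grad φ x)) 0 := by
  have h1 : ∀ i ∈ Finset.univ, HasDerivAt
      (fun s : ℝ => normApow A ((u + s • (Pi.single j φ : W0Vec p Ω d)) i))
      (if i = j then ∫ x in Ω, p * fluxPairing p (A x) (W0.grad (u j) x) (W0.grad φ x) else 0)
      0 := fun i _ => by
    by_cases hij : i = j
    · subst hij
      simpa using hA.hasDerivAt_normApow hΩ hΩb (u i) φ
    · simpa [hij] using hasDerivAt_const (0 : ℝ) (normApow A (u i))
  have h2 := HasDerivAt.fun_sum h1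
  simpa [normApowVec] using h2

lemma Homog.hasDerivAt_integralOf {r : ℝ} (hr : 1 < r) {H : (Fin d → ℝ) → ℝ} (hH : Homog r H)
    (hHd : ContDiff ℝ 1 H) {u : W0Vec p Ω d} {φ : W0 p Ω}
    (hu : MemLp u.fn (ENNReal.ofReal r) (volume.restrict Ω))
    (hφ : MemLp (W0.fn φ) (ENNReal.ofReal r) (volume.restrict Ω)) (j : Fin d) :
    HasDerivAt (fun s : ℝ => integralOf H (u + s • (Pi.single j φ : W0Vec p Ω d)))
      (∫ x in Ω, AnisoSystem.partialD H j (u.fn x) * W0.fn φ x) 0 := by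
  refine (hH.hasDerivAt_integral hr hHd hu hφ j).2.congr_of_eventuallyEq
    (Eventually.of_forall fun s => ?_)
  refine integralOf_congr ?_
  have h0 : W0.fn (0 : W0 p Ω) =ᵐ[volume.restrict Ω] 0 := Lp.coeFn_zero _ _ _
  filter_upwards [W0Vec.fn_add u (s • (Pi.single j φ : W0Vec p Ω d)),
    W0Vec.fn_smul s (Pi.single j φ : W0Vec p Ω d), h0] with x h1 h2 h3
  rw [h1, h2]
  congr 2
  funext i
  by_cases hij : i = j
  · subst hij
    simp [W0Vec.fn]
  · simp [W0Vec.fn, hij, h3]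

end EnergyDerivative

/-! ### The Euler–Lagrange equation and the rescaled solution -/

namespace AssumptionsAFG

variable {n d : ℕ} {p : ℝ} [hp : Fact (1 < p)] {Ω : Set (Eucl n)}
  {A : Eucl n → Matrix (Fin n) (Fin n) ℝ} {F G : (Fin d → ℝ) → ℝ}
  (h : AssumptionsAFG p Ω A F G)
include h

/-- The Euler–Lagrange equation of a minimizer. -/
lemma euler_lagrange (hpn : p < n) (hΩ : IsOpen Ω) (hΩb : Bornology.IsBounded Ω)
    {u : W0Vec p Ω d} (hu : u ∈ constraintSet p Ω G)
    (hmin : energy A F u = sInf (energy A F '' constraintSet p Ω G)) (j : Fin d) (φ : W0 p Ω) :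
    ∫ x in Ω, fluxPairing p (A x) (W0.grad (u j) x) (W0.grad φ x) =
      1 / p * (∫ x in Ω, partialD F j (u.fn x) * W0.fn φ x) +
        sInf (energy A F '' constraintSet p Ω G) / critExp n p *
          ∫ x in Ω, partialD G j (u.fn x) * W0.fn φ x := by
  have hp0 := pos_of_fact p
  have hpq := lt_critExp hp.out hpn
  have hq := hp0.trans hpq
  set m := sInf (energy A F '' constraintSet p Ω G)
  have hu1 : integralOf G u = 1 := hu
  have d1 := h.elliptic.hasDerivAt_normApowVec hΩ hΩb u j φ
  have d2 := h.homog_F.hasDerivAt_integralOf hp.out h.contDiff_F (W0Vec.memLp_fn u)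
    (W0.memLp_fn φ) j
  have d3 := h.homog_G.hasDerivAt_integralOf (hp.out.trans hpq) h.contDiff_G
    (W0Vec.memLp_fn_critExp hpn u) (W0.memLp_fn_critExp hpn φ) j
  -- The outer power is differentiable because its base is ∫ G(u) = 1 ≠ 0.
  have d4 := (d3.rpow_const (p := p / critExp n p) (Or.inl (by simp [hu1]))).const_mul m
  have d5 := (d1.sub d2).sub d4
  -- Nonnegative for every s by the scale-invariant inequality, and zero at s = 0 because u is a
  -- minimizer; no curve inside the constraint set is needed.
  have hloc : IsLocalMin ((((fun s : ℝ => normApowVec A (u + s • (Pi.single j φ : W0Vec p Ω d))) -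
      fun s : ℝ => integralOf F (u + s • (Pi.single j φ : W0Vec p Ω d)))) - fun s : ℝ =>
      m * integralOf G (u + s • (Pi.single j φ : W0Vec p Ω d)) ^ (p / critExp n p)) 0 := by
    refine Eventually.of_forall fun s => ?_
    have h1 := h.sInf_energy_mul_le hpn hΩ hΩb (u + s • (Pi.single j φ : W0Vec p Ω d))
    simp only [Pi.sub_apply, zero_smul, add_zero, hu1, Real.one_rpow, mul_one]
    rw [← energy, ← energy, hmin, sub_self]
    linarith
  have h0 := hloc.hasDerivAt_eq_zero d5
  simp only [zero_smul, add_zero, hu1, Real.one_rpow, mul_one, integral_const_mul] at h0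
  field_simp
  field_simp at h0
  linarith

/-- A multiple of a minimizer solves the system. -/
theorem exists_weakSolution (hpn : p < n) (hΩ : IsOpen Ω) (hΩb : Bornology.IsBounded Ω)
    {u : W0Vec p Ω d} (hu : u ∈ constraintSet p Ω G)
    (hmin : energy A F u = sInf (energy A F '' constraintSet p Ω G)) :
    ∃ w : W0Vec p Ω d, IsNontrivial w ∧ IsWeakSolution A F G w := by
  have hp0 := pos_of_fact p
  have hpq := lt_critExp hp.out hpn
  have hq := hp0.trans hpq
  have hm0 := h.sInf_energy_pos hpn hΩ hΩb
  have hEL := h.euler_lagrange hpn hΩ hΩb hu hmin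
  set m := sInf (energy A F '' constraintSet p Ω G)
  have hu1 : integralOf G u = 1 := hu
  have hqp : 0 < critExp n p - p := by linarith
  -- The flux and ∂F scale by c^(p - 1), ∂G by c^(p* - 1). The choice c^(p* - p) = m gives m c^(p -
  -- 1) = c^(p* - 1), which absorbs the multiplier.
  set c : ℝ := m ^ (critExp n p - p)⁻¹ with hc
  have hc0 : 0 < c := by positivity
  have hcm : m * c ^ (p - 1) = c ^ (critExp n p - 1) := by
    have h1 : m = c ^ (critExp n p - p) := by
      rw [hc, ← Real.rpow_mul hm0.le, inv_mul_cancel₀ hqp.ne', Real.rpow_one]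
    rw [h1, ← Real.rpow_add hc0]
    congr 1
    ring
  refine ⟨c • u, ?_, fun j φ => ?_⟩
  · by_contra hne
    rw [IsNontrivial] at hne
    push Not at hne
    have h1 : W0Vec.fn (c • u) =ᵐ[volume.restrict Ω] fun _ => 0 := by
      filter_upwards [ae_all_iff.2 hne] with x hx
      funext j
      exact hx j
    -- Nontriviality: a vanishing c u would have zero G-integral, whereas homogeneity gives c^(p*) >
    -- 0.
    have h2 : integralOf G (c • u) = 0 := by
      rw [integralOf, integralOf_congr h1]
      simp [h.homog_G.map_zero hq]
    rw [h.homog_G.integralOf_smul hc0, hu1, mul_one] at h2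
    exact (Real.rpow_pos_of_pos hc0 _).ne' h2
  · have iF := (h.homog_F.hasDerivAt_integral hp.out h.contDiff_F (W0Vec.memLp_fn u)
      (W0.memLp_fn φ) j).1
    have iG := (h.homog_G.hasDerivAt_integral (hp.out.trans hpq) h.contDiff_G
      (W0Vec.memLp_fn_critExp hpn u) (W0.memLp_fn_critExp hpn φ) j).1
    have hF' := h.homog_F.partialD (h.contDiff_F.differentiable (by simp)) j
    have hG' := h.homog_G.partialD (h.contDiff_G.differentiable (by simp)) j
    obtain ⟨l, L, -, -, hfac⟩ := h.elliptic.exists_factor hΩb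
    have e1 : ∫ x in Ω, (matForm (A x) (W0.grad ((c • u) j) x) (W0.grad ((c • u) j) x)) ^
        ((p - 2) / 2) * matForm (A x) (W0.grad ((c • u) j) x) (W0.grad φ x) =
        ∫ x in Ω, c ^ (p - 1) * fluxPairing p (A x) (W0.grad (u j) x) (W0.grad φ x) := by
      refine integral_congr_ae ?_
      filter_upwards [ae_restrict_mem_closure hΩ, W0.grad_smul c (u j)] with x hx h1
      obtain ⟨B, hB, -⟩ := hfac x hx
      rw [Pi.smul_apply, h1]
      change fluxPairing p (A x) _ _ = _
      rw [fluxPairing_eq_of_factor hB, fluxPairing_eq_of_factor hB, map_smul, norm_smul,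
        Real.norm_of_nonneg hc0.le, Real.mul_rpow hc0.le (norm_nonneg _), real_inner_smul_left,
        show p - 1 = (p - 2) + 1 by ring, Real.rpow_add_one hc0.ne']
      ring
    have e2 : ∫ x in Ω, (1 / p * partialD F j ((c • u : W0Vec p Ω d).fn x) +
        1 / critExp n p * partialD G j ((c • u : W0Vec p Ω d).fn x)) * W0.fn φ x =
        ∫ x in Ω, (c ^ (p - 1) * (1 / p) * (partialD F j (u.fn x) * W0.fn φ x) +
          c ^ (critExp n p - 1) * (1 / critExp n p) * (partialD G j (u.fn x) * W0.fn φ x)) := by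
      refine integral_congr_ae ?_
      filter_upwards [W0Vec.fn_smul c u] with x h1
      rw [h1, hF' c _ hc0, hG' c _ hc0]
      ring
    rw [e1, e2, integral_add (iF.const_mul _) (iG.const_mul _), integral_const_mul,
      integral_const_mul, integral_const_mul, hEL j φ, ← hcm]
    ring

end AssumptionsAFG

end AnisoSystem

end

/-! ### The main theorem -/

theorem proposition3 {n d : ℕ} (p : ℝ) [Fact (1 < p)] (hpn : p < n)
    (Ω : Set (AnisoSystem.Eucl n)) (hΩ : IsOpen Ω) (hΩb : Bornology.IsBounded Ω)
    (A : AnisoSystem.Eucl n → Matrix (Fin n) (Fin n) ℝ) (F G : (Fin d → ℝ) → ℝ)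
    (hAFG : AnisoSystem.AssumptionsAFG p Ω A F G)
    (hNK : AnisoSystem.sharpN p Ω A G < AnisoSystem.energyK p Ω A F G) :
    (∃ u ∈ AnisoSystem.constraintSet p Ω G,
      AnisoSystem.energy A F u = (AnisoSystem.energyK p Ω A F G)⁻¹ ∧
      ∀ v ∈ AnisoSystem.constraintSet p Ω G,
        AnisoSystem.energy A F u ≤ AnisoSystem.energy A F v) ∧
    (∃ u : AnisoSystem.W0Vec p Ω d,
      AnisoSystem.IsNontrivial u ∧ AnisoSystem.IsWeakSolution A F G u) := by
  obtain ⟨u, hu, hmin⟩ := hAFG.exists_minimizer hpn hΩ hΩb hNK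
  refine ⟨⟨u, hu, ?_, fun v hv => ?_⟩, hAFG.exists_weakSolution hpn hΩ hΩb hu hmin⟩
  · rw [hmin, AnisoSystem.energyK, inv_inv]
  · rw [hmin]
    exact hAFG.sInf_energy_le hΩ hΩb hv
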